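/- **Setting.** Let $\mathcal U=[-1,1]^{\mathbb N}$, let $\varrho$ be the uniform probability measure on $\mathcal U$ (the infinite product of $\frac12\,dy$ on $[-1,1]$), let $\mathcal V$ be a nontrivial real or complex Hilbert space, and let $L^2_\varrho(\mathcal U;\mathcal V)$ be the Lebesgue–Bochner space. Let $\mathcal W$ be a complex Banach space containing $\mathcal V$ isometrically and real-linearly ($\mathcal W=\mathcal V$ if $\mathcal V$ is complex, a complexification of $\mathcal V$ if $\mathcal V$ is real). *Holomorphic classes.* For $\rho\ge 1$ let $\mathcal E_\rho=\{\frac12(z+z^{-1}):1\le|z|\le\rho\}\subset\mathbb C$, and $\mathcal E_{\boldsymbol\rho}=\prod_i\mathcal E_{\rho_i}$. For $\boldsymbol b\in[0,\infty)^{\mathbb N}$ let $\mathcal R(\boldsymbol b)$ be the union of all $\mathcal E_{\boldsymbol\rho}$ with $\boldsymbol\rho\in[1,\infty)^{\mathbb N}$ and $\sum_i\big(\frac{\rho_i+\rho_i^{-1}}2-1\big)b_i\le1$. Let $\mathcal H(\boldsymbol b)$ be the class of functions $f:\mathcal U\to\mathcal V$, continuous for the product topology, that extend to a function $F:\mathcal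 R(\boldsymbol b)\to\mathcal W$ with $\sup_{\mathcal R(\boldsymbol b)}\|F\|\le1$ which is holomorphic, i.e. on each of the polyellipses $\mathcal E_{\boldsymbol\rho}$ above it is holomorphic in every finite group of variables (in the interior of the ellipses of these variables), the other variables being fixed. Put $\|\boldsymbol b\|_{p,\mathsf M}=\big(\sum_i\sup_{j\ge i}|b_j|^p\big)^{1/p}$, $\ell^p_{\mathsf M}(\mathbb N)=\{\boldsymbol b:\|\boldsymbol b\|_{p,\mathsf M}<\infty\}$ and $\mathcal H(p,\mathsf M)=\bigcup\{\mathcal H(\boldsymbol b):\boldsymbol b\in[0,\infty)^{\mathbb N},\ \|\boldsymbol b\|_{p,\mathsf M}\le1\}$. *Sampling operators and widths.* Let $\mathcal Y$ be a vector subspace of $L^2_\varrho(\mathcal U;\mathcal V)$ with a norm for which the inclusion is continuous. An adaptive sampling operator is a map $\mathcal L:\mathcal Y\to\mathcal V^m$ with $\mathcal L(f)_i=L_i(f;\mathcal L(f)_1,\dots,\mathcal L(f)_{i-1})$, each $L_i$ being bounded and linear in $f$, such that there are $v,w\in\mathcal V\setminus\{0\}$, a normed space $\widetilde{\mathcal Y}\subseteq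 L^2_\varrho(\mathcal U;\mathbb R)$ and an operator $\widetilde{\mathcal L}:\widetilde{\mathcal Y}\to\mathbb R^m$ of the same adaptive form with: if $g\in L^2_\varrho(\mathcal U;\mathbb R)$ and $vg\in\mathcal Y$, then $g\in\widetilde{\mathcal Y}$ and $\mathcal L(vg)=w\,\widetilde{\mathcal L}(g)$. For $\mathcal H(p,\mathsf M)\subseteq\mathcal Y$ let $$\theta_m(p,\mathsf M)=\inf_{\mathcal L,\mathcal T}\ \sup_{f\in\mathcal H(p,\mathsf M)}\|f-\mathcal T(\mathcal L(f))\|_{L^2_\varrho(\mathcal U;\mathcal V)},$$ over all adaptive sampling operators $\mathcal L:\mathcal Y\to\mathcal V^m$ and all maps $\mathcal T:\mathcal V^m\to L^2_\varrho(\mathcal U;\mathcal V)$. *The random scheme.* For $m\ge3$ let $n=\lceil m/\log^2 m\rceil$, let $\Lambda$ be the set of finitely supported $\boldsymbol\nu\in\mathbb N_0^{\mathbb N}$ with $\prod_k(\nu_k+1)\le n$ and $\nu_k=0$ for $k\ge n$, $\Lambda=\{\boldsymbol\nu_1,\dots,\boldsymbol\nu_N\}$, $\ell=mN$, and let $\Psi_{\boldsymbol\nu}$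 be the tensor product orthonormal Legendre polynomials. Let $\boldsymbol r\sim\mathcal N(0,I_\ell)$ have the entries $a_{ij}$, $i\le m$, $j\le N$, and let $\boldsymbol A=m^{-1/2}(a_{ij})$, acting from $\mathcal V^N$ to $\mathcal V^m$. Define $$\mathcal L_{\boldsymbol r}(f)=\Big(\int_{\mathcal U}f\;\tfrac1{\sqrt m}\sum_{j=1}^N a_{ij}\Psi_{\boldsymbol\nu_j}\,d\varrho\Big)_{i=1}^m ,$$ and $\mathcal T_{\boldsymbol r}(\boldsymbol v)=\sum_{j=1}^N\hat c_j\Psi_{\boldsymbol\nu_j}$ if $\boldsymbol v\in\mathrm{Ran}(\boldsymbol A)$, where $\hat{\boldsymbol c}$ is the element of least norm $(\sum_j\|z_j\|^2)^{1/2}$ among the minimizers of $\sum_j\|z_j\|$ over $\{\boldsymbol z\in\mathcal V^N:\boldsymbol A\boldsymbol z=\boldsymbol v\}$, and $\mathcal T_{\boldsymbol r}(\boldsymbol v)=0$ otherwise. These maps do not depend on $\boldsymbol b$, $p$, $q$. $\mathbb E$ denotes the expectation over $\boldsymbol r$ (the upper expectation, i.e. the infimum of the expectations of measurable majorants, so that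 no measurability of the supremum is presupposed). **Theorem.** For every $m\ge3$ the following holds. For every $\boldsymbol r$, $\mathcal T_{\boldsymbol r}$ is well defined (the minimizer $\hat{\boldsymbol c}$ exists and is unique whenever $\boldsymbol v\in\mathrm{Ran}(\boldsymbol A)$), $\mathcal L_{\boldsymbol r}$ is bounded and linear on $L^2_\varrho(\mathcal U;\mathcal V)$, and its restriction to any $\mathcal Y$ as above is a bounded linear (nonadaptive) operator that is an adaptive sampling operator in the above sense. Moreover: (a) for all $0<p<1$ and all $\boldsymbol b\in\ell^p_{\mathsf M}(\mathbb N)$ with $\boldsymbol b\in[0,\infty)^{\mathbb N}$, $$\mathbb E_{\boldsymbol r}\sup_{f\in\mathcal H(\boldsymbol b)}\|f-\mathcal T_{\boldsymbol r}(\mathcal L_{\boldsymbol r}(f))\|_{L^2_\varrho(\mathcal U;\mathcal V)}\le c\cdot\Big(\frac m{\log^2 m}\Big)^{1/2-1/p},$$ where $c>0$ depends on $\boldsymbol b$ and $p$ only; (b) for all $0<p<q<1$, $$\mathbb E_{\boldsymbol r}\sup_{f\in\mathcal H(p,\mathsf M)}\|f-\mathcal T_{\boldsymbol r}(\mathcal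 L_{\boldsymbol r}(f))\|_{L^2_\varrho(\mathcal U;\mathcal V)}\le c\cdot m^{1/2-1/q},$$ where $c>0$ depends on $p$ and $q$ only, and for every $\mathcal Y\supseteq\mathcal H(p,\mathsf M)$ as above $\theta_m(p,\mathsf M)$ is at most the left-hand side. -/

import Mathlib

open MeasureTheory ProbabilityTheory Polynomial
open scoped ENNReal

noncomputable section

namespace HolApprox

/-! ## The infinite-dimensional cube and its uniform probability measure -/

/-- The cube `[-1,1]^ℕ`. Coordinates are numbered from `0`. -/
abbrev Cube : Type := ℕ → Set.Icc (-1 : ℝ) 1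

/-- The uniform probability measure `dy / 2` on `[-1,1]`. -/
def uniformInterval : Measure (Set.Icc (-1 : ℝ) 1) := 
  (2 : ℝ≥0∞)⁻¹ • (volume : Measure ℝ).comap Subtype.val

instance uniformInterval.isProbabilityMeasure : IsProbabilityMeasure uniformInterval := by
  constructor
  have h : (volume : Measure ℝ).comap (Subtype.val : Set.Icc (-1 : ℝ) 1 → ℝ) Set.univ = 2 := by
    rw [(MeasurableEmbedding.subtype_coe measurableSet_Icc).comap_apply, Set.image_univ,
      Subtype.range_coe, Real.volume_Icc]
    norm_num
  rw [uniformInterval, Measure.smul_apply, h, smul_eq_mul]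
  exact ENNReal.inv_mul_cancel (by norm_num) (by norm_num)

/-- The uniform probability measure on the cube: the infinite product of `uniformInterval`. -/
def uniformCube : Measure Cube := Measure.infinitePi fun _ : ℕ => uniformInterval

instance uniformCube.isProbabilityMeasure : IsProbabilityMeasure uniformCube := by
  unfold uniformCube
  infer_instance

/-- The Lebesgue-Bochner space `L²(U ; V)`. -/
abbrev L2 (V : Type*) [NormedAddCommGroup V] : Type _ := Lp V 2 uniformCube

/-! ## Holomorphic functions on unions of Bernstein polyellipses -/

/-- The (closed) Bernstein ellipse of parameter `ρ ≥ 1`; for `ρ = 1` it is the segment `[-1,1]`,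
being the image of the unit circle under `z ↦ (z + z⁻¹) / 2`. -/
def bernsteinEllipse (ρ : ℝ) : Set ℂ :=
  {w | ∃ z : ℂ, 1 ≤ ‖z‖ ∧ ‖z‖ ≤ ρ ∧ w = (z + z⁻¹) / 2}

/-- The Bernstein polyellipse `E_{ρ 0} × E_{ρ 1} × ⋯`. -/
def polyellipse (ρ : ℕ → ℝ) : Set (ℕ → ℂ) :=
  {z | ∀ k, z k ∈ bernsteinEllipse (ρ k)}

/-- `ρ ∈ [1,∞)^ℕ` with `∑ ((ρ k + (ρ k)⁻¹) / 2 - 1) * b k ≤ 1`. For `b ≥ 0` the terms are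
nonnegative, so the sum is taken in `[0,∞]` and a divergent series does not qualify. -/
def Admissible (b ρ : ℕ → ℝ) : Prop :=
  (∀ k, 1 ≤ ρ k) ∧ ∑' k, ENNReal.ofReal (((ρ k + (ρ k)⁻¹) / 2 - 1) * b k) ≤ 1

/-- The region `R(b)`: the union of the admissible polyellipses. -/
def region (b : ℕ → ℝ) : Set (ℕ → ℂ) :=
  {z | ∃ ρ, Admissible b ρ ∧ z ∈ polyellipse ρ}

/-- Replace the coordinates of `z` in the finite set `S` by those of `w`. -/
def updateOn (z : ℕ → ℂ) (S : Finset ℕ) (w : S → ℂ) : ℕ → ℂ :=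
  fun k => if h : k ∈ S then w ⟨k, h⟩ else z k

/-- `F` is holomorphic in the region `R(b)`: on every admissible polyellipse it is a holomorphic
function of each finite group of variables, the other variables being frozen at any values. -/
def HolomorphicInRegion {W : Type*} [NormedAddCommGroup W] [NormedSpace ℂ W]
    (b : ℕ → ℝ) (F : (ℕ → ℂ) → W) : Prop :=
  ∀ ρ, Admissible b ρ → ∀ z ∈ polyellipse ρ, ∀ S : Finset ℕ,
    DifferentiableOn ℂ (fun w : S → ℂ => F (updateOn z S w))
      {w | ∀ k : S, w k ∈ interior (bernsteinEllipse (ρ k))}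

/-- The inclusion of the cube in `ℂ^ℕ`. -/
def cubeToComplex (y : Cube) : ℕ → ℂ := fun k => ((y k : ℝ) : ℂ)

section HolomorphyClass

variable {V W : Type*} [NormedAddCommGroup V] [NormedSpace ℝ V]
  [NormedAddCommGroup W] [NormedSpace ℂ W]

/-- The class `H(b)` as a set of functions: the continuous `f : U → V` that have an extension to
`R(b)` which is holomorphic there and bounded by `1` in norm. The values of the extension lie in a
complex space `W` that contains `V` through `emb`: `W = V` if `V` is complex, and `W` is a
complexification of `V` if `V` is real. -/
def IsHolomorphicUnit (emb : V →ₗᵢ[ℝ] W) (b : ℕ → ℝ) (f : Cube → V) : Prop :=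
  Continuous f ∧ ∃ F : (ℕ → ℂ) → W,
    (∀ y, F (cubeToComplex y) = emb (f y)) ∧
    HolomorphicInRegion b F ∧
    ∀ z ∈ region b, ‖F z‖ ≤ 1

/-- The class `H(b)` as a subset of `L²(U ; V)`. -/
def holClass (emb : V →ₗᵢ[ℝ] W) (b : ℕ → ℝ) : Set (L2 V) :=
  {f | ∃ g : Cube → V, IsHolomorphicUnit emb b g ∧ f =ᵐ[uniformCube] g}

/-- The minimal monotone majorant `sup_{j ≥ i} |z j|`, with values in `[0,∞]`. -/
def monotoneMajorant (z : ℕ → ℝ) (i : ℕ) : ℝ≥0∞ := ⨆ j ≥ i, ‖z j‖ₑ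

/-- The monotone `ℓ^p`-(quasi)norm, with values in `[0,∞]`. -/
def monotoneNorm (p : ℝ) (z : ℕ → ℝ) : ℝ≥0∞ := (∑' i, monotoneMajorant z i ^ p) ^ (1 / p)

/-- The class `H(p, M)`: the union of `H(b)` over all `b ≥ 0` in the unit ball of the monotone
`ℓ^p`-space. -/
def holClassMonotone (emb : V →ₗᵢ[ℝ] W) (p : ℝ) : Set (L2 V) :=
  {f | ∃ b : ℕ → ℝ, (∀ k, 0 ≤ b k) ∧ monotoneNorm p b ≤ 1 ∧ f ∈ holClass emb b}

end HolomorphyClass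

/-! ## Sampling operators and adaptive widths -/

/-- A vector subspace of `E` equipped with a norm of its own. -/
structure NormedSubspace (𝕜 E : Type*) [RCLike 𝕜] [AddCommGroup E] [Module 𝕜 E] where
  carrier : Submodule 𝕜 E
  norm : Seminorm 𝕜 carrier
  eq_zero_of_norm : ∀ f, norm f = 0 → f = 0

/-- The inclusion of the normed subspace `Y` in the ambient normed space is continuous. -/
def NormedSubspace.ContinuouslyEmbedded {𝕜 E : Type*} [RCLike 𝕜] [NormedAddCommGroup E]
    [NormedSpace 𝕜 E] (Y : NormedSubspace 𝕜 E) : Prop :=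
  ∃ C : ℝ, ∀ f : Y.carrier, ‖(f : E)‖ ≤ C * Y.norm f

/-- `L` is linear and bounded with respect to the norm of `Y`. -/
def IsBoundedLinear {𝕜 E Z : Type*} [RCLike 𝕜] [AddCommGroup E] [Module 𝕜 E]
    [NormedAddCommGroup Z] [NormedSpace 𝕜 Z] (Y : NormedSubspace 𝕜 E) (L : Y.carrier → Z) : Prop :=
  IsLinearMap 𝕜 L ∧ ∃ C : ℝ, ∀ f, ‖L f‖ ≤ C * Y.norm f

/-- `L` takes `m` measurements with values in `Z`, one after the other: the `i`-th one is a bounded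
linear map, which may depend on the values of the previous measurements. -/
def IsAdaptive {𝕜 E Z : Type*} [RCLike 𝕜] [AddCommGroup E] [Module 𝕜 E]
    [NormedAddCommGroup Z] [NormedSpace 𝕜 Z] (Y : NormedSubspace 𝕜 E) {m : ℕ}
    (L : Y.carrier → Fin m → Z) : Prop :=
  ∃ ℓ : (i : Fin m) → (Fin i → Z) → Y.carrier → Z,
    (∀ i u, IsBoundedLinear Y (ℓ i u)) ∧
    ∀ f i, L f i = ℓ i (fun j => L f (Fin.castLE i.isLt.le j)) f

section Widths

variable {𝕜 V : Type*} [RCLike 𝕜] [NormedAddCommGroup V] [NormedSpace 𝕜 V] [NormedSpace ℝ V]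

/-- Adaptive sampling operators with values in `V^m`: there are nonzero `v, w ∈ V` and a real-valued
adaptive sampling operator `L'` on a normed subspace `Y'` of `L²(U)` such that, whenever `v g ∈ Y`
with `g ∈ L²(U)`, one has `g ∈ Y'` and `L (v g) = w L'(g)`. -/
def IsSamplingOperator (Y : NormedSubspace 𝕜 (L2 V)) {m : ℕ}
    (L : Y.carrier → Fin m → V) : Prop :=
  IsAdaptive Y L ∧
  ∃ v w : V, v ≠ 0 ∧ w ≠ 0 ∧
  ∃ (Y' : NormedSubspace ℝ (L2 ℝ)) (L' : Y'.carrier → Fin m → ℝ), IsAdaptive Y' L' ∧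
    ∀ (g : L2 ℝ) (f : Y.carrier), (f : L2 V) =ᵐ[uniformCube] (fun y => g y • v) →
      ∃ hg : g ∈ Y'.carrier, ∀ i, L f i = L' ⟨g, hg⟩ i • w

/-- The adaptive `m`-width `Θ_m(K ; Y, L²(U ; V))` of a set `K ⊆ Y`. -/
def adaptiveWidth (Y : NormedSubspace 𝕜 (L2 V)) (K : Set (L2 V)) (m : ℕ) : ℝ≥0∞ :=
  ⨅ (L : Y.carrier → Fin m → V) (_ : IsSamplingOperator Y L) (T : (Fin m → V) → L2 V),
    ⨆ (f : Y.carrier) (_ : (f : L2 V) ∈ K), ‖(f : L2 V) - T (L f)‖ₑ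

end Widths

/-! ## Legendre polynomials and the hyperbolic cross -/

/-- The orthonormal Legendre polynomial of degree `n` with respect to `dy / 2` on `[-1,1]`:
`√(2n+1) Pₙ`, where `Pₙ` is given by the formula of Rodrigues. -/
def legendre (n : ℕ) (y : ℝ) : ℝ :=
  √(2 * n + 1) * ((derivative^[n] ((X ^ 2 - 1 : ℝ[X]) ^ n)).eval y / (2 ^ n * n.factorial))

/-- The tensor product Legendre polynomial for a finitely supported multi-index. -/
def tensorLegendre (ν : ℕ →₀ ℕ) (y : Cube) : ℝ := ν.prod fun k n => legendre n (y k)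

/-- The hyperbolic cross. The `k`-th coordinate here is the coordinate number `k + 1` in the usual
numbering `1, 2, …`, and the coordinates whose usual number is at least `n` vanish. -/
def hyperbolicCross (n : ℕ) : Set (ℕ →₀ ℕ) :=
  {ν | (ν.prod fun _ a => a + 1) ≤ n ∧ ∀ k, n ≤ k + 1 → ν k = 0}

lemma hyperbolicCross_finite (n : ℕ) : (hyperbolicCross n).Finite := by
  refine (Set.finite_Iic (Finsupp.indicator (Finset.range n) fun _ _ => n)).subset ?_
  rintro ν ⟨h1, h2⟩ k
  rw [Finsupp.indicator_apply]
  by_cases hk : k < n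
  · rw [dif_pos (Finset.mem_range.2 hk)]
    by_cases hν : ν k = 0
    · simp [hν]
    · have hd : ν k + 1 ∣ ν.prod fun _ a => a + 1 :=
        Finset.dvd_prod_of_mem (fun j => ν j + 1) (Finsupp.mem_support_iff.2 hν)
      have hp : 0 < ν.prod fun _ a => a + 1 := Finset.prod_pos fun _ _ => Nat.succ_pos _
      have := Nat.le_of_dvd hp hd
      omega
  · rw [h2 k (by omega)]
    exact Nat.zero_le _

/-- The number `⌈m / log² m⌉` that determines the size of the hyperbolic cross. -/
def crossParam (m : ℕ) : ℕ := ⌈(m : ℝ) / Real.log m ^ 2⌉₊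

/-- The index set used for `m` measurements. -/
def indexSet (m : ℕ) : Finset (ℕ →₀ ℕ) := (hyperbolicCross_finite (crossParam m)).toFinset

/-- The number `N(m)` of indices. -/
def numIndices (m : ℕ) : ℕ := (indexSet m).card

/-- An enumeration of the indices. -/
def indexAt (m : ℕ) (j : Fin (numIndices m)) : ℕ →₀ ℕ := (indexSet m).equivFin.symm j

/-! ## Gaussian sampling and reconstruction by `ℓ¹`-minimization -/

/-- The dimension `m * N(m)` of the random vector. -/
def randomDim (m : ℕ) : ℕ := m * numIndices m

/-- The law `N(0, I)` on `ℝ^d`. -/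
def stdNormal (d : ℕ) : Measure (Fin d → ℝ) := Measure.pi fun _ => gaussianReal 0 1

/-- The matrix `m^{-1/2} (a i j)`, whose entries `a i j` are the entries of the vector `r`. -/
def sensingMatrix (m : ℕ) (r : Fin (randomDim m) → ℝ) : Matrix (Fin m) (Fin (numIndices m)) ℝ :=
  fun i j => (√m)⁻¹ * r (finProdFinEquiv (i, j))

/-- The expectation of a `[0,∞]`-valued random variable `g`, in the form that is also meaningful
without measurability of `g` (upper expectation): the infimum of the expectations of the measurable
majorants of `g`. It is the usual expectation if `g` is measurable. -/
def upperExpectation {Ω : Type*} [MeasurableSpace Ω] (μ : Measure Ω) (g : Ω → ℝ≥0∞) : ℝ≥0∞ :=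
  ⨅ (h : Ω → ℝ≥0∞) (_ : Measurable h) (_ : g ≤ h), ∫⁻ ω, h ω ∂μ

lemma upperExpectation_of_measurable {Ω : Type*} [MeasurableSpace Ω] (μ : Measure Ω)
    (g : Ω → ℝ≥0∞) (hg : Measurable g) : upperExpectation μ g = ∫⁻ ω, g ω ∂μ :=
  le_antisymm (iInf_le_of_le g (iInf_le_of_le hg (iInf_le _ le_rfl)))
    (le_iInf fun _ => le_iInf fun _ => le_iInf fun h => lintegral_mono h)

section Reconstruction

variable {V : Type*} [NormedAddCommGroup V] [NormedSpace ℝ V]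

/-- The sampling operator: its `i`-th measurement is the integral of `f` against
`m^{-1/2} ∑ⱼ aᵢⱼ Ψ_{νⱼ}`, a random weighted sum of Legendre coefficients of `f`. -/
def gaussianSampling (m : ℕ) (r : Fin (randomDim m) → ℝ) (f : L2 V) : Fin m → V :=
  fun i => ∫ y, (∑ j, sensingMatrix m r i j * tensorLegendre (indexAt m j) y) • f y ∂uniformCube

/-- The action of a real matrix on vectors with entries in `V`. -/
def matrixAct {m N : ℕ} (A : Matrix (Fin m) (Fin N) ℝ) (z : Fin N → V) : Fin m → V :=
  fun i => ∑ j, A i j • z j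

/-- The minimizers of `∑ⱼ ‖zⱼ‖` subject to `A z = v`. -/
def l1Minimizers {m N : ℕ} (A : Matrix (Fin m) (Fin N) ℝ) (v : Fin m → V) : Set (Fin N → V) :=
  {z | matrixAct A z = v ∧ ∀ z', matrixAct A z' = v → ∑ j, ‖z j‖ ≤ ∑ j, ‖z' j‖}

/-- `T` is the `ℓ¹`-minimization reconstruction map for the random vector `r`. If `v` lies in the
range of the sensing matrix, then `T v = ∑ⱼ cⱼ Ψ_{νⱼ}`, where `c` is the (unique) element of smallest
`ℓ²`-norm among the solutions of the `ℓ¹`-minimization problem; otherwise `T v = 0`. -/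
def IsL1Reconstruction (m : ℕ) (r : Fin (randomDim m) → ℝ) (T : (Fin m → V) → L2 V) : Prop :=
  ∀ v : Fin m → V,
    (v ∈ Set.range (matrixAct (V := V) (sensingMatrix m r)) →
      ∃ c ∈ l1Minimizers (sensingMatrix m r) v,
        (∀ z ∈ l1Minimizers (sensingMatrix m r) v, z ≠ c → ∑ j, ‖c j‖ ^ 2 < ∑ j, ‖z j‖ ^ 2) ∧
        T v =ᵐ[uniformCube] fun y => ∑ j, tensorLegendre (indexAt m j) y • c j) ∧
    (v ∉ Set.range (matrixAct (V := V) (sensingMatrix m r)) → T v = 0)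

/-- The worst-case error over `K` of sampling followed by the reconstruction `T`. -/
def worstError (m : ℕ) (r : Fin (randomDim m) → ℝ) (T : (Fin m → V) → L2 V) (K : Set (L2 V)) :
    ℝ≥0∞ :=
  ⨆ f ∈ K, ‖f - T (gaussianSampling m r f)‖ₑ

end Reconstruction

end HolApprox

end

/-! Two facts carry the theorem. The Legendre coefficients of all functions in a class obey `ℓ^p`
bounds that depend only on `p` and on one majorant `β` of the sequences `b` involved. And a Gaussian
matrix, with high probability, allows such coefficients to be recovered by `ℓ¹`-minimization.

Coefficients. In Joukowski coordinates, Cauchy's formula on an ellipse has the kernel `(1 - u²) / (1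
- 2yu + u²)`, `u = ζ⁻¹`, which generates the Chebyshev polynomials. The Legendre polynomial of
degree `n + 1` is orthogonal to the partial sum of degree `n`, and the remainder is of order
`R^{-(n+1)}` (`integral_legendre_smul_eq`). Fubini extends this to the finitely many variables in
the support of `ν`, the others being frozen (`norm_integral_tensorLegendre_smul_le`). The
polyellipse may depend on `ν`: with `r = |supp ν|`, the radii `κ + 1 / (2 r β_k)` fit inside an
admissible one, so that the coefficient is at most `∏ A r β_k κ^{-(ν_k - 1)}` over the support
(`norm_legendreCoeff_le`). In the sum of the `p`-th powers one writes `r^{pr} = (r^{p-1})^r r^r`.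
The products with `r^r` sum to at most `e^{Xr}`, and `(r^{p-1})^r` beats this because `p < 1`
(`sum_coeffMajorant_rpow_le`). Outside the hyperbolic cross either `∏ (ν_k + 1)` is large or a late
coordinate is active, where `β_k^p = O(1/k)`; both give a `p`-th power of order `1/n`
(`coeffMajorant_rpow_le_of_notMem`). Truncation therefore has the desired error.

Recovery. By Maurey's method, a lower bound for `‖Ax‖` on the finitely many sums of `k` signed unit
vectors extends to all `x` up to a term `‖x‖₁² / (k - 1)` (`GoodMatrix.sub_le`). Factoring a Gram
matrix transfers this to vectors with entries in a Hilbert space (`GoodMatrix.sum_norm_sq_le`). On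
the kernel the `ℓ²`-norm is thus small compared with the `ℓ¹`-norm, which yields the error `K^{1/2 -
1/p}` for `ℓ¹`-minimization, `K = k - 1` (`sum_norm_sub_sq_le_rpow`).

Probability. Chernoff bounds and a union bound over `(2N)^k` sums show that a Gaussian matrix is
good (`stdNormal_not_goodMatrix_le`). Since `log N` is of order `log² m`, the choice of `k` of order
`m / log² m` is affordable. On the exceptional event the trivial bound suffices, its probability
being exponentially small (`upperExpectation_worstError_le`).

Part (a) uses a majorant of `b`. For (b) the single sequence `(k+1)^{-1/p}` dominates the whole unit
ball; it is `p'`-summable for every `p' > p`, and `p < p' < q` leaves room to absorb the logarithm.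
The width is bounded by the worst-case error for each realization, hence by the expectation. -/

namespace HolApprox

/-! ## Legendre polynomials -/

/-- The polynomial `(X² - 1)ⁿ` of the formula of Rodrigues. -/
noncomputable def rodriguesBase (n : ℕ) : ℝ[X] := (X ^ 2 - 1) ^ n

lemma monic_rodriguesBase (n : ℕ) : (rodriguesBase n).Monic := by
  have h : (X ^ 2 - 1 : ℝ[X]).Monic := by
    simpa using monic_X_pow_sub_C (1 : ℝ) two_ne_zero
  exact h.pow n

lemma natDegree_rodriguesBase (n : ℕ) : (rodriguesBase n).natDegree = 2 * n := by
  have h : (X ^ 2 - 1 : ℝ[X]).natDegree = 2 := by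
    simpa using natDegree_X_pow_sub_C (n := 2) (r := (1 : ℝ))
  rw [rodriguesBase, natDegree_pow, h, mul_comm]

lemma coeff_iterate_derivative_rodriguesBase (n : ℕ) :
    (derivative^[n] (rodriguesBase n)).coeff n = ((2 * n).descFactorial n : ℝ) := by
  have h : (rodriguesBase n).coeff (n + n) = 1 := by
    have := (monic_rodriguesBase n).coeff_natDegree
    rwa [natDegree_rodriguesBase, two_mul] at this
  rw [coeff_iterate_derivative, h, two_mul]
  simp

lemma natDegree_iterate_derivative_rodriguesBase_le (n : ℕ) :
    (derivative^[n] (rodriguesBase n)).natDegree ≤ n := by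
  refine (natDegree_iterate_derivative _ _).trans ?_
  rw [natDegree_rodriguesBase]
  omega

lemma iterate_derivative_two_mul_rodriguesBase (n : ℕ) :
    derivative^[2 * n] (rodriguesBase n) = C ((2 * n).factorial : ℝ) := by
  have h0 : (derivative^[2 * n] (rodriguesBase n)).natDegree ≤ 0 := by
    refine (natDegree_iterate_derivative _ _).trans ?_
    rw [natDegree_rodriguesBase]
    omega
  have h : (rodriguesBase n).coeff (2 * n) = 1 := by
    have := (monic_rodriguesBase n).coeff_natDegree
    rwa [natDegree_rodriguesBase] at this
  rw [eq_C_of_natDegree_le_zero h0, coeff_iterate_derivative, zero_add, h]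
  simp [Nat.descFactorial_self]

lemma eval_iterate_derivative_rodriguesBase {n k : ℕ} (hk : k < n) {y : ℝ} (hy : y ^ 2 = 1) :
    (derivative^[k] (rodriguesBase n)).eval y = 0 := by
  obtain ⟨q, hq⟩ := pow_sub_dvd_iterate_derivative_pow (X ^ 2 - 1 : ℝ[X]) n k
  rw [rodriguesBase, hq]
  simp [hy, show n - k ≠ 0 by omega]

lemma integral_eval_derivative_mul (p q : ℝ[X]) (h1 : p.eval 1 = 0) (h2 : p.eval (-1) = 0) :
    ∫ y in (-1 : ℝ)..1, (derivative p).eval y * q.eval y =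
      - ∫ y in (-1 : ℝ)..1, p.eval y * (derivative q).eval y := by
  have := intervalIntegral.integral_mul_deriv_eq_deriv_mul (a := -1) (b := 1)
    (u := fun y => q.eval y) (v := fun y => p.eval y) (u' := fun y => (derivative q).eval y)
    (v' := fun y => (derivative p).eval y)
    (fun y _ => q.hasDerivAt y) (fun y _ => p.hasDerivAt y)
    ((derivative q).continuous.intervalIntegrable _ _)
    ((derivative p).continuous.intervalIntegrable _ _)
  simp only [h1, h2, mul_zero, sub_zero, zero_sub] at this
  simp_rw [mul_comm ((derivative p).eval _), this, mul_comm (p.eval _)]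

/-- Integration by parts `k` times: the boundary terms vanish since `±1` are zeros of order `n` of
the base. The case `k = n` gives both the orthogonality and the norms of the Legendre polynomials.
-/
lemma integral_iterate_derivative_rodriguesBase_mul (n : ℕ) (q : ℝ[X]) (k : ℕ) (hk : k ≤ n) :
    ∫ y in (-1 : ℝ)..1, (derivative^[n] (rodriguesBase n)).eval y * q.eval y =
      (-1) ^ k * ∫ y in (-1 : ℝ)..1, (derivative^[n - k] (rodriguesBase n)).eval y *
        (derivative^[k] q).eval y := by
  induction k with
  | zero => simp
  | succ k ih =>
    rw [ih (by omega), show n - k = (n - (k + 1)) + 1 by omega, Function.iterate_succ_apply',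
      integral_eval_derivative_mul _ _
        (eval_iterate_derivative_rodriguesBase (by omega) (by norm_num))
        (eval_iterate_derivative_rodriguesBase (by omega) (by norm_num)),
      Function.iterate_succ_apply', pow_succ]
    ring

lemma integral_iterate_derivative_rodriguesBase_mul_eq_zero {n : ℕ} {q : ℝ[X]}
    (hq : q.natDegree < n) :
    ∫ y in (-1 : ℝ)..1, (derivative^[n] (rodriguesBase n)).eval y * q.eval y = 0 := by
  rw [integral_iterate_derivative_rodriguesBase_mul n q n le_rfl,
    iterate_derivative_eq_zero hq]
  simp

/-- The recursion in `n` comes from integrating the derivative of `y (1 - y²)^(n+1)`, which vanishes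
at both endpoints. -/
lemma integral_one_sub_sq_pow (n : ℕ) :
    (∫ y in (-1 : ℝ)..1, (1 - y ^ 2) ^ n) * (2 * n + 1).factorial =
      2 * 4 ^ n * (n.factorial : ℝ) ^ 2 := by
  induction n with
  | zero => simp; norm_num
  | succ n ih =>
    have hd : ∀ y ∈ Set.uIcc (-1 : ℝ) 1, HasDerivAt (fun y : ℝ => y * (1 - y ^ 2) ^ (n + 1))
        ((2 * n + 3) * (1 - y ^ 2) ^ (n + 1) - 2 * (n + 1) * (1 - y ^ 2) ^ n) y := by
      intro y _
      have h1 : HasDerivAt (fun y : ℝ => 1 - y ^ 2) (-(2 * y)) y := by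
        simpa using (hasDerivAt_pow 2 y).const_sub 1
      have h2 := (hasDerivAt_id y).mul (h1.pow (n + 1))
      refine h2.congr_deriv ?_
      simp only [id, Nat.add_sub_cancel, Pi.pow_apply]
      push_cast
      ring
    have hI := intervalIntegral.integral_eq_sub_of_hasDerivAt hd
      (Continuous.intervalIntegrable (by fun_prop) _ _)
    rw [intervalIntegral.integral_sub (Continuous.intervalIntegrable (by fun_prop) _ _)
      (Continuous.intervalIntegrable (by fun_prop) _ _), intervalIntegral.integral_const_mul,
      intervalIntegral.integral_const_mul] at hI
    norm_num at hI
    have h3 : ((2 * (n + 1) + 1).factorial : ℝ) =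
        (2 * n + 3) * ((2 * n + 2) * (2 * n + 1).factorial) := by
      rw [show 2 * (n + 1) + 1 = (2 * n + 1) + 1 + 1 by ring, Nat.factorial_succ,
        Nat.factorial_succ]
      push_cast
      ring
    rw [h3, Nat.factorial_succ n]
    push_cast
    linear_combination (2 * n + 2) * (2 * n + 1).factorial * hI + 2 * (n + 1) * (2 * n + 2) * ih

/-- The orthonormal Legendre polynomial as a polynomial. -/
noncomputable def legendrePoly (n : ℕ) : ℝ[X] :=
  C (√(2 * n + 1) / (2 ^ n * n.factorial)) * derivative^[n] (rodriguesBase n)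

lemma legendre_eq_eval (n : ℕ) (y : ℝ) : legendre n y = (legendrePoly n).eval y := by
  rw [legendre, legendrePoly, eval_mul, eval_C, rodriguesBase]
  ring

@[fun_prop]
lemma continuous_legendre (n : ℕ) : Continuous (legendre n) := by
  simp_rw [funext (legendre_eq_eval n)]
  exact (legendrePoly n).continuous

lemma degree_legendrePoly (n : ℕ) : (legendrePoly n).degree = n := by
  have hc : √(2 * n + 1 : ℝ) / (2 ^ n * n.factorial) ≠ 0 := by positivity
  rw [legendrePoly, degree_C_mul hc]
  refine le_antisymm (natDegree_le_iff_degree_le.1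
    (natDegree_iterate_derivative_rodriguesBase_le n)) (le_degree_of_ne_zero ?_)
  rw [coeff_iterate_derivative_rodriguesBase]
  exact_mod_cast (Nat.descFactorial_pos.2 (by omega)).ne'

/-- The Legendre polynomials as a sequence of polynomials of increasing degree. -/
noncomputable def legendreSequence : Polynomial.Sequence ℝ where
  elems' := legendrePoly
  degree_eq' := degree_legendrePoly

lemma span_range_legendrePoly : Submodule.span ℝ (Set.range legendrePoly) = ⊤ :=
  legendreSequence.span fun i => (leadingCoeff_ne_zero.2 (legendreSequence.ne_zero i)).isUnit

lemma integral_legendre_mul_eval_eq_zero {n : ℕ} {q : ℝ[X]} (hq : q.natDegree < n) :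
    ∫ y in (-1 : ℝ)..1, legendre n y * q.eval y = 0 := by
  simp_rw [legendre_eq_eval, legendrePoly, eval_mul, eval_C, mul_assoc]
  rw [intervalIntegral.integral_const_mul,
    integral_iterate_derivative_rodriguesBase_mul_eq_zero hq, mul_zero]

lemma integral_legendre_mul_legendre_of_ne {n k : ℕ} (h : n ≠ k) :
    ∫ y in (-1 : ℝ)..1, legendre n y * legendre k y = 0 := by
  wlog hlt : k < n generalizing n k
  · simp_rw [mul_comm (legendre n _)]
    exact this h.symm (by omega)
  simp_rw [legendre_eq_eval k]
  exact integral_legendre_mul_eval_eq_zero (by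
    rwa [natDegree_eq_of_degree_eq_some (degree_legendrePoly k)])

lemma integral_legendre_mul_self (n : ℕ) :
    ∫ y in (-1 : ℝ)..1, legendre n y * legendre n y = 2 := by
  have h1 := integral_iterate_derivative_rodriguesBase_mul n
    (derivative^[n] (rodriguesBase n)) n le_rfl
  rw [← Function.iterate_add_apply, ← two_mul, iterate_derivative_two_mul_rodriguesBase,
    Nat.sub_self, Function.iterate_zero, id] at h1
  simp only [eval_C, rodriguesBase, eval_pow, eval_sub, eval_X, eval_one] at h1
  rw [intervalIntegral.integral_mul_const, ← mul_assoc, ← intervalIntegral.integral_const_mul] at h1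
  simp_rw [← mul_pow, show ∀ x : ℝ, (-1) * (x ^ 2 - 1) = 1 - x ^ 2 by intro x; ring] at h1
  have h2 := integral_one_sub_sq_pow n
  simp_rw [legendre]
  simp_rw [show ∀ a b c : ℝ, (a * (b / c)) * (a * (b / c)) = (a * a / c ^ 2) * (b * b) by
    intros; ring]
  rw [intervalIntegral.integral_const_mul, h1, Real.mul_self_sqrt (by positivity)]
  rw [Nat.factorial_succ] at h2
  push_cast at h2
  have h4 : (4 : ℝ) ^ n = (2 ^ n) ^ 2 := by rw [← pow_mul, mul_comm, pow_mul]; norm_num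
  rw [h4] at h2
  field_simp
  linear_combination h2

lemma integral_uniformInterval {E : Type*} [NormedAddCommGroup E] [NormedSpace ℝ E]
    (f : ℝ → E) :
    ∫ y, f y ∂uniformInterval = (2⁻¹ : ℝ) • ∫ y in (-1 : ℝ)..1, f y := by
  rw [uniformInterval, integral_smul_measure, intervalIntegral.integral_of_le (by norm_num),
    ← integral_Icc_eq_integral_Ioc]
  congr 1
  · simp
  · exact integral_subtype_comap measurableSet_Icc f

lemma integral_legendre_mul_legendre (n k : ℕ) :
    ∫ y, legendre n y * legendre k y ∂uniformInterval = if n = k then 1 else 0 := by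
  rw [integral_uniformInterval (fun y : ℝ => legendre n y * legendre k y)]
  split_ifs with h
  · rw [h, integral_legendre_mul_self]; norm_num
  · rw [integral_legendre_mul_legendre_of_ne h]; simp

@[simp]
lemma legendre_zero (y : ℝ) : legendre 0 y = 1 := by simp [legendre]

/-- On a probability space the `L¹`-norm is at most the `L²`-norm, here in the form `∫ (|P| - 1)² ≥
0`. -/
lemma integral_abs_legendre_le (n : ℕ) : ∫ y, |legendre n y| ∂uniformInterval ≤ 1 := by
  have hc : Continuous fun y : Set.Icc (-1 : ℝ) 1 => legendre n y := by fun_prop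
  have hi : ∀ f : Set.Icc (-1 : ℝ) 1 → ℝ, Continuous f → Integrable f uniformInterval :=
    fun f hf => hf.integrable_of_hasCompactSupport (HasCompactSupport.of_compactSpace f)
  have h1 : ∫ y, (|legendre n y| - 1) ^ 2 ∂uniformInterval = 2 - 2 * ∫ y, |legendre n y| ∂uniformInterval := by
    have h : ∀ y, (|legendre n y| - 1) ^ 2 = (legendre n y * legendre n y + 1) - 2 * |legendre n y| := by
      intro y
      rw [← abs_mul_abs_self]
      ring
    simp_rw [h]
    rw [integral_sub (hi _ (by fun_prop)) (hi _ (by fun_prop)), integral_add (hi _ (by fun_prop)) (hi _ (by fun_prop)),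
      integral_legendre_mul_legendre, integral_const_mul]
    norm_num
  have h2 : 0 ≤ ∫ y, (|legendre n y| - 1) ^ 2 ∂uniformInterval := integral_nonneg fun y => sq_nonneg _
  linarith

/-! ## The Joukowski map and Bernstein ellipses -/

/-- The Joukowski map. -/
noncomputable def joukowski (z : ℂ) : ℂ := (z + z⁻¹) / 2

lemma joukowski_inv (z : ℂ) : joukowski z⁻¹ = joukowski z := by
  rw [joukowski, joukowski, inv_inv, add_comm]

/-- The differences `J(w) ∓ 1` are the squares `(w ∓ 1)²` divided by `2w`, so the parallelogram law
applies. This is the description of Bernstein ellipses by their foci `±1`. -/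
lemma norm_joukowski_sub_one_add {w : ℂ} (hw : w ≠ 0) :
    ‖joukowski w - 1‖ + ‖joukowski w + 1‖ = ‖w‖ + ‖w‖⁻¹ := by
  have h1 : joukowski w - 1 = (w - 1) ^ 2 / (2 * w) := by
    rw [joukowski]; field_simp; ring
  have h2 : joukowski w + 1 = (w + 1) ^ 2 / (2 * w) := by
    rw [joukowski]; field_simp; ring
  have h3 := parallelogram_law_with_norm ℝ w 1
  have h4 : ‖w‖ ≠ 0 := norm_ne_zero_iff.2 hw
  rw [norm_one] at h3
  rw [h1, h2]
  simp only [norm_div, norm_pow, norm_mul, Complex.norm_ofNat]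
  field_simp
  linarith

/-- With `s² = z² - 1` one has `(z + s)(z - s) = 1`, so one of the two preimages `z ± s` has norm at
least `1`. -/
lemma exists_joukowski_eq (z : ℂ) : ∃ w : ℂ, 1 ≤ ‖w‖ ∧ joukowski w = z := by
  obtain ⟨s, hs⟩ := IsAlgClosed.exists_pow_nat_eq (z ^ 2 - 1) two_pos
  have h : (z + s) * (z - s) = 1 := by linear_combination -hs
  have hi : (z + s)⁻¹ = z - s := inv_eq_of_mul_eq_one_right h
  have hj : joukowski (z + s) = z := by rw [joukowski, hi]; ring
  rcases le_total 1 ‖z + s‖ with h1 | h1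
  · exact ⟨_, h1, hj⟩
  · refine ⟨(z + s)⁻¹, ?_, by rw [joukowski_inv, hj]⟩
    rw [norm_inv]
    refine one_le_inv_iff₀.2 ⟨?_, h1⟩
    rw [norm_pos_iff]
    exact left_ne_zero_of_mul_eq_one h

lemma add_inv_lt_add_inv {s t : ℝ} (hs : 0 < s) (h1 : s < t) (h2 : s⁻¹ < t) :
    s + s⁻¹ < t + t⁻¹ := by
  have ht : 0 < t := hs.trans h1
  have h3 : 1 < s * t := by
    have := mul_lt_mul_of_pos_left h2 hs
    rwa [mul_inv_cancel₀ hs.ne'] at this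
  have : t + t⁻¹ - (s + s⁻¹) = (t - s) * (s * t - 1) / (s * t) := by field_simp; ring
  have h4 : 0 < (t - s) * (s * t - 1) / (s * t) := by
    apply div_pos (mul_pos _ _) (by positivity) <;> linarith
  linarith

lemma le_of_add_inv_lt_add_inv {s t : ℝ} (ht : 1 ≤ t) (h : s + s⁻¹ < t + t⁻¹) :
    s ≤ t := by
  by_contra! h1
  have := add_inv_lt_add_inv (by linarith) h1 ((inv_le_one_of_one_le₀ ht).trans_lt (by linarith))
  linarith

/-- The strict inequality for the focal sum is an open condition that implies membership in the
ellipse. Interior points are thus found without any openness property of the Joukowski map. -/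
lemma mem_interior_bernsteinEllipse {ρ : ℝ} (hρ : 1 ≤ ρ) {z : ℂ}
    (hz : ‖z - 1‖ + ‖z + 1‖ < ρ + ρ⁻¹) : z ∈ interior (bernsteinEllipse ρ) := by
  have ho : IsOpen {z : ℂ | ‖z - 1‖ + ‖z + 1‖ < ρ + ρ⁻¹} :=
    isOpen_lt (by fun_prop) (by fun_prop)
  refine interior_maximal ?_ ho hz
  intro w hw
  obtain ⟨v, hv, rfl⟩ := exists_joukowski_eq w
  have h0 : v ≠ 0 := norm_pos_iff.1 (by linarith)
  rw [Set.mem_ofPred_eq, norm_joukowski_sub_one_add h0] at hw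
  exact ⟨v, hv, le_of_add_inv_lt_add_inv hρ hw, rfl⟩

lemma joukowski_mem_interior {ρ : ℝ} {w : ℂ} (hw : w ≠ 0) (h1 : ‖w‖ < ρ)
    (h2 : ‖w‖⁻¹ < ρ) : joukowski w ∈ interior (bernsteinEllipse ρ) := by
  have h0 : 0 < ‖w‖ := norm_pos_iff.2 hw
  refine mem_interior_bernsteinEllipse ?_ ?_
  · rcases le_total 1 ‖w‖ with h | h
    · linarith
    · linarith [(one_le_inv₀ h0).2 h]
  · rw [norm_joukowski_sub_one_add hw]
    exact add_inv_lt_add_inv h0 h1 h2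

lemma joukowski_exp (θ : ℝ) : joukowski (Complex.exp (θ * Complex.I)) = (Real.cos θ : ℝ) := by
  rw [joukowski, ← Complex.exp_neg, Complex.ofReal_cos, Complex.cos, neg_mul]

lemma ofReal_mem_bernsteinEllipse {ρ : ℝ} (hρ : 1 ≤ ρ) {y : ℝ}
    (hy : y ∈ Set.Icc (-1 : ℝ) 1) : (y : ℂ) ∈ bernsteinEllipse ρ := by
  rw [← Real.cos_arccos hy.1 hy.2, ← joukowski_exp]
  refine ⟨Complex.exp (Real.arccos y * Complex.I), ?_, ?_, rfl⟩ <;>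
    simp [Complex.norm_exp_ofReal_mul_I, hρ]

/-! ## Cauchy's formula in Joukowski coordinates -/

section Cauchy

variable {W : Type*} [NormedAddCommGroup W] [NormedSpace ℂ W]

/-- The factor in front of `q` is the derivative of the Joukowski map, which sends the unit circle
to `[-1,1]` traversed back and forth. The two passages cancel: the integrand in `θ` is odd under `θ
↦ 2π - θ`. No regularity of `q` is needed. -/
lemma circleIntegral_joukowski_deriv_unit (q : ℂ → W) :
    (∮ ζ in C(0, 1), ((ζ ^ 2 - 1) / (2 * ζ ^ 2)) • q (joukowski ζ)) = 0 := by
  set f : ℝ → W := fun θ => (-(Real.sin θ : ℂ)) • q (Real.cos θ : ℝ)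
  have h1 : (∮ ζ in C(0, 1), ((ζ ^ 2 - 1) / (2 * ζ ^ 2)) • q (joukowski ζ)) =
      ∫ θ in (0 : ℝ)..(2 * Real.pi), f θ := by
    rw [circleIntegral]
    refine intervalIntegral.integral_congr fun θ _ => ?_
    simp only [deriv_circleMap, circleMap, Complex.ofReal_one, one_mul, zero_add, f]
    rw [joukowski_exp, smul_smul]
    congr 1
    have he := Complex.exp_ne_zero (θ * Complex.I)
    rw [Complex.ofReal_sin, Complex.sin, neg_mul, Complex.exp_neg]
    field_simp
    ring
  have h2 : ∀ θ, f (2 * Real.pi - θ) = - f θ := by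
    intro θ
    simp only [f, Real.sin_two_pi_sub, Real.cos_two_pi_sub, Complex.ofReal_neg, neg_smul]
  have h3 := intervalIntegral.integral_comp_sub_left (a := 0) (b := 2 * Real.pi) f (2 * Real.pi)
  simp only [h2, sub_self, sub_zero, intervalIntegral.integral_neg] at h3
  rw [h1]
  have h4 : (2 : ℂ) • (∫ θ in (0 : ℝ)..(2 * Real.pi), f θ) = 0 := by
    rw [two_smul]
    nth_rewrite 1 [← h3]
    exact neg_add_cancel _
  simpa using h4

lemma sq_sub_two_mul_add_one_eq {y : ℝ} (hy : y ∈ Set.Icc (-1 : ℝ) 1) (ζ : ℂ) :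
    ζ ^ 2 - 2 * y * ζ + 1 = (ζ - Complex.exp (Real.arccos y * Complex.I)) *
      (ζ - (Complex.exp (Real.arccos y * Complex.I))⁻¹) := by
  have h := joukowski_exp (Real.arccos y)
  rw [Real.cos_arccos hy.1 hy.2, joukowski] at h
  have he := mul_inv_cancel₀ (Complex.exp_ne_zero (Real.arccos y * Complex.I))
  linear_combination 2 * ζ * h - he

lemma sq_sub_two_mul_add_one_ne_zero {y : ℝ} (hy : y ∈ Set.Icc (-1 : ℝ) 1) {ζ : ℂ}
    (hζ : 1 < ‖ζ‖) : ζ ^ 2 - 2 * y * ζ + 1 ≠ 0 := by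
  rw [sq_sub_two_mul_add_one_eq hy]
  refine mul_ne_zero ?_ ?_ <;> rw [sub_ne_zero] <;> rintro rfl <;>
    simp [Complex.norm_exp_ofReal_mul_I] at hζ

/-- Partial fractions: the kernel is `1/(ζ - e) + 1/(ζ - e⁻¹) - 1/ζ` with `e = exp(i arccos y)`.
This form remains valid at `y = ±1`, where the two roots coincide. -/
lemma circleIntegral_joukowski_kernel {R : ℝ} (hR : 1 < R) {y : ℝ}
    (hy : y ∈ Set.Icc (-1 : ℝ) 1) :
    (∮ ζ in C(0, R), (ζ ^ 2 - 1) / (ζ * (ζ ^ 2 - 2 * y * ζ + 1))) = 2 * Real.pi * Complex.I := by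
  set e := Complex.exp (Real.arccos y * Complex.I) with he
  have hne : ‖e‖ = 1 := Complex.norm_exp_ofReal_mul_I _
  have h1 : Set.EqOn (fun ζ : ℂ => (ζ ^ 2 - 1) / (ζ * (ζ ^ 2 - 2 * y * ζ + 1)))
      (fun ζ => (ζ - e)⁻¹ + (ζ - e⁻¹)⁻¹ - (ζ - 0)⁻¹) (Metric.sphere 0 R) := by
    intro ζ hζ
    have hn : ‖ζ‖ = R := by simpa using hζ
    have h0 : ζ ≠ 0 := norm_pos_iff.1 (by linarith)
    have hd := sq_sub_two_mul_add_one_ne_zero hy (hn.symm ▸ hR)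
    have hd' := hd
    simp only
    rw [sq_sub_two_mul_add_one_eq hy, ← he] at hd ⊢
    obtain ⟨ha, hb⟩ := mul_ne_zero_iff.1 hd
    have he0 : e ≠ 0 := Complex.exp_ne_zero _
    have hee : e * e⁻¹ = 1 := mul_inv_cancel₀ he0
    generalize e⁻¹ = e' at *
    rw [sub_zero]
    field_simp
    linear_combination hee
  rw [circleIntegral.integral_congr (by linarith) h1]
  have hci : ∀ a : ℂ, ‖a‖ < R → CircleIntegrable (fun ζ : ℂ => (ζ - a)⁻¹) 0 R := by
    intro a ha
    rw [circleIntegrable_sub_inv_iff]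
    right
    simp only [Metric.mem_sphere, dist_zero_right]
    rw [abs_of_pos (by linarith)]
    exact ha.ne
  have hn1 : ‖e‖ < R := by rwa [hne]
  have hn2 : ‖e⁻¹‖ < R := by rwa [norm_inv, hne, inv_one]
  have hn3 : ‖(0 : ℂ)‖ < R := by rw [norm_zero]; linarith
  rw [circleIntegral.integral_sub (CircleIntegrable.fun_add (hci _ hn1) (hci _ hn2)) (hci _ hn3),
    circleIntegral.integral_add (hci _ hn1) (hci _ hn2),
    circleIntegral.integral_sub_inv_of_mem_ball (by simpa using hn1),
    circleIntegral.integral_sub_inv_of_mem_ball (by simpa using hn2),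
    circleIntegral.integral_sub_inv_of_mem_ball (by simpa using hn3)]
  ring

lemma continuousAt_joukowski {z : ℂ} (hz : z ≠ 0) : DifferentiableAt ℂ joukowski z := by
  unfold joukowski
  fun_prop (disch := exact hz)

variable [CompleteSpace W]

/-- Cauchy's formula on the image of a circle under the Joukowski map. -/
lemma circleIntegral_joukowski {D : Set ℂ} (hD : IsOpen D) {R : ℝ} (hR : 1 < R)
    (hJ : ∀ w : ℂ, 1 ≤ ‖w‖ → ‖w‖ ≤ R → joukowski w ∈ D) {g : ℂ → W}
    (hg : DifferentiableOn ℂ g D) {y : ℝ} (hy : y ∈ Set.Icc (-1 : ℝ) 1) :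
    (∮ ζ in C(0, R), ((ζ ^ 2 - 1) / (ζ * (ζ ^ 2 - 2 * y * ζ + 1))) • g (joukowski ζ)) =
      (2 * Real.pi * Complex.I : ℂ) • g y := by
  have hyD : (y : ℂ) ∈ D := by
    rw [← Real.cos_arccos hy.1 hy.2, ← joukowski_exp]
    apply hJ <;> simp [Complex.norm_exp_ofReal_mul_I, hR.le]
  -- Writing `g = g(y) + (· - y) q` with `q` holomorphic cancels the zeros of the denominator. The
  -- part with `q` can then be moved to the unit circle, where its integral vanishes, and the
  -- constant part is the integral of the kernel.
  set q := dslope g y with hq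
  have hqD : DifferentiableOn ℂ q D :=
    (Complex.differentiableOn_dslope (hD.mem_nhds hyD)).2 hg
  have hd : ∀ w : ℂ, 1 ≤ ‖w‖ → ‖w‖ ≤ R →
      DifferentiableAt ℂ (fun ζ : ℂ => ((ζ ^ 2 - 1) / (2 * ζ ^ 2)) • q (joukowski ζ)) w := by
    intro w h1 h2
    have h0 : w ≠ 0 := norm_pos_iff.1 (by linarith)
    refine DifferentiableAt.fun_smul ?_ ?_
    · refine DifferentiableAt.fun_div (by fun_prop) (by fun_prop) (by simpa using h0)
    · exact (hqD.differentiableAt (hD.mem_nhds (hJ w h1 h2))).comp w (continuousAt_joukowski h0)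
  have h1 : (∮ ζ in C(0, R), ((ζ ^ 2 - 1) / (2 * ζ ^ 2)) • q (joukowski ζ)) = 0 := by
    rw [Complex.circleIntegral_eq_of_differentiable_on_annulus_off_countable one_pos hR.le
      Set.countable_empty, circleIntegral_joukowski_deriv_unit]
    · intro w hw
      simp only [Set.mem_sdiff, mem_closedBall_zero_iff, mem_ball_zero_iff, not_lt] at hw
      exact (hd w hw.2 hw.1).continuousAt.continuousWithinAt
    · intro w hw
      simp only [Set.mem_sdiff, mem_closedBall_zero_iff, mem_ball_zero_iff, not_le] at hw
      exact hd w hw.1.2.le hw.1.1.le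
  have h2 : Set.EqOn (fun ζ : ℂ => ((ζ ^ 2 - 1) / (ζ * (ζ ^ 2 - 2 * y * ζ + 1))) • g (joukowski ζ))
      (fun ζ => ((ζ ^ 2 - 1) / (2 * ζ ^ 2)) • q (joukowski ζ) +
        ((ζ ^ 2 - 1) / (ζ * (ζ ^ 2 - 2 * y * ζ + 1))) • g y) (Metric.sphere 0 R) := by
    intro ζ hζ
    have hn : ‖ζ‖ = R := by simpa using hζ
    have h0 : ζ ≠ 0 := norm_pos_iff.1 (by linarith)
    have hdn := sq_sub_two_mul_add_one_ne_zero hy (hn.symm ▸ hR)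
    have h3 : g (joukowski ζ) = (joukowski ζ - y) • q (joukowski ζ) + g y := by
      rw [hq, sub_smul_dslope, sub_add_cancel]
    have h4 : (ζ ^ 2 - 1) / (ζ * (ζ ^ 2 - 2 * y * ζ + 1)) * (joukowski ζ - y) =
        (ζ ^ 2 - 1) / (2 * ζ ^ 2) := by
      have h5 : joukowski ζ - y = (ζ ^ 2 - 2 * y * ζ + 1) / (2 * ζ) := by
        rw [joukowski]
        field_simp
        ring
      rw [h5]
      generalize ζ ^ 2 - 2 * y * ζ + 1 = d at hdn
      field_simp
    simp only
    rw [h3, smul_add, smul_smul, h4]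
  have hsub : ∀ w ∈ Metric.sphere (0 : ℂ) R, ‖w‖ = R := by simp
  rw [circleIntegral.integral_congr (by linarith) h2, circleIntegral.integral_add, h1, zero_add,
    circleIntegral.integral_smul_const, circleIntegral_joukowski_kernel hR hy]
  · refine ContinuousOn.circleIntegrable (by linarith) fun w hw => ?_
    have := hsub w hw
    exact (hd w (by linarith) this.le).continuousAt.continuousWithinAt
  · refine ContinuousOn.circleIntegrable (by linarith) fun w hw => ?_
    have hw' := hsub w hw
    refine ContinuousAt.continuousWithinAt ?_
    have h0 : w ≠ 0 := norm_pos_iff.1 (by linarith)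
    have hdn := sq_sub_two_mul_add_one_ne_zero hy (hw'.symm ▸ hR)
    refine ContinuousAt.smul (ContinuousAt.div (by fun_prop) (by fun_prop) ?_) continuousAt_const
    exact mul_ne_zero h0 hdn

end Cauchy

/-! ## Legendre coefficients as contour integrals -/

lemma abs_eval_chebyshev_le_one (k : ℤ) {y : ℝ} (hy : y ∈ Set.Icc (-1 : ℝ) 1) :
    |(Chebyshev.T ℝ k).eval y| ≤ 1 := by
  rw [← Real.cos_arccos hy.1 hy.2, Chebyshev.T_real_cos]
  exact Real.abs_cos_le_one _

/-- The partial sum of the generating function `(1 - u²) / (1 - 2yu + u²)` of the Chebyshev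
polynomials. -/
noncomputable def chebyshevPartial (n : ℕ) (y : ℝ) (u : ℂ) : ℂ :=
  1 + ∑ k ∈ Finset.range n, 2 * (((Chebyshev.T ℝ (k + 1)).eval y : ℝ) : ℂ) * u ^ (k + 1)

/-- The remainder that belongs to `chebyshevPartial`. -/
noncomputable def chebyshevRemainder (n : ℕ) (y : ℝ) (u : ℂ) : ℂ :=
  (2 * (((Chebyshev.T ℝ (n + 1)).eval y : ℝ) : ℂ) * u ^ (n + 1) -
    2 * (((Chebyshev.T ℝ n).eval y : ℝ) : ℂ) * u ^ (n + 2)) / (1 - 2 * y * u + u ^ 2)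

/-- The three-term recurrence makes the product telescope. An exact finite identity replaces the
generating series, so that no series has to be integrated termwise. -/
lemma one_sub_sq_eq_chebyshev (n : ℕ) (y : ℝ) (u : ℂ) :
    1 - u ^ 2 = (1 - 2 * y * u + u ^ 2) * chebyshevPartial n y u +
      (2 * (((Chebyshev.T ℝ (n + 1)).eval y : ℝ) : ℂ) * u ^ (n + 1) -
        2 * (((Chebyshev.T ℝ n).eval y : ℝ) : ℂ) * u ^ (n + 2)) := by
  induction n with
  | zero => simp [chebyshevPartial]; ring
  | succ n ih =>
    have h : (Chebyshev.T ℝ ((n + 1 : ℕ) + 1)).eval y =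
        2 * y * (Chebyshev.T ℝ (n + 1)).eval y - (Chebyshev.T ℝ n).eval y := by
      have := Chebyshev.T_add_two ℝ n
      push_cast
      rw [show (n : ℤ) + 1 + 1 = n + 2 by ring, this]
      simp
    rw [ih, chebyshevPartial, chebyshevPartial, Finset.sum_range_succ, h]
    push_cast
    ring

/-- The quadratic factors as `(1 - e u)(1 - e⁻¹ u)` with `|e| = 1`. -/
lemma one_sub_norm_sq_le {y : ℝ} (hy : y ∈ Set.Icc (-1 : ℝ) 1) {u : ℂ} (hu : ‖u‖ < 1) :
    (1 - ‖u‖) ^ 2 ≤ ‖1 - 2 * y * u + u ^ 2‖ := by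
  set e := Complex.exp (Real.arccos y * Complex.I)
  have hne : ‖e‖ = 1 := Complex.norm_exp_ofReal_mul_I _
  have h := joukowski_exp (Real.arccos y)
  rw [Real.cos_arccos hy.1 hy.2, joukowski] at h
  have he := mul_inv_cancel₀ (Complex.exp_ne_zero (Real.arccos y * Complex.I))
  have h1 : 1 - 2 * y * u + u ^ 2 = (1 - e * u) * (1 - e⁻¹ * u) := by
    linear_combination 2 * u * h - u ^ 2 * he
  have h2 : ∀ a : ℂ, ‖a‖ = 1 → 1 - ‖u‖ ≤ ‖1 - a * u‖ := by
    intro a ha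
    have := norm_sub_norm_le (1 : ℂ) (a * u)
    rwa [norm_one, norm_mul, ha, one_mul] at this
  rw [h1, norm_mul, sq]
  exact mul_le_mul (h2 _ hne) (h2 _ (by rw [norm_inv, hne, inv_one])) (by linarith) (norm_nonneg _)

lemma one_sub_two_mul_add_ne_zero {y : ℝ} (hy : y ∈ Set.Icc (-1 : ℝ) 1) {u : ℂ} (hu : ‖u‖ < 1) :
    1 - 2 * y * u + u ^ 2 ≠ 0 := by
  have h := one_sub_norm_sq_le hy hu
  rw [← norm_pos_iff]
  have : 0 < (1 - ‖u‖) ^ 2 := by have : 0 < 1 - ‖u‖ := by linarith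
                                 positivity
  linarith

lemma norm_chebyshevRemainder_le (n : ℕ) {y : ℝ} (hy : y ∈ Set.Icc (-1 : ℝ) 1) {u : ℂ}
    (hu : ‖u‖ < 1) : ‖chebyshevRemainder n y u‖ ≤ 4 * ‖u‖ ^ (n + 1) / (1 - ‖u‖) ^ 2 := by
  have h0 : 0 < (1 - ‖u‖) ^ 2 := by
    have : 0 < 1 - ‖u‖ := by linarith
    positivity
  rw [chebyshevRemainder, norm_div]
  refine div_le_div₀ (by positivity) ?_ h0 (one_sub_norm_sq_le hy hu)
  have h1 : ∀ k : ℤ, ‖(((Chebyshev.T ℝ k).eval y : ℝ) : ℂ)‖ ≤ 1 := by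
    intro k
    rw [Complex.norm_real]
    exact abs_eval_chebyshev_le_one k hy
  refine (norm_sub_le _ _).trans ?_
  simp only [norm_mul, Complex.norm_ofNat, norm_pow]
  have h2 : ‖u‖ ^ (n + 2) ≤ ‖u‖ ^ (n + 1) :=
    pow_le_pow_of_le_one (norm_nonneg _) hu.le (by omega)
  have h3 : 0 ≤ ‖u‖ ^ (n + 1) := by positivity
  have h4 : 0 ≤ ‖u‖ ^ (n + 2) := by positivity
  nlinarith [mul_le_mul_of_nonneg_right (h1 (n + 1)) h3, mul_le_mul_of_nonneg_right (h1 n) h4]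

/-- For fixed `u` the partial sum is a polynomial in `y` of degree at most `n`, and the Legendre
polynomial of degree `n + 1` is orthogonal to all of these. -/
lemma integral_legendre_mul_chebyshevPartial (n : ℕ) (u : ℂ) :
    ∫ y, (legendre (n + 1) y : ℂ) * chebyshevPartial n y u ∂uniformInterval = 0 := by
  have hi : ∀ f : ℝ → ℂ, Continuous f →
      Integrable (fun y : Set.Icc (-1 : ℝ) 1 => f y) uniformInterval :=
    fun f hf => (hf.comp continuous_subtype_val).integrable_of_hasCompactSupport
      (HasCompactSupport.of_compactSpace _)
  have h0 : ∀ q : ℝ[X], q.natDegree < n + 1 →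
      ∫ y, ((legendre (n + 1) y : ℂ) * ((q.eval (y : ℝ) : ℝ) : ℂ)) ∂uniformInterval = 0 := by
    intro q hq
    simp_rw [← Complex.ofReal_mul]
    rw [integral_complex_ofReal, integral_uniformInterval (fun y => legendre (n + 1) y * q.eval y),
      integral_legendre_mul_eval_eq_zero hq]
    simp
  have hT : ∀ k ∈ Finset.range n, (Chebyshev.T ℝ (k + 1)).natDegree < n + 1 := by
    intro k hk
    rw [Chebyshev.natDegree_T]
    have := Finset.mem_range.1 hk
    omega
  have h1 : ∀ y : ℝ, (legendre (n + 1) y : ℂ) * chebyshevPartial n y u =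
      (legendre (n + 1) y : ℂ) * (((1 : ℝ[X]).eval y : ℝ) : ℂ) + ∑ k ∈ Finset.range n,
        ((legendre (n + 1) y : ℂ) * (((Chebyshev.T ℝ (k + 1)).eval y : ℝ) : ℂ)) * (2 * u ^ (k + 1)) := by
    intro y
    rw [chebyshevPartial, mul_add, Finset.mul_sum, eval_one, Complex.ofReal_one]
    congr 1
    exact Finset.sum_congr rfl fun k _ => by ring
  have hcont : ∀ q : ℝ[X], Continuous fun y : ℝ => ((q.eval y : ℝ) : ℂ) :=
    fun q => Complex.continuous_ofReal.comp q.continuous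
  have hl : Continuous fun y : ℝ => (legendre (n + 1) y : ℂ) :=
    Complex.continuous_ofReal.comp (continuous_legendre _)
  simp_rw [h1]
  rw [integral_add (hi (fun y => (legendre (n + 1) y : ℂ) * (((1 : ℝ[X]).eval y : ℝ) : ℂ))
      (hl.mul (hcont _))), h0 1 (by simp), zero_add, integral_finsetSum]
  · refine Finset.sum_eq_zero fun k hk => ?_
    rw [integral_mul_const, h0 _ (hT k hk), zero_mul]
  · intro k _
    exact hi (fun y => ((legendre (n + 1) y : ℂ) * (((Chebyshev.T ℝ (k + 1)).eval y : ℝ) : ℂ)) *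
      (2 * u ^ (k + 1))) ((hl.mul (hcont _)).mul continuous_const)
  · exact hi (fun y => ∑ k ∈ Finset.range n, ((legendre (n + 1) y : ℂ) *
      (((Chebyshev.T ℝ (k + 1)).eval y : ℝ) : ℂ)) * (2 * u ^ (k + 1)))
      (continuous_finsetSum _ fun k _ => (hl.mul (hcont _)).mul continuous_const)

/-- The interval `[0, 2π]` of angles. -/
abbrev Angle : Type := Set.Icc (0 : ℝ) (2 * Real.pi)

/-- Lebesgue measure on the interval of angles. -/
noncomputable def angleMeasure : Measure Angle := (volume : Measure ℝ).comap Subtype.val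

lemma angleMeasure_univ : angleMeasure Set.univ = ENNReal.ofReal (2 * Real.pi) := by
  rw [angleMeasure, (MeasurableEmbedding.subtype_coe measurableSet_Icc).comap_apply,
    Set.image_univ, Subtype.range_coe, Real.volume_Icc, sub_zero]

instance angleMeasure.isFiniteMeasure : IsFiniteMeasure angleMeasure :=
  ⟨by rw [angleMeasure_univ]; exact ENNReal.ofReal_lt_top⟩

lemma angleMeasure_real_univ : angleMeasure.real Set.univ = 2 * Real.pi := by
  rw [measureReal_def, angleMeasure_univ, ENNReal.toReal_ofReal (by positivity)]

lemma integral_angleMeasure {E : Type*} [NormedAddCommGroup E] [NormedSpace ℝ E] (f : ℝ → E) :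
    ∫ θ : Angle, f θ ∂angleMeasure = ∫ θ in (0 : ℝ)..(2 * Real.pi), f θ := by
  rw [angleMeasure, intervalIntegral.integral_of_le (by positivity),
    ← integral_Icc_eq_integral_Ioc]
  exact integral_subtype_comap measurableSet_Icc f

lemma norm_inv_circleMap {R : ℝ} (hR : 1 < R) (θ : ℝ) : ‖(circleMap 0 R θ)⁻¹‖ = R⁻¹ := by
  rw [norm_inv, norm_circleMap_zero, abs_of_pos (by linarith)]

/-- The kernel that represents the Legendre coefficient number `n + 1` of a holomorphic function as
an integral over a Bernstein ellipse. -/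
noncomputable def legendreKernel (n : ℕ) (R : ℝ) (θ : ℝ) : ℂ :=
  (2 * Real.pi : ℂ)⁻¹ * ∫ y, (legendre (n + 1) y : ℂ) *
    chebyshevRemainder n y (circleMap 0 R θ)⁻¹ ∂uniformInterval

lemma continuous_legendre_mul_chebyshevRemainder (n : ℕ) {R : ℝ} (hR : 1 < R) :
    Continuous fun x : ℝ × Set.Icc (-1 : ℝ) 1 =>
      (legendre (n + 1) x.2 : ℂ) * chebyshevRemainder n x.2 (circleMap 0 R x.1)⁻¹ := by
  have hu : Continuous fun x : ℝ × Set.Icc (-1 : ℝ) 1 => (circleMap 0 R x.1)⁻¹ :=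
    ((continuous_circleMap 0 R).comp continuous_fst).inv₀ fun x =>
      circleMap_ne_center (by linarith)
  have hT : ∀ k : ℤ, Continuous fun x : ℝ × Set.Icc (-1 : ℝ) 1 =>
      (((Chebyshev.T ℝ k).eval (x.2 : ℝ) : ℝ) : ℂ) := fun k =>
    Complex.continuous_ofReal.comp ((Chebyshev.T ℝ k).continuous.comp
      (continuous_subtype_val.comp continuous_snd))
  have hy : Continuous fun x : ℝ × Set.Icc (-1 : ℝ) 1 => ((x.2 : ℝ) : ℂ) := by fun_prop
  have hl : Continuous fun x : ℝ × Set.Icc (-1 : ℝ) 1 => ((legendre (n + 1) x.2 : ℝ) : ℂ) := by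
    fun_prop
  refine hl.mul (Continuous.div (((continuous_const.mul (hT _)).mul (hu.pow _)).sub
    ((continuous_const.mul (hT _)).mul (hu.pow _))) ((continuous_const.sub
      ((continuous_const.mul hy).mul hu)).add (hu.pow _)) fun x => ?_)
  refine one_sub_two_mul_add_ne_zero x.2.2 ?_
  rw [norm_inv_circleMap hR]
  exact inv_lt_one_of_one_lt₀ hR

lemma continuous_legendreKernel (n : ℕ) {R : ℝ} (hR : 1 < R) :
    Continuous (legendreKernel n R) := by
  refine continuous_const.mul ?_
  have := continuous_parametric_integral_of_continuous (μ := uniformInterval)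
    (f := fun (θ : ℝ) (y : Set.Icc (-1 : ℝ) 1) => (legendre (n + 1) y : ℂ) *
      chebyshevRemainder n y (circleMap 0 R θ)⁻¹) (continuous_legendre_mul_chebyshevRemainder n hR) (s := Set.univ) isCompact_univ
  simpa using this

lemma norm_legendreKernel_le (n : ℕ) {R : ℝ} (hR : 1 < R) (θ : ℝ) :
    ‖legendreKernel n R θ‖ ≤ (2 * Real.pi)⁻¹ * (4 * (R⁻¹) ^ (n + 1) / (1 - R⁻¹) ^ 2) := by
  rw [legendreKernel, norm_mul]
  have h1 : ‖(2 * Real.pi : ℂ)⁻¹‖ = (2 * Real.pi)⁻¹ := by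
    simp [abs_of_pos Real.pi_pos]
  rw [h1]
  refine mul_le_mul_of_nonneg_left ?_ (by positivity)
  set B := 4 * (R⁻¹) ^ (n + 1) / (1 - R⁻¹) ^ 2 with hB
  have hB0 : 0 ≤ B := by positivity
  have hint : Integrable (fun y : Set.Icc (-1 : ℝ) 1 => |legendre (n + 1) y| * B) uniformInterval :=
    Continuous.integrable_of_hasCompactSupport (by fun_prop) (HasCompactSupport.of_compactSpace _)
  refine (norm_integral_le_of_norm_le hint (ae_of_all _ fun y => ?_)).trans ?_
  · rw [norm_mul, Complex.norm_real, Real.norm_eq_abs]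
    refine mul_le_mul_of_nonneg_left ?_ (abs_nonneg _)
    have := norm_chebyshevRemainder_le n y.2 (u := (circleMap 0 R θ)⁻¹)
      (by rw [norm_inv_circleMap hR]; exact inv_lt_one_of_one_lt₀ hR)
    rwa [norm_inv_circleMap hR] at this
  · rw [integral_mul_const]
    exact mul_le_of_le_one_left hB0 (integral_abs_legendre_le _)

section

variable {W : Type*} [NormedAddCommGroup W] [NormedSpace ℂ W] [CompleteSpace W]

lemma continuous_joukowski_circleMap {R : ℝ} (hR : 1 < R) :
    Continuous fun θ : ℝ => joukowski (circleMap 0 R θ) := by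
  unfold joukowski
  exact ((continuous_circleMap 0 R).add ((continuous_circleMap 0 R).inv₀ fun θ =>
    circleMap_ne_center (by linarith))).div_const _

/-- This is `circleIntegral_joukowski` after `dζ = iζ dθ` and `u = ζ⁻¹`, with the kernel split into
partial sum and remainder. -/
lemma eq_integral_chebyshev {D : Set ℂ} (hD : IsOpen D) {R : ℝ} (hR : 1 < R)
    (hJ : ∀ w : ℂ, 1 ≤ ‖w‖ → ‖w‖ ≤ R → joukowski w ∈ D) {g : ℂ → W}
    (hg : DifferentiableOn ℂ g D) {y : ℝ} (hy : y ∈ Set.Icc (-1 : ℝ) 1) (n : ℕ) :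
    g y = (2 * Real.pi : ℂ)⁻¹ • ∫ θ : Angle, (chebyshevPartial n y (circleMap 0 R θ)⁻¹ +
      chebyshevRemainder n y (circleMap 0 R θ)⁻¹) • g (joukowski (circleMap 0 R θ))
        ∂angleMeasure := by
  have h := circleIntegral_joukowski hD hR hJ hg hy
  have h1 : (∮ ζ in C(0, R), ((ζ ^ 2 - 1) / (ζ * (ζ ^ 2 - 2 * y * ζ + 1))) • g (joukowski ζ)) =
      Complex.I • ∫ θ in (0 : ℝ)..(2 * Real.pi), (chebyshevPartial n y (circleMap 0 R θ)⁻¹ +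
      chebyshevRemainder n y (circleMap 0 R θ)⁻¹) • g (joukowski (circleMap 0 R θ)) := by
    rw [circleIntegral, ← intervalIntegral.integral_smul]
    refine intervalIntegral.integral_congr fun θ _ => ?_
    simp only [deriv_circleMap]
    set ζ := circleMap 0 R θ
    have h0 : ζ ≠ 0 := circleMap_ne_center (by linarith)
    have hd := one_sub_two_mul_add_ne_zero hy (u := ζ⁻¹)
      (by rw [norm_inv_circleMap hR]; exact inv_lt_one_of_one_lt₀ hR)
    have h2 : chebyshevPartial n y ζ⁻¹ + chebyshevRemainder n y ζ⁻¹ =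
        (1 - ζ⁻¹ ^ 2) / (1 - 2 * y * ζ⁻¹ + ζ⁻¹ ^ 2) := by
      rw [one_sub_sq_eq_chebyshev n y ζ⁻¹, chebyshevRemainder, add_div, mul_div_cancel_left₀ _ hd]
    have h3 : ζ ^ 2 * (1 - 2 * y * ζ⁻¹ + ζ⁻¹ ^ 2) = ζ ^ 2 - 2 * y * ζ + 1 := by field_simp
    have h4 : ζ ^ 2 * (1 - ζ⁻¹ ^ 2) = ζ ^ 2 - 1 := by field_simp
    rw [h2, smul_smul, smul_smul, ← h3, ← h4]
    congr 1
    field_simp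
  rw [h1] at h
  rw [integral_angleMeasure (fun θ => (chebyshevPartial n y (circleMap 0 R θ)⁻¹ +
      chebyshevRemainder n y (circleMap 0 R θ)⁻¹) • g (joukowski (circleMap 0 R θ)))]
  have h5 : (2 * Real.pi * Complex.I : ℂ) • g y = Complex.I • (2 * Real.pi : ℂ) • g y := by
    rw [smul_smul, mul_comm Complex.I]
  rw [h5] at h
  have h6 := smul_right_injective W Complex.I_ne_zero h
  rw [h6, smul_smul, inv_mul_cancel₀ (by simp [Real.pi_ne_zero]), one_smul]

/-- A Legendre coefficient of a holomorphic function as an integral over a Bernstein ellipse. -/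
theorem integral_legendre_smul_eq {D : Set ℂ} (hD : IsOpen D) {R : ℝ} (hR : 1 < R)
    (hJ : ∀ w : ℂ, 1 ≤ ‖w‖ → ‖w‖ ≤ R → joukowski w ∈ D) {g : ℂ → W}
    (hg : DifferentiableOn ℂ g D) (n : ℕ) :
    ∫ y, (legendre (n + 1) y : ℂ) • g (y : ℝ) ∂uniformInterval =
      ∫ θ : Angle, legendreKernel n R θ • g (joukowski (circleMap 0 R θ)) ∂angleMeasure := by
  have hgc : Continuous fun θ : ℝ => g (joukowski (circleMap 0 R θ)) := by
    refine hg.continuousOn.comp_continuous (continuous_joukowski_circleMap hR) fun θ => ?_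
    have hn : ‖circleMap 0 R θ‖ = R := by rw [norm_circleMap_zero, abs_of_pos (by linarith)]
    exact hJ _ (by linarith) hn.le
  have hu : Continuous fun x : Set.Icc (-1 : ℝ) 1 × Angle => (circleMap 0 R x.2)⁻¹ :=
    ((continuous_circleMap 0 R).comp (continuous_subtype_val.comp continuous_snd)).inv₀ fun x =>
      circleMap_ne_center (by linarith)
  have hP : Continuous fun x : Set.Icc (-1 : ℝ) 1 × Angle =>
      chebyshevPartial n x.1 (circleMap 0 R x.2)⁻¹ := by
    refine continuous_const.add (continuous_finsetSum _ fun k _ => ?_)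
    exact (continuous_const.mul (Complex.continuous_ofReal.comp ((Chebyshev.T ℝ _).continuous.comp
      (continuous_subtype_val.comp continuous_fst)))).mul (hu.pow _)
  have hl : Continuous fun x : Set.Icc (-1 : ℝ) 1 × Angle => ((legendre (n + 1) x.1 : ℝ) : ℂ) := by
    fun_prop
  have hQ : Continuous fun x : Set.Icc (-1 : ℝ) 1 × Angle => (legendre (n + 1) x.1 : ℂ) *
      chebyshevRemainder n x.1 (circleMap 0 R x.2)⁻¹ :=
    (continuous_legendre_mul_chebyshevRemainder n hR).comp
      ((continuous_subtype_val.comp continuous_snd).prodMk continuous_fst)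
  set h : Angle → W := fun θ => g (joukowski (circleMap 0 R θ)) with hh
  have hhc : Continuous h := hgc.comp continuous_subtype_val
  set Φ : Set.Icc (-1 : ℝ) 1 → Angle → ℂ := fun y θ =>
    (legendre (n + 1) y : ℂ) * chebyshevPartial n y (circleMap 0 R θ)⁻¹ +
      (legendre (n + 1) y : ℂ) * chebyshevRemainder n y (circleMap 0 R θ)⁻¹ with hΦ
  have hΦc : Continuous (Function.uncurry Φ) := (hl.mul hP).add hQ
  have h1 : ∀ y : Set.Icc (-1 : ℝ) 1, (legendre (n + 1) y : ℂ) • g (y : ℝ) =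
      (2 * Real.pi : ℂ)⁻¹ • ∫ θ, Φ y θ • h θ ∂angleMeasure := by
    intro y
    rw [eq_integral_chebyshev hD hR hJ hg y.2 n, smul_comm, ← integral_smul]
    simp_rw [smul_smul, mul_add]
    rfl
  simp_rw [h1]
  -- After Fubini the inner integral over `y` is scalar. Its partial-sum term vanishes by
  -- orthogonality, and the rest is `legendreKernel`.
  rw [integral_smul, integral_integral_swap, ← integral_smul]
  · refine integral_congr_ae (ae_of_all _ fun θ => ?_)
    simp only
    rw [integral_smul_const, smul_smul]
    congr 1
    rw [legendreKernel]
    congr 1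
    have hi : ∀ f : Set.Icc (-1 : ℝ) 1 → ℂ, Continuous f → Integrable f uniformInterval :=
      fun f hf => hf.integrable_of_hasCompactSupport (HasCompactSupport.of_compactSpace f)
    have hs : Continuous fun y : Set.Icc (-1 : ℝ) 1 => (y, θ) := by fun_prop
    refine (integral_add (hi (fun y => (legendre (n + 1) y : ℂ) * chebyshevPartial n y
      (circleMap 0 R θ)⁻¹) ((hl.mul hP).comp hs)) (hi _ (hQ.comp hs))).trans ?_
    rw [integral_legendre_mul_chebyshevPartial, zero_add]
    rfl
  · exact Continuous.integrable_of_hasCompactSupport (hΦc.smul (hhc.comp continuous_snd))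
      (HasCompactSupport.of_compactSpace _)

end

/-! ## Legendre coefficients of functions of several variables -/

lemma integrable_of_continuous_of_compactSpace {X E : Type*} [TopologicalSpace X] [CompactSpace X]
    [MeasurableSpace X] [OpensMeasurableSpace X] {μ : Measure X} [IsFiniteMeasure μ]
    [NormedAddCommGroup E] [SecondCountableTopologyEither X E] {f : X → E} (hf : Continuous f) :
    Integrable f μ := by
  have hs : IsCompact (Set.range f) := isCompact_range hf
  obtain ⟨C, hC⟩ := hs.isBounded.exists_norm_le
  exact Integrable.of_bound hf.aestronglyMeasurable C (ae_of_all _ fun x => hC _ ⟨x, rfl⟩)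

lemma integral_pi_succ {X E : Type*} [TopologicalSpace X] [CompactSpace X]
    [SecondCountableTopology X] [MeasurableSpace X] [BorelSpace X] (μ : Measure X)
    [IsFiniteMeasure μ] [NormedAddCommGroup E] [NormedSpace ℝ E] (s : ℕ)
    {f : (Fin (s + 1) → X) → E} (hf : Continuous f) :
    ∫ x, f x ∂(Measure.pi fun _ => μ) =
      ∫ x₀, ∫ x, f (Fin.cons x₀ x) ∂(Measure.pi fun _ => μ) ∂μ := by
  have h := (measurePreserving_piFinSuccAbove (fun _ : Fin (s + 1) => μ) 0).symm
  have hc : Continuous fun p : X × (Fin s → X) => f (Fin.cons p.1 p.2) := by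
    refine hf.comp (continuous_pi fun i => ?_)
    refine Fin.cases ?_ (fun j => ?_) i <;> simp only [Fin.cons_zero, Fin.cons_succ] <;> fun_prop
  rw [← h.integral_comp']
  simp only [MeasurableEquiv.piFinSuccAbove_symm_apply, Fin.insertNthEquiv, Fin.insertNth_zero,
    Equiv.coe_fn_mk]
  exact integral_prod _ (integrable_of_continuous_of_compactSpace hc)

/-- In an integral over a product space, the representation of a linear functional on functions of
one variable can be exchanged in every variable. -/
lemma integral_pi_exchange {X Y : Type} {W : Type*} [TopologicalSpace X] [CompactSpace X]
    [SecondCountableTopology X] [MeasurableSpace X] [BorelSpace X] [TopologicalSpace Y]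
    [CompactSpace Y] [SecondCountableTopology Y] [MeasurableSpace Y] [BorelSpace Y]
    (μ : Measure X) [IsFiniteMeasure μ] (ν : Measure Y) [IsFiniteMeasure ν]
    [NormedAddCommGroup W] [NormedSpace ℂ W] [CompleteSpace W] (s : ℕ) (D : Fin s → Set ℂ)
    (a : X → ℂ) (ha : Continuous a) (haD : ∀ i x, a x ∈ D i)
    (b : Fin s → Y → ℂ) (hb : ∀ i, Continuous (b i)) (hbD : ∀ i y, b i y ∈ D i)
    (φ : Fin s → X → ℂ) (hφ : ∀ i, Continuous (φ i)) (ψ : Fin s → Y → ℂ)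
    (hψ : ∀ i, Continuous (ψ i))
    (hex : ∀ i, ∀ g : ℂ → W, DifferentiableOn ℂ g (D i) →
      ∫ x, φ i x • g (a x) ∂μ = ∫ y, ψ i y • g (b i y) ∂ν)
    (G : (Fin s → ℂ) → W) (hG : DifferentiableOn ℂ G (Set.univ.pi D)) :
    ∫ x, (∏ i, φ i (x i)) • G (fun i => a (x i)) ∂(Measure.pi fun _ => μ) =
      ∫ y, (∏ i, ψ i (y i)) • G (fun i => b i (y i)) ∂(Measure.pi fun _ => ν) := by
  induction s with
  | zero =>
    have h1 : (fun x : Fin 0 → X => (∏ i, φ i (x i)) • G (fun i => a (x i))) = fun _ => G default := by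
      funext x; simp [Subsingleton.elim (fun i => a (x i)) default]
    have h2 : (fun y : Fin 0 → Y => (∏ i, ψ i (y i)) • G (fun i => b i (y i))) = fun _ => G default := by
      funext y; simp [Subsingleton.elim (fun i => b i (y i)) default]
    rw [h1, h2]
    simp [measureReal_def]
  | succ s ih =>
    have hcons : ∀ {t : ℂ} {z : Fin s → ℂ}, t ∈ D 0 → (∀ i, z i ∈ D i.succ) →
        (Fin.cons t z : Fin (s + 1) → ℂ) ∈ Set.univ.pi D := by
      intro t z ht hz i _
      refine Fin.cases ?_ (fun j => ?_) i
      · simpa using ht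
      · simpa using hz j
    have hG0 : ∀ t ∈ D 0, DifferentiableOn ℂ (fun z : Fin s → ℂ => G (Fin.cons t z))
        (Set.univ.pi fun i => D i.succ) := by
      intro t ht
      refine hG.comp (t := Set.univ.pi D) (f := fun z : Fin s → ℂ => (Fin.cons t z : Fin (s + 1) → ℂ)) ?_ ?_
      · refine differentiableOn_pi.2 fun i => ?_
        refine Fin.cases ?_ (fun j => ?_) i
        · simp only [Fin.cons_zero]; fun_prop
        · simp only [Fin.cons_succ]; fun_prop
      · intro z hz
        exact hcons ht fun i => hz i trivial
    have hG1 : ∀ z : Fin s → ℂ, (∀ i, z i ∈ D i.succ) →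
        DifferentiableOn ℂ (fun t => G (Fin.cons t z)) (D 0) := by
      intro z hz
      refine hG.comp (t := Set.univ.pi D) (f := fun t : ℂ => (Fin.cons t z : Fin (s + 1) → ℂ)) ?_ ?_
      · refine differentiableOn_pi.2 fun i => ?_
        refine Fin.cases ?_ (fun j => ?_) i
        · simp only [Fin.cons_zero]; fun_prop
        · simp only [Fin.cons_succ]; fun_prop
      · intro t ht
        exact hcons ht hz
    have hc : ∀ {Z : Type} [TopologicalSpace Z] (u : Z → ℂ) (v : Z → Fin s → ℂ), Continuous u →
        Continuous v → (∀ z, u z ∈ D 0) → (∀ z i, v z i ∈ D i.succ) →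
        Continuous fun z => G (Fin.cons (u z) (v z)) := by
      intro Z _ u v hu hv hu' hv'
      refine hG.continuousOn.comp_continuous (continuous_pi fun i => ?_) fun z => hcons (hu' z) (hv' z)
      refine Fin.cases ?_ (fun j => ?_) i <;> simp only [Fin.cons_zero, Fin.cons_succ]
      · exact hu
      · exact (continuous_apply j).comp hv
    have hXc : Continuous fun x : Fin (s + 1) → X => (∏ i, φ i (x i)) • G (fun i => a (x i)) := by
      refine (continuous_finsetProd _ fun i _ => (hφ i).comp (continuous_apply i)).smul ?_
      exact hG.continuousOn.comp_continuous (by fun_prop) fun x i _ => haD i _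
    have hYc : Continuous fun y : Fin (s + 1) → Y => (∏ i, ψ i (y i)) • G (fun i => b i (y i)) := by
      refine (continuous_finsetProd _ fun i _ => (hψ i).comp (continuous_apply i)).smul ?_
      exact hG.continuousOn.comp_continuous
        (continuous_pi fun i => (hb i).comp (continuous_apply i)) fun x i _ => hbD i _
    have hconsX : ∀ (x₀ : X) (x : Fin s → X),
        (fun i => a ((Fin.cons x₀ x : Fin (s + 1) → X) i)) =
          (Fin.cons (a x₀) (fun i => a (x i)) : Fin (s + 1) → ℂ) := by
      intro x₀ x
      funext i
      refine Fin.cases ?_ (fun j => ?_) i <;> simp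
    have hconsY : ∀ (y₀ : Y) (y : Fin s → Y),
        (fun i => b i ((Fin.cons y₀ y : Fin (s + 1) → Y) i)) =
          (Fin.cons (b 0 y₀) (fun i => b i.succ (y i)) : Fin (s + 1) → ℂ) := by
      intro x₀ x
      funext i
      refine Fin.cases ?_ (fun j => ?_) i <;> simp
    rw [integral_pi_succ μ s hXc, integral_pi_succ ν s hYc]
    simp only [Fin.prod_univ_succ, Fin.cons_zero, Fin.cons_succ, hconsX, hconsY, mul_smul,
      integral_smul]
    have h1 : ∀ x₀ : X, ∫ x, (∏ i : Fin s, φ i.succ (x i)) • G (Fin.cons (a x₀) fun i => a (x i))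
          ∂(Measure.pi fun _ => μ) =
        ∫ y, (∏ i : Fin s, ψ i.succ (y i)) • G (Fin.cons (a x₀) fun i => b i.succ (y i))
          ∂(Measure.pi fun _ => ν) := fun x₀ =>
      ih (fun i => D i.succ) (fun i => haD i.succ) (fun i => b i.succ) (fun i => hb i.succ)
        (fun i => hbD i.succ) (fun i => φ i.succ) (fun i => hφ i.succ) (fun i => ψ i.succ)
        (fun i => hψ i.succ) (fun i => hex i.succ) _ (hG0 _ (haD 0 x₀))
    simp_rw [h1, ← integral_smul]
    have hψc : ∀ {Z : Type} [TopologicalSpace Z] (v : Z → Fin s → Y), Continuous v →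
        Continuous fun z => ∏ i : Fin s, ψ i.succ (v z i) := by
      intro Z _ v hv
      exact continuous_finsetProd _ fun i _ => (hψ i.succ).comp ((continuous_apply i).comp hv)
    have hbc : ∀ {Z : Type} [TopologicalSpace Z] (v : Z → Fin s → Y), Continuous v →
        Continuous fun z => fun i : Fin s => b i.succ (v z i) := by
      intro Z _ v hv
      exact continuous_pi fun i => (hb i.succ).comp ((continuous_apply i).comp hv)
    -- The induction hypothesis has exchanged the last `s` variables with the first one frozen.
    -- Fubini makes the first variable the inner one, `hex 0` exchanges it, and Fubini restores the
    -- order.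
    refine (integral_integral_swap ?_).trans (Eq.trans ?_ (integral_integral_swap ?_).symm)
    rotate_left
    · refine integral_congr_ae (ae_of_all _ fun y => ?_)
      simp only
      simp_rw [smul_comm _ (∏ i : Fin s, ψ i.succ (y i)), integral_smul]
      rw [hex 0 (fun t => G (Fin.cons t fun i => b i.succ (y i))) (hG1 _ fun i => hbD i.succ _)]
    · refine integrable_of_continuous_of_compactSpace ?_
      exact ((hψ 0).comp continuous_fst).smul ((hψc _ continuous_snd).smul
        (hc (fun p : Y × (Fin s → Y) => b 0 p.1) _ ((hb 0).comp continuous_fst) (hbc _ continuous_snd)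
          (fun _ => hbD 0 _) fun _ i => hbD i.succ _))
    · refine integrable_of_continuous_of_compactSpace ?_
      exact ((hφ 0).comp continuous_fst).smul ((hψc _ continuous_snd).smul
        (hc (fun p : X × (Fin s → Y) => a p.1) _ (ha.comp continuous_fst) (hbc _ continuous_snd)
          (fun _ => haD 0 _) fun _ i => hbD i.succ _))

/-- Replace the coordinates of a point of the cube in a finite set. -/
def cubeUpdate (S : Finset ℕ) (y : Cube) (w : S → Set.Icc (-1 : ℝ) 1) : Cube :=
  fun k => if h : k ∈ S then w ⟨k, h⟩ else y k

lemma continuous_cubeUpdate (S : Finset ℕ) :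
    Continuous fun p : Cube × (S → Set.Icc (-1 : ℝ) 1) => cubeUpdate S p.1 p.2 := by
  refine continuous_pi fun k => ?_
  by_cases h : k ∈ S <;> simp only [cubeUpdate, h, dite_true, dite_false] <;> fun_prop

/-- Resampling the coordinates in `S` independently preserves the product measure; it is enough to
check finite boxes. An integral over the cube thereby becomes an outer one over the frozen variables
and an inner one over finitely many variables. -/
lemma map_cubeUpdate (S : Finset ℕ) :
    (uniformCube.prod (Measure.pi fun _ : S => uniformInterval)).map
      (fun p => cubeUpdate S p.1 p.2) = uniformCube := by
  refine Measure.eq_infinitePi _ fun s t ht => ?_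
  have hm := (continuous_cubeUpdate S).measurable
  rw [Measure.map_apply hm (MeasurableSet.pi s.countable_toSet fun i _ => ht i)]
  have hpre : (fun p : Cube × (S → Set.Icc (-1 : ℝ) 1) => cubeUpdate S p.1 p.2) ⁻¹'
      (Set.pi s t) = (Set.pi (s \ S : Finset ℕ) t) ×ˢ
        (Set.pi Set.univ fun k : S => if (k : ℕ) ∈ s then t k else Set.univ) := by
    ext ⟨y, w⟩
    simp only [Set.mem_preimage, Set.mem_pi, Set.mem_prod, Finset.mem_coe, Finset.mem_sdiff,
      Set.mem_univ, true_implies, cubeUpdate]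
    constructor
    · intro h
      refine ⟨fun k hk => by simpa [hk.2] using h k hk.1, fun k => ?_⟩
      split_ifs with hk
      · simpa using h k hk
      · trivial
    · rintro ⟨h1, h2⟩ k hk
      by_cases hS : k ∈ S
      · have := h2 ⟨k, hS⟩
        rw [if_pos hk] at this
        simpa [hS] using this
      · simpa [hS] using h1 k ⟨hk, hS⟩
  rw [hpre, Measure.prod_prod, uniformCube, Measure.infinitePi_pi _ (fun i _ => ht i),
    Measure.pi_pi]
  have h1 : ∏ k : S, uniformInterval (if (k : ℕ) ∈ s then t k else Set.univ) =
      ∏ k ∈ S ∩ s, uniformInterval (t k) := by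
    rw [Finset.prod_coe_sort S fun k => uniformInterval (if k ∈ s then t k else Set.univ),
      ← Finset.prod_filter_mul_prod_filter_not S (· ∈ s)]
    rw [Finset.prod_congr rfl (g := fun k => uniformInterval (t k))
      (fun k hk => by rw [if_pos (Finset.mem_filter.1 hk).2]),
      Finset.prod_eq_one (s := S.filter (· ∉ s))
      (fun k hk => by rw [if_neg (Finset.mem_filter.1 hk).2, measure_univ]), mul_one,
      Finset.filter_mem_eq_inter]
  rw [h1, Finset.inter_comm, mul_comm, Finset.prod_inter_mul_prod_sdiff]

lemma integral_cubeUpdate {E : Type*} [NormedAddCommGroup E] [NormedSpace ℝ E] (S : Finset ℕ)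
    {f : Cube → E} (hf : Continuous f) :
    ∫ y, f y ∂uniformCube =
      ∫ y, ∫ w, f (cubeUpdate S y w) ∂(Measure.pi fun _ : S => uniformInterval) ∂uniformCube := by
  conv_lhs => rw [← map_cubeUpdate S]
  rw [integral_map (continuous_cubeUpdate S).aemeasurable hf.aestronglyMeasurable]
  exact integral_prod _ (integrable_of_continuous_of_compactSpace
    (hf.comp (continuous_cubeUpdate S)))

@[fun_prop]
lemma continuous_tensorLegendre (ν : ℕ →₀ ℕ) : Continuous (tensorLegendre ν) := by
  unfold tensorLegendre Finsupp.prod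
  fun_prop

lemma tensorLegendre_cubeUpdate (ν : ℕ →₀ ℕ) (y : Cube) (w : ν.support → Set.Icc (-1 : ℝ) 1) :
    tensorLegendre ν (cubeUpdate ν.support y w) = ∏ k : ν.support, legendre (ν k) (w k) := by
  rw [tensorLegendre, Finsupp.prod, ← Finset.prod_coe_sort]
  refine Finset.prod_congr rfl fun k _ => ?_
  have := k.2
  simp [cubeUpdate, -Finsupp.mem_support_iff]

lemma cubeToComplex_cubeUpdate (S : Finset ℕ) (y : Cube) (w : S → Set.Icc (-1 : ℝ) 1) :
    cubeToComplex (cubeUpdate S y w) =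
      updateOn (cubeToComplex y) S fun k => (((w k : Set.Icc (-1 : ℝ) 1) : ℝ) : ℂ) := by
  funext k
  by_cases h : k ∈ S <;> simp [cubeToComplex, cubeUpdate, updateOn, h]

section

variable {W : Type*} [NormedAddCommGroup W] [NormedSpace ℂ W] [CompleteSpace W]

/-- Every variable is moved to its own ellipse by `integral_pi_exchange`, and `G` is bounded by `1`
there. The factor `(2π)⁻¹` in each kernel bound cancels the length of the interval of angles. -/
lemma norm_integral_pi_legendre_le {S : Finset ℕ} {D : S → Set ℂ} (hD : ∀ k, IsOpen (D k))
    {R : S → ℝ} (hR : ∀ k, 1 < R k)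
    (hJ : ∀ k, ∀ w : ℂ, 1 ≤ ‖w‖ → ‖w‖ ≤ R k → joukowski w ∈ D k) (n : S → ℕ)
    {G : (S → ℂ) → W} (hG : DifferentiableOn ℂ G (Set.univ.pi D))
    (hG1 : ∀ z ∈ Set.univ.pi D, ‖G z‖ ≤ 1) :
    ‖∫ w, ((∏ k, legendre (n k + 1) (w k) : ℝ) : ℂ) • G (fun k => ((w k : ℝ) : ℂ))
      ∂(Measure.pi fun _ : S => uniformInterval)‖ ≤
        ∏ k, (4 * (R k)⁻¹ ^ (n k + 1) / (1 - (R k)⁻¹) ^ 2) := by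
  set s := S.card
  set e : Fin s ≃ S := S.equivFin.symm with he
  have hmp := measurePreserving_piCongrLeft (fun _ : S => uniformInterval) e
  rw [← hmp.integral_comp']
  have hpc : ∀ (x : Fin s → Set.Icc (-1 : ℝ) 1) (k : S),
      (MeasurableEquiv.piCongrLeft (fun _ : S => Set.Icc (-1 : ℝ) 1) e) x k = x (e.symm k) := by
    intro x k
    rw [MeasurableEquiv.coe_piCongrLeft, Equiv.piCongrLeft_apply, eq_rec_constant]
  simp_rw [hpc]
  have hprod : ∀ x : Fin s → Set.Icc (-1 : ℝ) 1,
      ((∏ k, legendre (n k + 1) (x (e.symm k)) : ℝ) : ℂ) =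
        ∏ i, ((legendre (n (e i) + 1) (x i) : ℝ) : ℂ) := by
    intro x
    rw [Complex.ofReal_prod, ← e.prod_comp]
    simp
  simp_rw [hprod]
  have hcJ : ∀ i : Fin s, Continuous fun θ : Angle => joukowski (circleMap 0 (R (e i)) θ) :=
    fun i => (continuous_joukowski_circleMap (hR (e i))).comp continuous_subtype_val
  have hJD : ∀ (i : Fin s) (θ : Angle), joukowski (circleMap 0 (R (e i)) θ) ∈ D (e i) := by
    intro i θ
    have h1 := hR (e i)
    have hn : ‖circleMap 0 (R (e i)) (θ : ℝ)‖ = R (e i) := by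
      rw [norm_circleMap_zero, abs_of_pos (by linarith)]
    exact hJ _ _ (by linarith) hn.le
  have hreal : ∀ k : S, ∀ x : Set.Icc (-1 : ℝ) 1, (((x : ℝ) : ℂ)) ∈ D k := by
    intro k x
    rw [← Real.cos_arccos x.2.1 x.2.2, ← joukowski_exp]
    apply hJ <;> simp [Complex.norm_exp_ofReal_mul_I, (hR k).le]
  have key := integral_pi_exchange (W := W) uniformInterval angleMeasure s (fun i => D (e i))
    (fun x : Set.Icc (-1 : ℝ) 1 => ((x : ℝ) : ℂ)) (by fun_prop) (fun i => hreal (e i))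
    (fun i θ => joukowski (circleMap 0 (R (e i)) θ)) hcJ hJD
    (fun i x => ((legendre (n (e i) + 1) x : ℝ) : ℂ)) (fun i => by fun_prop)
    (fun i θ => legendreKernel (n (e i)) (R (e i)) θ)
    (fun i => (continuous_legendreKernel _ (hR _)).comp continuous_subtype_val)
    (fun i g hg => integral_legendre_smul_eq (hD _) (hR _) (hJ _) hg _)
    (fun z => G fun k => z (e.symm k)) (by
      refine hG.comp (t := Set.univ.pi D) (f := fun z : Fin s → ℂ => fun k => z (e.symm k))
        (by fun_prop) fun z hz k _ => ?_
      simpa using hz (e.symm k) trivial)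
  rw [key]
  have hb : ∀ y : Fin s → Angle, ‖(∏ i, legendreKernel (n (e i)) (R (e i)) (y i)) •
      G (fun k => joukowski (circleMap 0 (R (e (e.symm k))) (y (e.symm k))))‖ ≤
      ∏ i, ((2 * Real.pi)⁻¹ * (4 * (R (e i))⁻¹ ^ (n (e i) + 1) / (1 - (R (e i))⁻¹) ^ 2)) := by
    intro y
    rw [norm_smul, norm_prod]
    refine (mul_le_of_le_one_right (Finset.prod_nonneg fun _ _ => norm_nonneg _)
      (hG1 _ fun k _ => ?_)).trans (Finset.prod_le_prod (fun _ _ => norm_nonneg _)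
        fun i _ => norm_legendreKernel_le _ (hR _) _)
    have := hJD (e.symm k) (y (e.symm k))
    simpa using this
  refine (norm_integral_le_of_norm_le_const (ae_of_all _ hb)).trans (le_of_eq ?_)
  rw [measureReal_def, Measure.pi_univ, ENNReal.toReal_prod]
  simp_rw [← measureReal_def, angleMeasure_real_univ]
  rw [← Finset.prod_mul_distrib, ← e.prod_comp]
  refine Finset.prod_congr rfl fun i _ => ?_
  have := Real.pi_pos
  field_simp

/-- The bound for the Legendre coefficients of a function that is holomorphic on a polyellipse. -/
theorem norm_integral_tensorLegendre_smul_le {b ρ : ℕ → ℝ} (hadm : Admissible b ρ)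
    {F : (ℕ → ℂ) → W} (hF : HolomorphicInRegion b F) (hF1 : ∀ z ∈ region b, ‖F z‖ ≤ 1)
    (hFc : Continuous fun y : Cube => F (cubeToComplex y)) (ν : ℕ →₀ ℕ) {R : ℕ → ℝ}
    (hR : ∀ k ∈ ν.support, 1 < R k) (hRρ : ∀ k ∈ ν.support, R k < ρ k) :
    ‖∫ y, (tensorLegendre ν y : ℂ) • F (cubeToComplex y) ∂uniformCube‖ ≤
      ∏ k ∈ ν.support, (4 * (R k)⁻¹ ^ (ν k) / (1 - (R k)⁻¹) ^ 2) := by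
  have hc : Continuous fun y : Cube => (tensorLegendre ν y : ℂ) • F (cubeToComplex y) :=
    (Complex.continuous_ofReal.comp (continuous_tensorLegendre ν)).smul hFc
  rw [integral_cubeUpdate ν.support hc, ← Finset.prod_coe_sort]
  refine (norm_integral_le_of_norm_le_const (μ := uniformCube) (C := ∏ k : ν.support,
    (4 * (R k)⁻¹ ^ (ν k) / (1 - (R k)⁻¹) ^ 2)) (ae_of_all _ fun y => ?_)).trans (by simp)
  simp_rw [tensorLegendre_cubeUpdate, cubeToComplex_cubeUpdate]
  -- Only variables of positive degree are moved, so the kernels, which represent the coefficients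
  -- of index `n + 1`, apply with `n = ν k - 1`.
  have hν : ∀ k : ν.support, ν k = (ν k - 1) + 1 := fun k => by
    have := Finsupp.mem_support_iff.1 k.2
    omega
  have hz : cubeToComplex y ∈ polyellipse ρ := fun k => ofReal_mem_bernsteinEllipse (hadm.1 k) (y k).2
  have key := norm_integral_pi_legendre_le (W := W) (S := ν.support)
    (D := fun k => interior (bernsteinEllipse (ρ k))) (fun k => isOpen_interior)
    (R := fun k => R k) (fun k => hR k k.2) (fun k w h1 h2 => by
      have h3 := hRρ k k.2
      refine joukowski_mem_interior (norm_pos_iff.1 (by linarith)) (by linarith) ?_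
      have : ‖w‖⁻¹ ≤ 1 := inv_le_one_of_one_le₀ h1
      linarith) (fun k => ν k - 1)
    (G := fun w => F (updateOn (cubeToComplex y) ν.support w))
    ((hF ρ hadm _ hz ν.support).mono fun w hw k => hw k trivial)
    (fun w hw => hF1 _ ⟨ρ, hadm, fun k => ?_⟩)
  · simp_rw [← hν] at key
    exact key
  · by_cases h : k ∈ ν.support
    · simpa only [updateOn, h, dite_true] using interior_subset (hw ⟨k, h⟩ trivial)
    · simpa only [updateOn, h, dite_false] using hz k

end

/-! ## Summability of the majorant of the Legendre coefficients -/

/-- The sum over all multi-indices is the expansion of `∏_k (1 + t w_k ∑_{j ≥ 1} g_j)`, and `1 + x ≤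
e^x`. -/
lemma sum_prod_support_le_exp {w g : ℕ → ℝ} (hw : ∀ k, 0 ≤ w k) (hg : ∀ j, 0 ≤ g j)
    (hws : Summable w) (hgs : Summable g) {t : ℝ} (ht : 0 ≤ t) (F : Finset (ℕ →₀ ℕ)) :
    ∑ ν ∈ F, ∏ k ∈ ν.support, (t * (w k * g (ν k))) ≤
      Real.exp (t * ((∑' k, w k) * ∑' j, g j)) := by
  classical
  obtain ⟨n, hn⟩ : ∃ n, ∀ ν ∈ F, (∀ k ∈ ν.support, k < n) ∧ ∀ k, ν k < n + 1 := by
    refine ⟨F.sup (fun ν => ν.support.sup (fun k => k + 1 + ν k)), fun ν hν => ?_⟩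
    have h1 : ∀ k ∈ ν.support, k + 1 + ν k ≤ F.sup (fun ν => ν.support.sup (fun k => k + 1 + ν k)) :=
      fun k hk => (Finset.le_sup (f := fun k => k + 1 + ν k) hk).trans
        (Finset.le_sup (f := fun ν : ℕ →₀ ℕ => ν.support.sup (fun k => k + 1 + ν k)) hν)
    refine ⟨fun k hk => by have := h1 k hk; omega, fun k => ?_⟩
    by_cases hk : k ∈ ν.support
    · have := h1 k hk; omega
    · rw [Finsupp.notMem_support_iff.1 hk]; omega
  -- The value `1` at `j = 0` turns the product over the support into a product over all coordinates
  -- below `n`.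
  set h : ℕ → ℕ → ℝ := fun k j => if j = 0 then 1 else t * (w k * g j) with hh
  have h0 : ∀ k j, 0 ≤ h k j := by
    intro k j
    simp only [hh]
    split_ifs
    · exact zero_le_one
    · exact mul_nonneg ht (mul_nonneg (hw k) (hg j))
  have h1 : ∀ ν ∈ F, ∏ k ∈ ν.support, (t * (w k * g (ν k))) = ∏ i : Fin n, h i (ν i) := by
    intro ν hν
    rw [Fin.prod_univ_eq_prod_range (fun k => h k (ν k)) n]
    rw [← Finset.prod_subset (s₁ := ν.support) (fun k hk => Finset.mem_range.2 ((hn ν hν).1 k hk))]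
    · refine Finset.prod_congr rfl fun k hk => ?_
      simp only [hh]
      rw [if_neg (Finsupp.mem_support_iff.1 hk)]
    · intro k _ hk
      simp only [hh]
      rw [if_pos (Finsupp.notMem_support_iff.1 hk)]
  rw [Finset.sum_congr rfl h1]
  have hinj : Set.InjOn (fun (ν : ℕ →₀ ℕ) (i : Fin n) => ν i) F := by
    intro ν hν μ hμ hνμ
    ext k
    by_cases hk : k < n
    · exact congrFun hνμ ⟨k, hk⟩
    · rw [Finsupp.notMem_support_iff.1 fun h => hk ((hn ν hν).1 k h),
        Finsupp.notMem_support_iff.1 fun h => hk ((hn μ hμ).1 k h)]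
  calc ∑ ν ∈ F, ∏ i : Fin n, h i (ν i)
      = ∑ x ∈ F.image (fun (ν : ℕ →₀ ℕ) (i : Fin n) => ν i), ∏ i : Fin n, h i (x i) := by
        rw [Finset.sum_image hinj]
    _ ≤ ∑ x ∈ Fintype.piFinset (fun _ : Fin n => Finset.range (n + 1)), ∏ i : Fin n, h i (x i) := by
        refine Finset.sum_le_sum_of_subset_of_nonneg ?_ fun x _ _ =>
          Finset.prod_nonneg fun i _ => h0 _ _
        intro x hx
        obtain ⟨ν, hν, rfl⟩ := Finset.mem_image.1 hx
        exact Fintype.mem_piFinset.2 fun i => Finset.mem_range.2 ((hn ν hν).2 i)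
    _ = ∏ i : Fin n, ∑ j ∈ Finset.range (n + 1), h i j := (Finset.prod_univ_sum _ _).symm
    _ ≤ ∏ i : Fin n, Real.exp (t * (w i * ∑' j, g j)) := by
        refine Finset.prod_le_prod (fun i _ => Finset.sum_nonneg fun j _ => h0 _ _) fun i _ => ?_
        rw [Finset.sum_range_succ']
        simp only [hh, Nat.add_eq_zero_iff, one_ne_zero, and_false, if_false, if_true]
        rw [← Finset.mul_sum, ← Finset.mul_sum, add_comm]
        refine le_trans ?_ (add_comm _ _ |>.trans_le (Real.add_one_le_exp _))
        gcongr
        · exact hw i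
        · have h2 := hgs.sum_le_tsum (Finset.range (n + 1)) fun j _ => hg j
          rw [Finset.sum_range_succ'] at h2
          linarith [hg 0]
    _ = Real.exp (t * ((∑ i : Fin n, w i) * ∑' j, g j)) := by
        rw [← Real.exp_sum, ← Finset.mul_sum, ← Finset.sum_mul]
    _ ≤ _ := by
        gcongr
        · exact tsum_nonneg hg
        · rw [Fin.sum_univ_eq_sum_range]
          exact hws.sum_le_tsum _ fun k _ => hw k

lemma prod_le_exp_sum {ι : Type*} (S : Finset ι) {x : ι → ℝ} (hx : ∀ k ∈ S, 0 ≤ x k) :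
    ∏ k ∈ S, x k ≤ Real.exp (∑ k ∈ S, x k) := by
  rw [Real.exp_sum]
  exact Finset.prod_le_prod hx fun k _ => by linarith [Real.add_one_le_exp (x k)]

/-- Since `p < 1`, the base of the `t`-th power tends to zero and is eventually below `1/2`, however
large `X` is. -/
lemma summable_succ_mul_exp_mul_rpow_pow {p : ℝ} (hp : p < 1) (X : ℝ) :
    Summable fun t : ℕ => ((t : ℝ) + 1) * (Real.exp X * (t : ℝ) ^ (p - 1)) ^ t := by
  have h1 : Filter.Tendsto (fun t : ℕ => Real.exp X * (t : ℝ) ^ (p - 1)) Filter.atTop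
      (nhds 0) := by
    have := ((tendsto_rpow_neg_atTop (sub_pos.2 hp)).comp
      tendsto_natCast_atTop_atTop).const_mul (Real.exp X)
    simpa [Function.comp_def] using this
  have h2 : Summable fun t : ℕ => ((t : ℝ) + 1) * (1 / 2 : ℝ) ^ t := by
    have h3 := summable_pow_mul_geometric_of_norm_lt_one 1 (r := (1 / 2 : ℝ)) (by norm_num)
    have h4 := summable_geometric_of_lt_one (r := (1 / 2 : ℝ)) (by norm_num) (by norm_num)
    refine (h3.add h4).congr fun t => ?_
    ring
  refine Summable.of_norm_bounded_eventually_nat h2 ?_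
  filter_upwards [h1.eventually (gt_mem_nhds (show (0 : ℝ) < 1 / 2 by norm_num))] with t ht
  have h0 : 0 ≤ Real.exp X * (t : ℝ) ^ (p - 1) := by positivity
  rw [Real.norm_of_nonneg (by positivity)]
  gcongr

/-- The majorant of the Legendre coefficients. -/
noncomputable def coeffMajorant (A κ : ℝ) (β : ℕ → ℝ) (ν : ℕ →₀ ℕ) : ℝ :=
  ∏ k ∈ ν.support, (A * ν.support.card * β k * κ⁻¹ ^ (ν k - 1))

section Majorant

variable {A κ p M : ℝ} {β : ℕ → ℝ}

/-- The constant in the bounds for the majorant. -/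
noncomputable def majorantConst (A κ p : ℝ) (β : ℕ → ℝ) : ℝ :=
  ∑' t : ℕ, ((t : ℝ) + 1) * (Real.exp ((∑' k, (A * β k) ^ p) *
    ∑' j : ℕ, ((j : ℝ) + 1) * (κ⁻¹ ^ p) ^ (j - 1)) * (t : ℝ) ^ (p - 1)) ^ t

lemma term_le_majorantConst (hp : p < 1) (t : ℕ) :
    ((t : ℝ) + 1) * (((t : ℝ) ^ (p - 1)) ^ t * Real.exp (t * ((∑' k, (A * β k) ^ p) *
      ∑' j : ℕ, ((j : ℝ) + 1) * (κ⁻¹ ^ p) ^ (j - 1)))) ≤ majorantConst A κ p β := by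
  rw [Real.exp_nat_mul, mul_comm (((t : ℝ) ^ (p - 1)) ^ t), ← mul_pow]
  exact (summable_succ_mul_exp_mul_rpow_pow hp _).le_tsum t fun s _ => by positivity

lemma majorantConst_nonneg : 0 ≤ majorantConst A κ p β := tsum_nonneg fun t => by positivity

lemma summable_succ_mul_pow_pred (hp0 : 0 < p) (hκ : 1 < κ) :
    Summable fun j : ℕ => ((j : ℝ) + 1) * (κ⁻¹ ^ p) ^ (j - 1) := by
  rw [← summable_nat_add_iff 1]
  have h0 : 0 ≤ κ⁻¹ ^ p := by positivity
  have hθ : κ⁻¹ ^ p < 1 := Real.rpow_lt_one (by positivity) (inv_lt_one_of_one_lt₀ hκ) hp0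
  have h3 := summable_pow_mul_geometric_of_norm_lt_one 1 (r := κ⁻¹ ^ p)
    (by rwa [Real.norm_of_nonneg h0])
  have h4 := summable_geometric_of_lt_one h0 hθ
  refine (h3.add (h4.mul_left 2)).congr fun t => ?_
  simp only [Nat.add_sub_cancel]
  push_cast
  ring

lemma rpow_coeffMajorant (hA : 0 ≤ A) (hκ : 1 < κ) (hβ : ∀ k, 0 ≤ β k) (ν : ℕ →₀ ℕ) :
    coeffMajorant A κ β ν ^ p = ((ν.support.card : ℝ) ^ p) ^ ν.support.card *
      ∏ k ∈ ν.support, ((A * β k) ^ p * (κ⁻¹ ^ p) ^ (ν k - 1)) := by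
  rw [coeffMajorant, ← Real.finsetProd_rpow _ _ fun k _ => by have := hβ k; positivity,
    ← Finset.prod_const, ← Finset.prod_mul_distrib]
  refine Finset.prod_congr rfl fun k _ => ?_
  have hk := hβ k
  rw [show A * ν.support.card * β k * κ⁻¹ ^ (ν k - 1) =
      ν.support.card * ((A * β k) * κ⁻¹ ^ (ν k - 1)) by ring,
    Real.mul_rpow (by positivity) (by positivity), Real.mul_rpow (by positivity) (by positivity)]
  congr 2
  rw [← Real.rpow_natCast, ← Real.rpow_natCast, ← Real.rpow_mul (by positivity),
    ← Real.rpow_mul (by positivity), mul_comm]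

/-- The factor `r^r` will be distributed over the `r` factors of the product, where it costs only an
exponential in `r`; the factor `(r^{p-1})^r` decays faster than any exponential. -/
lemma rpow_pow_card (r : ℕ) :
    ((r : ℝ) ^ p) ^ r = ((r : ℝ) ^ (p - 1)) ^ r * (r : ℝ) ^ r := by
  rcases Nat.eq_zero_or_pos r with rfl | hr
  · simp
  · have : (0 : ℝ) < r := by exact_mod_cast hr
    rw [← mul_pow, Real.rpow_sub_one this.ne', div_mul_cancel₀ _ this.ne']

/-- The `p`-th powers of the majorant are summable. -/
theorem sum_coeffMajorant_rpow_le (hA : 0 ≤ A) (hκ : 1 < κ) (hp0 : 0 < p) (hp : p < 1)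
    (hβ : ∀ k, 0 ≤ β k) (hs : Summable fun k => (A * β k) ^ p) (F : Finset (ℕ →₀ ℕ)) :
    ∑ ν ∈ F, coeffMajorant A κ β ν ^ p ≤ majorantConst A κ p β := by
  set w : ℕ → ℝ := fun k => (A * β k) ^ p with hw
  set g : ℕ → ℝ := fun j => ((j : ℝ) + 1) * (κ⁻¹ ^ p) ^ (j - 1) with hg
  have hgs : Summable g := summable_succ_mul_pow_pred hp0 hκ
  have hw0 : ∀ k, 0 ≤ w k := fun k => Real.rpow_nonneg (mul_nonneg hA (hβ k)) _
  have hκ0 : 0 ≤ κ⁻¹ ^ p := by positivity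
  have hg0 : ∀ j, 0 ≤ g j := fun j => by positivity
  obtain ⟨T, hT⟩ : ∃ T, ∀ ν ∈ F, ν.support.card ∈ Finset.range T := by
    refine ⟨F.sup (fun ν => ν.support.card) + 1, fun ν hν => ?_⟩
    have := Finset.le_sup (f := fun ν : ℕ →₀ ℕ => ν.support.card) hν
    exact Finset.mem_range.2 (Nat.lt_succ_of_le this)
  -- The bound uses only the term `t = |supp ν|`. Adding the other values of `t` decouples `t` from
  -- `ν`, so that the sums can be interchanged and, for each `t`, all `ν` can be summed.
  have h1 : ∀ ν ∈ F, coeffMajorant A κ β ν ^ p ≤ ∑ t ∈ Finset.range T,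
      ((t : ℝ) ^ (p - 1)) ^ t * ∏ k ∈ ν.support, ((t : ℝ) * (w k * g (ν k))) := by
    intro ν hν
    have h2 := Finset.single_le_sum (f := fun t : ℕ => ((t : ℝ) ^ (p - 1)) ^ t *
      ∏ k ∈ ν.support, ((t : ℝ) * (w k * g (ν k)))) (fun t _ => mul_nonneg (by positivity)
        (Finset.prod_nonneg fun k _ => mul_nonneg (by positivity) (mul_nonneg (hw0 _) (hg0 _)))) (hT ν hν)
    refine le_trans ?_ h2
    rw [rpow_coeffMajorant hA hκ hβ, rpow_pow_card, ← Finset.pow_card_mul_prod, mul_assoc]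
    gcongr with k hk
    · intro k _
      exact mul_nonneg (hw0 k) (by positivity)
    · exact hw0 k
    · exact le_mul_of_one_le_left (by positivity) (by simp)
  calc ∑ ν ∈ F, coeffMajorant A κ β ν ^ p
      ≤ ∑ ν ∈ F, ∑ t ∈ Finset.range T,
        ((t : ℝ) ^ (p - 1)) ^ t * ∏ k ∈ ν.support, ((t : ℝ) * (w k * g (ν k))) :=
        Finset.sum_le_sum h1
    _ = ∑ t ∈ Finset.range T, ((t : ℝ) ^ (p - 1)) ^ t *
        ∑ ν ∈ F, ∏ k ∈ ν.support, ((t : ℝ) * (w k * g (ν k))) := by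
        rw [Finset.sum_comm]
        exact Finset.sum_congr rfl fun t _ => (Finset.mul_sum _ _ _).symm
    _ ≤ ∑ t ∈ Finset.range T, ((t : ℝ) + 1) * (Real.exp ((∑' k, w k) * ∑' j, g j) *
        (t : ℝ) ^ (p - 1)) ^ t := by
        refine Finset.sum_le_sum fun t _ => ?_
        rw [mul_pow, ← Real.exp_nat_mul, mul_comm (Real.exp _)]
        refine le_trans ?_ (le_mul_of_one_le_left (by positivity) (by simp))
        gcongr
        exact sum_prod_support_le_exp hw0 hg0 hs hgs (by positivity) F
    _ ≤ majorantConst A κ p β :=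
        (summable_succ_mul_exp_mul_rpow_pow hp _).sum_le_tsum _ fun t _ => by positivity

/-- The majorant is small outside of the hyperbolic cross. -/
theorem coeffMajorant_rpow_le_of_notMem (hA : 0 ≤ A) (hκ : 1 < κ) (hp0 : 0 < p) (hp : p < 1)
    (hβ : ∀ k, 0 ≤ β k) (hs : Summable fun k => (A * β k) ^ p)
    (hM : ∀ k : ℕ, (A * β k) ^ p ≤ M / (k + 1)) {n : ℕ} (hn : 1 ≤ n) {ν : ℕ →₀ ℕ}
    (hν : ν ∉ hyperbolicCross n) :
    coeffMajorant A κ β ν ^ p ≤ (1 + M * ∑' j : ℕ, ((j : ℝ) + 1) * (κ⁻¹ ^ p) ^ (j - 1)) *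
      majorantConst A κ p β / n := by
  set w : ℕ → ℝ := fun k => (A * β k) ^ p with hw
  set g : ℕ → ℝ := fun j => ((j : ℝ) + 1) * (κ⁻¹ ^ p) ^ (j - 1) with hg
  set U := majorantConst A κ p β with hU
  have hU0 : 0 ≤ U := majorantConst_nonneg
  have hgs : Summable g := summable_succ_mul_pow_pred hp0 hκ
  have hw0 : ∀ k, 0 ≤ w k := fun k => Real.rpow_nonneg (mul_nonneg hA (hβ k)) _
  have hκ0 : 0 ≤ κ⁻¹ ^ p := by positivity
  have hg0 : ∀ j, 0 ≤ g j := fun j => by positivity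
  have hgle : ∀ j, g j ≤ ∑' j, g j := fun j => hgs.le_tsum j fun i _ => hg0 i
  have hM0 : 0 ≤ M := by
    have := (hw0 0).trans (hM 0)
    simpa using this
  have hn0 : (0 : ℝ) < n := by exact_mod_cast hn
  set r := ν.support.card with hr
  have hexp : ∀ S : Finset ℕ, ∏ k ∈ S, ((r : ℝ) * (w k * g (ν k))) ≤
      Real.exp (r * ((∑' k, w k) * ∑' j, g j)) := by
    intro S
    refine (prod_le_exp_sum S fun k _ => mul_nonneg (by positivity)
      (mul_nonneg (hw0 _) (hg0 _))).trans (Real.exp_le_exp.2 ?_)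
    rw [← Finset.mul_sum]
    gcongr
    calc ∑ k ∈ S, w k * g (ν k) ≤ ∑ k ∈ S, w k * ∑' j, g j := by
          gcongr with k _
          · exact hw0 k
          · exact hgle _
      _ = (∑ k ∈ S, w k) * ∑' j, g j := (Finset.sum_mul _ _ _).symm
      _ ≤ _ := by
          gcongr
          exact hs.sum_le_tsum _ fun k _ => hw0 k
  have hterm := term_le_majorantConst (A := A) (κ := κ) (β := β) hp r
  have hv0 : 0 ≤ ((r : ℝ) ^ (p - 1)) ^ r := by positivity
  rw [rpow_coeffMajorant hA hκ hβ, rpow_pow_card, mul_assoc]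
  rw [le_div_iff₀ hn0]
  -- A multi-index leaves the cross by an active late coordinate or by a large product. In the first
  -- case the factor `1/n` comes from `w k₀`, in the second from the weights `j + 1` in `g`.
  by_cases h1 : (ν.prod fun _ a => a + 1) ≤ n
  · have h2 : ∃ k, n ≤ k + 1 ∧ ν k ≠ 0 := by
      by_contra! h2
      exact hν ⟨h1, h2⟩
    obtain ⟨k₀, hk₀, hνk⟩ := h2
    have hk : k₀ ∈ ν.support := Finsupp.mem_support_iff.2 hνk
    have hr1 : r = (ν.support.erase k₀).card + 1 := (Finset.card_erase_add_one hk).symm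
    have hpr : (r : ℝ) ^ r * ∏ k ∈ ν.support, (w k * (κ⁻¹ ^ p) ^ (ν k - 1)) ≤
        (r * (w k₀ * g (ν k₀))) * ∏ k ∈ ν.support.erase k₀, ((r : ℝ) * (w k * g (ν k))) := by
      rw [Finset.mul_prod_erase ν.support (fun k => (r : ℝ) * (w k * g (ν k))) hk,
        ← Finset.pow_card_mul_prod]
      gcongr with k hk
      · intro k _
        exact mul_nonneg (hw0 k) (by positivity)
      · exact hw0 k
      · exact le_mul_of_one_le_left (by positivity) (by simp)
    have hwk : w k₀ * n ≤ M := by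
      have h3 := hM k₀
      rw [le_div_iff₀ (by positivity)] at h3
      refine le_trans ?_ h3
      have h4 : (n : ℝ) ≤ (k₀ : ℝ) + 1 := by exact_mod_cast hk₀
      exact mul_le_mul_of_nonneg_left h4 (hw0 _)
    have hG0 : 0 ≤ ∑' j, g j := tsum_nonneg hg0
    set E := Real.exp (r * ((∑' k, w k) * ∑' j, g j)) with hE
    have hE0 : 0 ≤ E := (Real.exp_pos _).le
    have hwn := hw0 k₀
    have hgn := hg0 (ν k₀)
    calc _ ≤ ((r : ℝ) ^ (p - 1)) ^ r * ((r * (w k₀ * g (ν k₀))) * E) * n := by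
          refine mul_le_mul_of_nonneg_right (mul_le_mul_of_nonneg_left (hpr.trans ?_) hv0) hn0.le
          gcongr
          exact hexp _
      _ = (w k₀ * n) * g (ν k₀) * (r * (((r : ℝ) ^ (p - 1)) ^ r * E)) := by ring
      -- Separating the coordinate `k₀` leaves one extra factor `r`; the factor `t + 1` in
      -- `majorantConst` was put there to pay for it.
      _ ≤ M * (∑' j, g j) * (((r : ℝ) + 1) * (((r : ℝ) ^ (p - 1)) ^ r * E)) := by
          gcongr
          · exact hgle _
          · linarith
      _ ≤ M * (∑' j, g j) * U := by gcongr
      _ ≤ (1 + M * ∑' j, g j) * U := by nlinarith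
  · have h2 : (n : ℝ) ≤ ∏ k ∈ ν.support, ((ν k : ℝ) + 1) := by
      push Not at h1
      have h3 : n ≤ ν.prod fun _ a => a + 1 := h1.le
      rw [Finsupp.prod] at h3
      exact_mod_cast h3
    have hP0 : 0 ≤ ∏ k ∈ ν.support, (w k * (κ⁻¹ ^ p) ^ (ν k - 1)) :=
      Finset.prod_nonneg fun k _ => mul_nonneg (hw0 k) (by positivity)
    calc _ ≤ ((r : ℝ) ^ (p - 1)) ^ r * ((r : ℝ) ^ r *
          ∏ k ∈ ν.support, (w k * (κ⁻¹ ^ p) ^ (ν k - 1))) * ∏ k ∈ ν.support, ((ν k : ℝ) + 1) := by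
          gcongr
      -- The factors `ν k + 1` combine with the powers of `κ⁻¹` to give exactly `g (ν k)`.
      _ = ((r : ℝ) ^ (p - 1)) ^ r * ∏ k ∈ ν.support, ((r : ℝ) * (w k * g (ν k))) := by
          have h5 : (r : ℝ) ^ r = ∏ k ∈ ν.support, (r : ℝ) := by rw [Finset.prod_const]
          rw [h5, mul_assoc, ← Finset.prod_mul_distrib, ← Finset.prod_mul_distrib]
          congr 1
          refine Finset.prod_congr rfl fun k _ => ?_
          simp only [hg]
          ring
      _ ≤ ((r : ℝ) ^ (p - 1)) ^ r * Real.exp (r * ((∑' k, w k) * ∑' j, g j)) := by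
          gcongr
          exact hexp _
      _ ≤ ((r : ℝ) + 1) * (((r : ℝ) ^ (p - 1)) ^ r * Real.exp (r * ((∑' k, w k) * ∑' j, g j))) :=
          le_mul_of_one_le_left (by positivity) (by simp)
      _ ≤ U := hterm
      _ ≤ (1 + M * ∑' j, g j) * U := by
          have hG0 : 0 ≤ ∑' j, g j := tsum_nonneg hg0
          have : 0 ≤ M * ∑' j, g j := by positivity
          nlinarith

end Majorant

/-! ## The Legendre coefficients of functions in `H(b)` -/

/-- The weights `(ρ + ρ⁻¹)/2 - 1 = (ρ - 1)² / (2ρ)` are nonnegative. Hence radii built from one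
majorant `β` serve every `b ≤ β` at once. -/
lemma Admissible.mono {b β ρ : ℕ → ℝ} (hb : ∀ k, b k ≤ β k) (h : Admissible β ρ) :
    Admissible b ρ := by
  refine ⟨h.1, (ENNReal.tsum_le_tsum fun k => ENNReal.ofReal_le_ofReal ?_).trans h.2⟩
  refine mul_le_mul_of_nonneg_left (hb k) ?_
  have h1 : 0 < ρ k := by linarith [h.1 k]
  have h2 : 0 ≤ (ρ k - 1) ^ 2 / (2 * ρ k) := by positivity
  have h3 : (ρ k + (ρ k)⁻¹) / 2 - 1 = (ρ k - 1) ^ 2 / (2 * ρ k) := by field_simp; ring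
  rwa [h3]

/-- The Legendre coefficients of a vector-valued function. -/
noncomputable def legendreCoeff {V : Type*} [NormedAddCommGroup V] [NormedSpace ℝ V] (ν : ℕ →₀ ℕ)
    (f : Cube → V) : V :=
  ∫ y, tensorLegendre ν y • f y ∂uniformCube

/-- The smallest parameter of the ellipses in use. -/
noncomputable def minRadius (β : ℕ → ℝ) : ℝ := 1 + (2 * (1 + ∑' k, β k))⁻¹

lemma one_lt_minRadius {β : ℕ → ℝ} (hβ : ∀ k, 0 ≤ β k) : 1 < minRadius β := by
  have : 0 ≤ ∑' k, β k := tsum_nonneg hβ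
  have : 0 < (2 * (1 + ∑' k, β k))⁻¹ := by positivity
  unfold minRadius
  linarith

/-- The parameters of the polyellipse that is used for the coefficient number `ν`. -/
noncomputable def innerRadius (β : ℕ → ℝ) (ν : ℕ →₀ ℕ) (k : ℕ) : ℝ :=
  minRadius β + (2 * ν.support.card * β k)⁻¹

/-- The parameters of an admissible polyellipse around that given by `innerRadius`. -/
noncomputable def outerRadius (β : ℕ → ℝ) (ν : ℕ →₀ ℕ) (k : ℕ) : ℝ :=
  if k ∈ ν.support then 1 + 2 * (innerRadius β ν k - 1) else 1

lemma minRadius_le_innerRadius {β : ℕ → ℝ} (hβ : ∀ k, 0 < β k) (ν : ℕ →₀ ℕ) (k : ℕ) :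
    minRadius β ≤ innerRadius β ν k := by
  have := hβ k
  have : 0 ≤ (2 * ν.support.card * β k)⁻¹ := by positivity
  unfold innerRadius
  linarith

/-- Each of the two terms in `innerRadius` uses at most half of the budget: `(κ - 1) ∑ β_k ≤ 1/2` by
the choice of `minRadius`, and the `r` terms `(2r)⁻¹` add up to at most `1/2`. The distance to `1`
may be doubled in passing to the outer radius because `(ρ + ρ⁻¹)/2 - 1 ≤ (ρ - 1)/2`. Outside the
support `ρ = 1` costs nothing. -/
lemma admissible_outerRadius {β : ℕ → ℝ} (hβ : ∀ k, 0 < β k) (hs : Summable β) (ν : ℕ →₀ ℕ) :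
    Admissible β (outerRadius β ν) := by
  have h1 : ∀ k, 1 < innerRadius β ν k := fun k =>
    (one_lt_minRadius fun k => (hβ k).le).trans_le (minRadius_le_innerRadius hβ ν k)
  refine ⟨fun k => ?_, ?_⟩
  · unfold outerRadius
    split_ifs
    · linarith [h1 k]
    · exact le_rfl
  rw [tsum_eq_sum (s := ν.support) fun k hk => by simp [outerRadius, hk, -Finsupp.mem_support_iff]]
  have h2 : ∀ k ∈ ν.support,
      ((outerRadius β ν k + (outerRadius β ν k)⁻¹) / 2 - 1) * β k ≤
        (minRadius β - 1) * β k + (2 * ν.support.card : ℝ)⁻¹ := by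
    intro k hk
    have h3 : outerRadius β ν k = 1 + 2 * (innerRadius β ν k - 1) := if_pos hk
    have h4 : (outerRadius β ν k)⁻¹ ≤ 1 := inv_le_one_of_one_le₀ (by linarith [h1 k])
    have h5 : (outerRadius β ν k + (outerRadius β ν k)⁻¹) / 2 - 1 ≤ innerRadius β ν k - 1 := by
      linarith
    refine (mul_le_mul_of_nonneg_right h5 (hβ k).le).trans (le_of_eq ?_)
    have hr : (ν.support.card : ℝ) ≠ 0 := by
      exact_mod_cast (Finset.card_pos.2 ⟨k, hk⟩).ne'
    have := (hβ k).ne'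
    unfold innerRadius
    field_simp
    ring
  refine (Finset.sum_le_sum fun k hk => ENNReal.ofReal_le_ofReal (h2 k hk)).trans ?_
  have hm := one_lt_minRadius fun k => (hβ k).le
  rw [← ENNReal.ofReal_sum_of_nonneg fun k _ => by
    have := hβ k
    have : 0 ≤ (minRadius β - 1) * β k := mul_nonneg (by linarith) this.le
    positivity]
  rw [ENNReal.ofReal_le_one, Finset.sum_add_distrib, ← Finset.mul_sum, Finset.sum_const, nsmul_eq_mul]
  have hS : ∑ k ∈ ν.support, β k ≤ ∑' k, β k := hs.sum_le_tsum _ fun k _ => (hβ k).le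
  have hB : 0 ≤ ∑' k, β k := tsum_nonneg fun k => (hβ k).le
  have h6 : (minRadius β - 1) * ∑ k ∈ ν.support, β k ≤ 1 / 2 := by
    refine (mul_le_mul_of_nonneg_left hS (by linarith)).trans ?_
    unfold minRadius
    rw [add_sub_cancel_left, inv_mul_eq_div, div_le_div_iff₀ (by positivity) (by norm_num)]
    linarith
  have h7 : (ν.support.card : ℝ) * (2 * ν.support.card : ℝ)⁻¹ ≤ 1 / 2 := by
    rcases Nat.eq_zero_or_pos ν.support.card with h | h
    · rw [h]; norm_num
    · have : (ν.support.card : ℝ) ≠ 0 := by exact_mod_cast h.ne'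
      field_simp
      exact le_rfl
  linarith

/-- One factor `R_k⁻¹` is bounded by `2 r β_k`, the other `ν_k - 1` factors by `κ⁻¹`. The `8` is `4`
from the kernel times this `2`. -/
lemma prod_radius_le_coeffMajorant {β : ℕ → ℝ} (hβ : ∀ k, 0 < β k) (ν : ℕ →₀ ℕ) :
    ∏ k ∈ ν.support, (4 * (innerRadius β ν k)⁻¹ ^ (ν k) / (1 - (innerRadius β ν k)⁻¹) ^ 2) ≤
      coeffMajorant (8 / (1 - (minRadius β)⁻¹) ^ 2) (minRadius β) β ν := by
  have hm := one_lt_minRadius fun k => (hβ k).le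
  have hm1 := inv_lt_one_of_one_lt₀ hm
  unfold coeffMajorant
  have hle := minRadius_le_innerRadius hβ ν
  have hpos : ∀ k, 0 < innerRadius β ν k := fun k => by linarith [hle k]
  refine Finset.prod_le_prod (fun k _ => ?_) fun k hk => ?_
  · have := hpos k
    positivity
  have hk0 := hpos k
  have hβk := hβ k
  have hr : (0 : ℝ) < ν.support.card := by exact_mod_cast Finset.card_pos.2 ⟨k, hk⟩
  have h1 : (innerRadius β ν k)⁻¹ ≤ (minRadius β)⁻¹ := inv_anti₀ (by linarith) (hle k)
  have h2 : (innerRadius β ν k)⁻¹ ≤ 2 * ν.support.card * β k := by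
    rw [← inv_inv (2 * ν.support.card * β k)]
    refine inv_anti₀ (by positivity) ?_
    unfold innerRadius
    linarith
  have h3 : (innerRadius β ν k)⁻¹ ^ (ν k) ≤
      (2 * ν.support.card * β k) * (minRadius β)⁻¹ ^ (ν k - 1) := by
    have h4 : ν k = (ν k - 1) + 1 := by
      have := Finsupp.mem_support_iff.1 hk
      omega
    conv_lhs => rw [h4, pow_succ']
    gcongr
  have h0 : 0 < 1 - (minRadius β)⁻¹ := by linarith
  calc 4 * (innerRadius β ν k)⁻¹ ^ (ν k) / (1 - (innerRadius β ν k)⁻¹) ^ 2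
      ≤ 4 * ((2 * ν.support.card * β k) * (minRadius β)⁻¹ ^ (ν k - 1)) /
        (1 - (minRadius β)⁻¹) ^ 2 := by gcongr
    _ = _ := by ring

section

variable {V W : Type*} [NormedAddCommGroup V] [NormedSpace ℝ V] [CompleteSpace V]
  [NormedAddCommGroup W] [NormedSpace ℂ W] [CompleteSpace W]

/-- The Legendre coefficients of functions in `H(b)` are bounded by the majorant. -/
theorem norm_legendreCoeff_le {emb : V →ₗᵢ[ℝ] W} {b β : ℕ → ℝ} (hβ : ∀ k, 0 < β k)
    (hs : Summable β) (hb : ∀ k, b k ≤ β k) {f : Cube → V} (hf : IsHolomorphicUnit emb b f)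
    (ν : ℕ →₀ ℕ) :
    ‖legendreCoeff ν f‖ ≤ coeffMajorant (8 / (1 - (minRadius β)⁻¹) ^ 2) (minRadius β) β ν := by
  obtain ⟨hc, F, hFf, hF, hF1⟩ := hf
  have hm := one_lt_minRadius fun k => (hβ k).le
  have hR : ∀ k, 1 < innerRadius β ν k := fun k => hm.trans_le (minRadius_le_innerRadius hβ ν k)
  refine le_trans ?_ (prod_radius_le_coeffMajorant hβ ν)
  have hFc : Continuous fun y : Cube => F (cubeToComplex y) := by
    simp_rw [hFf]
    exact emb.continuous.comp hc
  have key := norm_integral_tensorLegendre_smul_le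
    ((admissible_outerRadius hβ hs ν).mono hb) hF hF1 hFc ν (fun k _ => hR k) (fun k hk => by
      have := hR k
      unfold outerRadius
      rw [if_pos hk]
      linarith)
  refine le_trans (le_of_eq ?_) key
  -- The isometry `emb` commutes with the Bochner integral, so the coefficient may be estimated in
  -- the complex space, where the extension lives.
  rw [← emb.norm_map, legendreCoeff]
  have hint : Integrable (fun y => tensorLegendre ν y • f y) uniformCube :=
    ((continuous_tensorLegendre ν).smul hc).integrable_of_hasCompactSupport
      (HasCompactSupport.of_compactSpace _)
  rw [← LinearIsometry.coe_toContinuousLinearMap, ← ContinuousLinearMap.integral_comp_comm _ hint]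
  congr 2
  funext y
  rw [map_smul, hFf, LinearIsometry.coe_toContinuousLinearMap, Complex.coe_smul]

end

/-! ## Orthonormality and completeness of the tensor product Legendre polynomials -/

lemma tensorLegendre_eq_prod {ν : ℕ →₀ ℕ} {S : Finset ℕ} (h : ν.support ⊆ S) (y : Cube) :
    tensorLegendre ν y = ∏ k ∈ S, legendre (ν k) (y k) :=
  Finset.prod_subset h fun k _ hk => by simp [Finsupp.notMem_support_iff.1 hk]

lemma integral_tensorLegendre_mul (ν μ : ℕ →₀ ℕ) :
    ∫ y, tensorLegendre ν y * tensorLegendre μ y ∂uniformCube = if ν = μ then 1 else 0 := by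
  classical
  set S := ν.support ∪ μ.support
  have h1 : ∀ y : Cube, tensorLegendre ν y * tensorLegendre μ y =
      ∏ k : S, (legendre (ν k) (S.restrict y k) * legendre (μ k) (S.restrict y k)) := by
    intro y
    rw [tensorLegendre_eq_prod (S := S) Finset.subset_union_left,
      tensorLegendre_eq_prod (S := S) Finset.subset_union_right, ← Finset.prod_mul_distrib,
      ← Finset.prod_coe_sort]
    rfl
  simp_rw [h1]
  refine (integral_restrict_infinitePi (μ := fun _ : ℕ => uniformInterval) (s := S)
    (f := fun x : S → Set.Icc (-1 : ℝ) 1 => ∏ k : S, (legendre (ν k) (x k) * legendre (μ k) (x k)))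
    (Continuous.aestronglyMeasurable (by fun_prop))).trans ?_
  rw [integral_fintype_prod_eq_prod
    (f := fun (k : S) (x : Set.Icc (-1 : ℝ) 1) => legendre (ν k) x * legendre (μ k) x)]
  simp_rw [integral_legendre_mul_legendre]
  split_ifs with h
  · simp [h]
  · obtain ⟨k, hk⟩ := Finsupp.ne_iff.1 h
    have hkS : k ∈ S := by
      by_contra hkS
      rw [Finset.mem_union, not_or, Finsupp.notMem_support_iff, Finsupp.notMem_support_iff] at hkS
      exact hk (hkS.1.trans hkS.2.symm)
    exact Finset.prod_eq_zero (Finset.mem_univ (⟨k, hkS⟩ : S)) (if_neg hk)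

section Completeness

variable {V : Type*} [NormedAddCommGroup V] [NormedSpace ℝ V]

lemma integrable_smul_of_continuous {u : Cube → V} (hu : Integrable u uniformCube) {φ : Cube → ℝ}
    (hφ : Continuous φ) : Integrable (fun y => φ y • u y) uniformCube := by
  obtain ⟨C, hC⟩ := (isCompact_range hφ).isBounded.exists_norm_le
  exact hu.bdd_smul C hφ.aestronglyMeasurable (ae_of_all _ fun y => hC _ ⟨y, rfl⟩)

/-- Induction on the number `m` of variables in which the polynomial is arbitrary. For `m = 0` the
product is a tensor Legendre polynomial; in the step the integral is linear in the factor `q m`, and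
the Legendre polynomials span. -/
lemma integral_prod_eval_smul_eq_zero {u : Cube → V} (hu : Integrable u uniformCube)
    (h0 : ∀ ν, legendreCoeff ν u = 0) (n m : ℕ) (q : ℕ → ℝ[X])
    (hq : ∀ k, m ≤ k → q k ∈ Set.range legendrePoly) :
    ∫ y, (∏ k ∈ Finset.range n, (q k).eval (y k : ℝ)) • u y ∂uniformCube = 0 := by
  induction m generalizing q with
  | zero =>
    choose a ha using fun k => hq k (Nat.zero_le k)
    set ν : ℕ →₀ ℕ := Finsupp.indicator (Finset.range n) fun k _ => a k with hν
    have hsub : ν.support ⊆ Finset.range n := Finsupp.support_indicator_subset _ _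
    rw [← h0 ν, legendreCoeff]
    congr 1
    funext y
    rw [tensorLegendre_eq_prod hsub]
    congr 1
    refine Finset.prod_congr rfl fun k hk => ?_
    rw [hν, Finsupp.indicator_of_mem hk, legendre_eq_eval, ha]
  | succ m ih =>
    by_cases hm : m ∈ Finset.range n
    swap
    · have h1 : ∀ y : Cube, ∏ k ∈ Finset.range n, (q k).eval (y k : ℝ) =
          ∏ k ∈ Finset.range n, ((if k < m then q k else legendrePoly 0).eval (y k : ℝ)) := by
        intro y
        refine Finset.prod_congr rfl fun k hk => ?_
        rw [Finset.mem_range] at hm hk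
        rw [if_pos (by omega)]
      simp_rw [h1]
      refine ih (fun k => if k < m then q k else legendrePoly 0) fun k hk => ?_
      simp only [not_lt.2 hk, if_false]
      exact ⟨0, rfl⟩
    have hcont : ∀ p : ℝ[X], Continuous fun y : Cube => p.eval (y m : ℝ) *
        ∏ k ∈ (Finset.range n).erase m, (q k).eval (y k : ℝ) := by
      intro p
      exact (p.continuous.comp (by fun_prop)).mul
        (continuous_finsetProd _ fun k _ => (q k).continuous.comp (by fun_prop))
    have hall : ∀ p ∈ Submodule.span ℝ (Set.range legendrePoly),
        ∫ y : Cube, (p.eval (y m : ℝ) * ∏ k ∈ (Finset.range n).erase m, (q k).eval (y k : ℝ)) • u y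
          ∂uniformCube = 0 := by
      intro p hp
      induction hp using Submodule.span_induction with
      | mem p hp =>
        have := ih (Function.update q m p) fun k hk => by
          rcases eq_or_ne k m with rfl | hkm
          · simpa using hp
          · rw [Function.update_of_ne hkm]
            exact hq k (by omega)
        rw [← this]
        congr 1
        funext y
        rw [← Finset.mul_prod_erase (Finset.range n)
          (fun k => (Function.update q m p k).eval (y k : ℝ)) hm, Function.update_self]
        congr 2
        refine Finset.prod_congr rfl fun k hk => ?_
        rw [Function.update_of_ne (Finset.ne_of_mem_erase hk)]
      | zero => simp
      | add p₁ p₂ _ _ h1 h2 =>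
        simp_rw [eval_add, add_mul, add_smul]
        rw [integral_add (integrable_smul_of_continuous hu (hcont p₁))
          (integrable_smul_of_continuous hu (hcont p₂)), h1, h2, add_zero]
      | smul c p _ h1 =>
        simp_rw [eval_smul, smul_eq_mul, mul_assoc, mul_smul c]
        rw [integral_smul, h1, smul_zero]
    have := hall (q m) (by rw [span_range_legendrePoly]; trivial)
    have h2 : ∀ y : Cube, (q m).eval (y m : ℝ) * ∏ k ∈ (Finset.range n).erase m,
        (q k).eval (y k : ℝ) = ∏ k ∈ Finset.range n, (q k).eval (y k : ℝ) := fun y =>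
      Finset.mul_prod_erase (Finset.range n) (fun k => (q k).eval (y k : ℝ)) hm
    simpa only [h2] using this

/-- A coordinate of the cube as a continuous function. -/
def cubeCoord (k : ℕ) : C(Cube, ℝ) := ⟨fun y => (y k : ℝ), by fun_prop⟩

lemma mem_closure_range_cubeCoord {φ : C(Cube, ℝ)}
    (hφ : φ ∈ Submonoid.closure (Set.range cubeCoord)) :
    ∃ (n : ℕ) (a : ℕ → ℕ), ∀ y : Cube, φ y = ∏ k ∈ Finset.range n, (y k : ℝ) ^ a k := by
  suffices h : ∃ (n : ℕ) (a : ℕ → ℕ), (∀ k, n ≤ k → a k = 0) ∧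
      ∀ y : Cube, φ y = ∏ k ∈ Finset.range n, (y k : ℝ) ^ a k by
    obtain ⟨n, a, -, h⟩ := h
    exact ⟨n, a, h⟩
  induction hφ using Submonoid.closure_induction with
  | mem φ hφ =>
    obtain ⟨k, rfl⟩ := hφ
    refine ⟨k + 1, fun j => if j = k then 1 else 0, fun j hj => if_neg (by omega), fun y => ?_⟩
    rw [Finset.prod_eq_single k]
    · simp [cubeCoord]
    · intro j _ hj
      simp [hj]
    · intro h
      exact absurd (Finset.self_mem_range_succ k) h
  | one => exact ⟨0, 0, by simp, by simp⟩
  | mul φ₁ φ₂ _ _ h1 h2 =>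
    obtain ⟨n₁, a₁, h1, h1'⟩ := h1
    obtain ⟨n₂, a₂, h2, h2'⟩ := h2
    have hext : ∀ (n : ℕ) (a : ℕ → ℕ), (∀ k, n ≤ k → a k = 0) → ∀ N, n ≤ N → ∀ y : Cube,
        ∏ k ∈ Finset.range n, (y k : ℝ) ^ a k = ∏ k ∈ Finset.range N, (y k : ℝ) ^ a k := by
      intro n a ha N hN y
      refine Finset.prod_subset (Finset.range_subset_range.2 hN) fun k _ hk => ?_
      rw [ha k (by simpa using hk), pow_zero]
    refine ⟨max n₁ n₂, a₁ + a₂, fun k hk => ?_, fun y => ?_⟩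
    · rw [Pi.add_apply, h1 k ((le_max_left _ _).trans hk), h2 k ((le_max_right _ _).trans hk)]
    · rw [ContinuousMap.mul_apply, h1', h2', hext n₁ a₁ h1 _ (le_max_left n₁ n₂),
        hext n₂ a₂ h2 _ (le_max_right n₁ n₂), ← Finset.prod_mul_distrib]
      exact Finset.prod_congr rfl fun k _ => (pow_add _ _ _).symm

/-- Stone–Weierstrass: the coordinates separate the points of the compact cube, the integral
vanishes on monomials, and it is continuous in `φ` for the uniform norm. -/
lemma integral_continuous_smul_eq_zero {u : Cube → V} (hu : Integrable u uniformCube)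
    (h0 : ∀ ν, legendreCoeff ν u = 0) (φ : C(Cube, ℝ)) :
    ∫ y, φ y • u y ∂uniformCube = 0 := by
  have halg : ∀ φ ∈ Algebra.adjoin ℝ (Set.range cubeCoord), ∫ y, φ y • u y ∂uniformCube = 0 := by
    intro φ hφ
    rw [← Subalgebra.mem_toSubmodule, Algebra.adjoin_eq_span] at hφ
    induction hφ using Submodule.span_induction with
    | mem φ hφ =>
      obtain ⟨n, a, h⟩ := mem_closure_range_cubeCoord hφ
      have := integral_prod_eval_smul_eq_zero hu h0 n n
        (fun k => if k < n then X ^ a k else legendrePoly 0) (fun k hk => by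
          simp only [not_lt.2 hk, if_false]; exact ⟨0, rfl⟩)
      rw [← this]
      congr 1
      funext y
      rw [h]
      congr 1
      refine Finset.prod_congr rfl fun k hk => ?_
      rw [if_pos (Finset.mem_range.1 hk), eval_pow, eval_X]
    | zero => simp
    | add φ₁ φ₂ _ _ h1 h2 =>
      simp_rw [ContinuousMap.add_apply, add_smul]
      rw [integral_add (integrable_smul_of_continuous hu φ₁.continuous)
        (integrable_smul_of_continuous hu φ₂.continuous), h1, h2, add_zero]
    | smul c φ _ h1 =>
      simp_rw [ContinuousMap.smul_apply, smul_eq_mul, mul_smul c]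
      rw [integral_smul, h1, smul_zero]
  have hsep : (Algebra.adjoin ℝ (Set.range cubeCoord)).SeparatesPoints := by
    intro x y hxy
    obtain ⟨k, hk⟩ := Function.ne_iff.1 hxy
    exact ⟨cubeCoord k, ⟨cubeCoord k, Algebra.subset_adjoin ⟨k, rfl⟩, rfl⟩,
      fun h => hk (Subtype.ext h)⟩
  have hdense := ContinuousMap.subalgebra_topologicalClosure_eq_top_of_separatesPoints _ hsep
  have hφ : φ ∈ closure (Algebra.adjoin ℝ (Set.range cubeCoord) : Set C(Cube, ℝ)) := by
    rw [← Subalgebra.topologicalClosure_coe, hdense]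
    trivial
  have hclosed : IsClosed {φ : C(Cube, ℝ) | ∫ y, φ y • u y ∂uniformCube = 0} := by
    refine isClosed_eq ?_ continuous_const
    refine continuous_iff_continuousAt.2 fun φ₀ => ?_
    rw [ContinuousAt, tendsto_iff_norm_sub_tendsto_zero]
    have hbound : ∀ φ : C(Cube, ℝ), ‖∫ y, φ y • u y ∂uniformCube - ∫ y, φ₀ y • u y ∂uniformCube‖ ≤
        ‖φ - φ₀‖ * ∫ y, ‖u y‖ ∂uniformCube := by
      intro φ
      rw [← integral_sub (integrable_smul_of_continuous hu φ.continuous)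
        (integrable_smul_of_continuous hu φ₀.continuous), ← integral_const_mul]
      refine norm_integral_le_of_norm_le (hu.norm.const_mul _) (ae_of_all _ fun y => ?_)
      rw [← sub_smul, norm_smul]
      exact mul_le_mul_of_nonneg_right ((φ - φ₀).norm_coe_le_norm y) (norm_nonneg _)
    refine squeeze_zero (fun _ => norm_nonneg _) hbound ?_
    have : Filter.Tendsto (fun φ : C(Cube, ℝ) => ‖φ - φ₀‖) (nhds φ₀) (nhds 0) :=
      tendsto_iff_norm_sub_tendsto_zero.1 Filter.tendsto_id
    simpa using this.mul_const (∫ y, ‖u y‖ ∂uniformCube)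
  exact closure_minimal (fun φ hφ => halg φ hφ) hclosed hφ

/-- A function whose Legendre coefficients vanish is zero almost everywhere. -/
theorem ae_eq_zero_of_legendreCoeff_eq_zero [CompleteSpace V] {u : Cube → V}
    (hu : Integrable u uniformCube) (h0 : ∀ ν, legendreCoeff ν u = 0) :
    u =ᵐ[uniformCube] 0 := by
  let _ : MetricSpace Cube := TopologicalSpace.metrizableSpaceMetric Cube
  refine ae_eq_zero_of_forall_setIntegral_isClosed_eq_zero hu fun s hs => ?_
  -- Continuous thickened indicators decrease to the indicator of the closed set `s`, so the
  -- integral of `u` over `s` is a limit of zeros.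
  have hlim : Filter.Tendsto (fun n : ℕ => ∫ y, ((thickenedIndicator
      (Nat.one_div_pos_of_nat (α := ℝ) (n := n)) s y : NNReal) : ℝ) • u y ∂uniformCube)
      Filter.atTop (nhds (∫ y, s.indicator u y ∂uniformCube)) := by
    refine tendsto_integral_of_dominated_convergence (fun y => ‖u y‖) (fun n => ?_) hu.norm
      (fun n => ae_of_all _ fun y => ?_) (ae_of_all _ fun y => ?_)
    · exact (integrable_smul_of_continuous hu (NNReal.continuous_coe.comp
        (thickenedIndicator _ s).continuous)).aestronglyMeasurable
    · rw [norm_smul, Real.norm_of_nonneg (NNReal.coe_nonneg _)]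
      exact mul_le_of_le_one_left (norm_nonneg _) (by
        exact_mod_cast thickenedIndicator_le_one (Nat.one_div_pos_of_nat (α := ℝ) (n := n)) s y)
    · have h1 := thickenedIndicator_tendsto_indicator_closure
        (fun n => Nat.one_div_pos_of_nat (α := ℝ) (n := n))
        tendsto_one_div_add_atTop_nhds_zero_nat s
      rw [hs.closure_eq] at h1
      have h2 := ((NNReal.continuous_coe.tendsto _).comp (tendsto_pi_nhds.1 h1 y)).smul_const (u y)
      have h3 : ((s.indicator (fun _ => (1 : NNReal)) y : NNReal) : ℝ) • u y = s.indicator u y := by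
        by_cases hy : y ∈ s
        · rw [Set.indicator_of_mem hy, Set.indicator_of_mem hy, NNReal.coe_one, one_smul]
        · rw [Set.indicator_of_notMem hy, Set.indicator_of_notMem hy, NNReal.coe_zero, zero_smul]
      rw [← h3]
      exact h2
  have hzero : ∀ n : ℕ, ∫ y, ((thickenedIndicator
      (Nat.one_div_pos_of_nat (α := ℝ) (n := n)) s y : NNReal) : ℝ) • u y ∂uniformCube = 0 :=
    fun n => integral_continuous_smul_eq_zero hu h0 ⟨_, NNReal.continuous_coe.comp
        (thickenedIndicator (Nat.one_div_pos_of_nat (α := ℝ) (n := n)) s).continuous⟩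
  simp_rw [hzero] at hlim
  rw [← integral_indicator hs.measurableSet]
  exact tendsto_nhds_unique hlim tendsto_const_nhds

end Completeness

/-! ## Legendre expansions in the Lebesgue-Bochner space -/

section

variable {V : Type*} [NormedAddCommGroup V] [NormedSpace ℝ V]

lemma memLp_tensorLegendre_smul (ν : ℕ →₀ ℕ) (v : V) :
    MemLp (fun y => tensorLegendre ν y • v) 2 uniformCube := by
  obtain ⟨C, hC⟩ := (isCompact_range (continuous_tensorLegendre ν)).isBounded.exists_norm_le
  have hc : Continuous fun y => tensorLegendre ν y • v :=
    (continuous_tensorLegendre ν).smul continuous_const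
  refine MemLp.of_bound hc.aestronglyMeasurable (C * ‖v‖) (ae_of_all _ fun y => ?_)
  rw [norm_smul]
  exact mul_le_mul_of_nonneg_right (hC _ ⟨y, rfl⟩) (norm_nonneg _)

/-- The function `y ↦ Ψ_ν(y) v` as an element of the Lebesgue-Bochner space. -/
noncomputable def legendreLp (ν : ℕ →₀ ℕ) (v : V) : L2 V := (memLp_tensorLegendre_smul ν v).toLp _

lemma coeFn_legendreLp (ν : ℕ →₀ ℕ) (v : V) :
    legendreLp ν v =ᵐ[uniformCube] fun y => tensorLegendre ν y • v := MemLp.coeFn_toLp _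

lemma integrable_coeFn_L2 {V : Type*} [NormedAddCommGroup V] (f : L2 V) : Integrable f uniformCube :=
  (Lp.memLp f).integrable one_le_two

lemma integrable_tensorLegendre_smul (ν : ℕ →₀ ℕ) (f : L2 V) :
    Integrable (fun y => tensorLegendre ν y • f y) uniformCube :=
  integrable_smul_of_continuous (integrable_coeFn_L2 f) (continuous_tensorLegendre ν)

lemma legendreCoeff_congr {f g : Cube → V} (h : f =ᵐ[uniformCube] g) (ν : ℕ →₀ ℕ) :
    legendreCoeff ν f = legendreCoeff ν g :=
  integral_congr_ae (h.mono fun y hy => by simp only [hy])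

lemma coeFn_finset_sum {ι V : Type*} [NormedAddCommGroup V] (s : Finset ι) (F : ι → L2 V) :
    ⇑(∑ i ∈ s, F i) =ᵐ[uniformCube] fun y => ∑ i ∈ s, F i y := by
  classical
  induction s using Finset.induction_on with
  | empty =>
    simp only [Finset.sum_empty]
    exact Lp.coeFn_zero V 2 uniformCube
  | insert a s ha ih =>
    rw [Finset.sum_insert ha]
    filter_upwards [Lp.coeFn_add (F a) (∑ i ∈ s, F i), ih] with y h1 h2
    rw [h1, Pi.add_apply, h2, Finset.sum_insert ha]

lemma coeFn_sum_legendreLp {N : ℕ} (e : Fin N → ℕ →₀ ℕ) (c : Fin N → V) :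
    ⇑(∑ j, legendreLp (e j) (c j)) =ᵐ[uniformCube] fun y => ∑ j, tensorLegendre (e j) y • c j := by
  have h : ∀ᵐ y ∂uniformCube, ∀ j, legendreLp (e j) (c j) y = tensorLegendre (e j) y • c j :=
    ae_all_iff.2 fun j => coeFn_legendreLp _ _
  filter_upwards [coeFn_finset_sum Finset.univ fun j => legendreLp (e j) (c j), h] with y h1 h2
  rw [h1]
  exact Finset.sum_congr rfl fun j _ => h2 j

end

section

variable {𝕜 V : Type*} [RCLike 𝕜] [NormedAddCommGroup V] [InnerProductSpace 𝕜 V]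
  [NormedSpace ℝ V] [IsScalarTower ℝ 𝕜 V]

lemma real_smul_eq_rclike_smul (t : ℝ) (v : V) : t • v = (t : 𝕜) • v := by
  rw [← RCLike.real_smul_eq_coe_smul]

variable [CompleteSpace V]

lemma inner_legendreLp_left (ν : ℕ →₀ ℕ) (v : V) (f : L2 V) :
    inner 𝕜 (legendreLp ν v) f = inner 𝕜 v (legendreCoeff ν f) := by
  rw [L2.inner_def, legendreCoeff, ← integral_inner (integrable_tensorLegendre_smul ν f)]
  refine integral_congr_ae ((coeFn_legendreLp ν v).mono fun y hy => ?_)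
  simp only [hy]
  rw [real_smul_eq_rclike_smul (𝕜 := 𝕜) _ v, real_smul_eq_rclike_smul (𝕜 := 𝕜) _ (f y),
    inner_smul_left, inner_smul_right, RCLike.conj_ofReal]

lemma legendreCoeff_legendreLp (ν μ : ℕ →₀ ℕ) (v : V) :
    legendreCoeff ν (legendreLp μ v) = if ν = μ then v else 0 := by
  rw [legendreCoeff_congr (coeFn_legendreLp μ v), legendreCoeff]
  simp_rw [smul_smul]
  rw [integral_smul_const, integral_tensorLegendre_mul]
  split_ifs <;> simp

variable (𝕜 V) in
/-- The map `v ↦ Ψ_ν v` as a linear isometry. -/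
noncomputable def legendreIsometry (ν : ℕ →₀ ℕ) : V →ₗᵢ[𝕜] L2 V where
  toFun := legendreLp ν
  map_add' v w := by
    rw [legendreLp, legendreLp, legendreLp, ← MemLp.toLp_add]
    exact MemLp.toLp_congr _ _ (ae_of_all _ fun y => smul_add _ _ _)
  map_smul' a v := by
    rw [legendreLp, legendreLp, RingHom.id_apply, ← MemLp.toLp_const_smul]
    refine MemLp.toLp_congr _ _ (ae_of_all _ fun y => ?_)
    simp only [Pi.smul_apply]
    rw [real_smul_eq_rclike_smul (𝕜 := 𝕜), real_smul_eq_rclike_smul (𝕜 := 𝕜), smul_comm]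
  norm_map' v := by
    have h1 : inner 𝕜 (legendreLp ν v) (legendreLp ν v) = inner 𝕜 v v := by
      rw [inner_legendreLp_left, legendreCoeff_legendreLp, if_pos rfl]
    have h2 : ‖legendreLp ν v‖ ^ 2 = ‖v‖ ^ 2 := by
      rw [← inner_self_eq_norm_sq (𝕜 := 𝕜), h1, inner_self_eq_norm_sq]
    exact (pow_left_inj₀ (norm_nonneg _) (norm_nonneg _) two_ne_zero).1 h2

lemma legendreIsometry_apply (ν : ℕ →₀ ℕ) (v : V) :
    legendreIsometry 𝕜 V ν v = legendreLp ν v := rfl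

lemma orthogonalFamily_legendreIsometry :
    OrthogonalFamily 𝕜 (fun _ : ℕ →₀ ℕ => V) (legendreIsometry 𝕜 V) := by
  intro ν μ hνμ v w
  rw [legendreIsometry_apply, legendreIsometry_apply, inner_legendreLp_left,
    legendreCoeff_legendreLp, if_neg hνμ, inner_zero_right]

/-- A function orthogonal to all the ranges has vanishing Legendre coefficients and is zero by
`ae_eq_zero_of_legendreCoeff_eq_zero`. -/
lemma isHilbertSum_legendreIsometry :
    IsHilbertSum 𝕜 (fun _ : ℕ →₀ ℕ => V) (legendreIsometry 𝕜 V) := by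
  refine IsHilbertSum.mk orthogonalFamily_legendreIsometry (le_of_eq ?_)
  refine (Submodule.topologicalClosure_eq_top_iff.2 ?_).symm
  rw [Submodule.eq_bot_iff]
  intro u hu
  have h0 : ∀ ν, legendreCoeff ν u = 0 := by
    intro ν
    refine ext_inner_left 𝕜 fun v => ?_
    rw [inner_zero_right, ← inner_legendreLp_left]
    exact (Submodule.mem_orthogonal _ _).1 hu _
      (Submodule.mem_iSup_of_mem ν ⟨v, rfl⟩)
  have h1 := ae_eq_zero_of_legendreCoeff_eq_zero (integrable_coeFn_L2 u) h0
  exact (Lp.eq_zero_iff_ae_eq_zero).2 h1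

end

section

/-- The Hilbert sum provides an expansion with abstract coefficients `w ν`; pairing with `legendreLp
ν v` identifies them as integrals. -/
lemma hasSum_legendreLp (𝕜 : Type*) {V : Type*} [RCLike 𝕜] [NormedAddCommGroup V]
    [InnerProductSpace 𝕜 V] [NormedSpace ℝ V] [IsScalarTower ℝ 𝕜 V] [CompleteSpace V]
    (f : L2 V) :
    HasSum (fun ν => legendreLp ν (legendreCoeff ν f)) f := by
  have hH := isHilbertSum_legendreIsometry (𝕜 := 𝕜) (V := V)
  set w := hH.linearIsometryEquiv f with hw
  have hsum := hH.hasSum_linearIsometryEquiv_symm w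
  rw [hw, LinearIsometryEquiv.symm_apply_apply, ← hw] at hsum
  have hcoef : ∀ ν, legendreCoeff ν f = w ν := by
    intro ν
    refine ext_inner_left 𝕜 fun v => ?_
    rw [← inner_legendreLp_left]
    have h1 := (innerSL 𝕜 (legendreLp ν v)).hasSum hsum
    have h2 : ∀ μ, innerSL 𝕜 (legendreLp ν v) (legendreIsometry 𝕜 V μ (w μ)) =
        if μ = ν then inner 𝕜 v (w ν) else 0 := by
      intro μ
      rw [innerSL_apply_apply, legendreIsometry_apply, inner_legendreLp_left, legendreCoeff_legendreLp]
      by_cases h : ν = μ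
      · simp [h]
      · simp [h, Ne.symm h]
    have h3 : HasSum (fun μ => innerSL 𝕜 (legendreLp ν v) (legendreIsometry 𝕜 V μ (w μ)))
        (inner 𝕜 v (w ν)) := by
      simp_rw [h2]
      exact hasSum_ite_eq ν _
    exact h1.unique h3
  simp_rw [hcoef]
  exact hsum

lemma norm_sum_legendreLp_sq (𝕜 : Type*) {V : Type*} [RCLike 𝕜] [NormedAddCommGroup V]
    [InnerProductSpace 𝕜 V] [NormedSpace ℝ V] [IsScalarTower ℝ 𝕜 V] [CompleteSpace V]
    (s : Finset (ℕ →₀ ℕ)) (c : (ℕ →₀ ℕ) → V) :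
    ‖∑ ν ∈ s, legendreLp ν (c ν)‖ ^ 2 = ∑ ν ∈ s, ‖c ν‖ ^ 2 :=
  (orthogonalFamily_legendreIsometry (𝕜 := 𝕜) (V := V)).norm_sum c s

lemma norm_sum_fin_legendreLp_sq (𝕜 : Type*) {V : Type*} [RCLike 𝕜] [NormedAddCommGroup V]
    [InnerProductSpace 𝕜 V] [NormedSpace ℝ V] [IsScalarTower ℝ 𝕜 V] [CompleteSpace V]
    {N : ℕ} {e : Fin N → ℕ →₀ ℕ} (he : Function.Injective e)
    (c : Fin N → V) : ‖∑ j, legendreLp (e j) (c j)‖ ^ 2 = ∑ j, ‖c j‖ ^ 2 :=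
  ((orthogonalFamily_legendreIsometry (𝕜 := 𝕜) (V := V)).comp he).norm_sum c Finset.univ

/-- The error of truncating the Legendre expansion. -/
lemma norm_sub_sum_legendreLp_sq_le (𝕜 : Type*) {V : Type*} [RCLike 𝕜] [NormedAddCommGroup V]
    [InnerProductSpace 𝕜 V] [NormedSpace ℝ V] [IsScalarTower ℝ 𝕜 V] [CompleteSpace V]
    (f : L2 V) (s : Finset (ℕ →₀ ℕ)) {τ : ℝ}
    (hτ : ∀ t : Finset (ℕ →₀ ℕ), (∀ ν ∈ t, ν ∉ s) → ∑ ν ∈ t, ‖legendreCoeff ν f‖ ^ 2 ≤ τ) :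
    ‖f - ∑ ν ∈ s, legendreLp ν (legendreCoeff ν f)‖ ^ 2 ≤ τ := by
  classical
  have h := hasSum_legendreLp 𝕜 f
  have h1 := ((h.sub_const (∑ ν ∈ s, legendreLp ν (legendreCoeff ν f))).norm.pow 2)
  refine le_of_tendsto h1 ?_
  filter_upwards [Filter.eventually_ge_atTop s] with t hst
  rw [← Finset.sum_sdiff hst, add_sub_cancel_right, norm_sum_legendreLp_sq 𝕜]
  exact hτ _ fun ν hν => (Finset.mem_sdiff.1 hν).2

lemma sum_norm_legendreCoeff_sq_le (𝕜 : Type*) {V : Type*} [RCLike 𝕜] [NormedAddCommGroup V]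
    [InnerProductSpace 𝕜 V] [NormedSpace ℝ V] [IsScalarTower ℝ 𝕜 V] [CompleteSpace V]
    (f : L2 V) (s : Finset (ℕ →₀ ℕ)) :
    ∑ ν ∈ s, ‖legendreCoeff ν f‖ ^ 2 ≤ ‖f‖ ^ 2 := by
  classical
  have h1 := ((hasSum_legendreLp 𝕜 f).norm.pow 2)
  refine ge_of_tendsto h1 ?_
  filter_upwards [Filter.eventually_ge_atTop s] with t hst
  rw [norm_sum_legendreLp_sq 𝕜]
  exact Finset.sum_le_sum_of_subset_of_nonneg hst fun _ _ _ => by positivity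

end

/-! ## Compressed sensing: the kernel of a good matrix -/

section Maurey

variable {E α : Type*} [AddCommGroup E] [Module ℝ E] [Fintype α]

/-- A derandomized form of Maurey's empirical method. -/
lemma exists_sum_le_of_convex_combination (B : E →ₗ[ℝ] E →ₗ[ℝ] ℝ) (e : α → E) {w : α → ℝ}
    (hw : ∀ a, 0 ≤ w a) (hw1 : ∑ a, w a = 1) {τ : ℝ} (hτ : ∀ a, B (e a) (e a) ≤ τ) (k : ℕ)
    (y : E) :
    ∃ φ : Fin k → α, B (y + ∑ i, e (φ i)) (y + ∑ i, e (φ i)) ≤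
      B (y + (k : ℝ) • ∑ a, w a • e a) (y + (k : ℝ) • ∑ a, w a • e a) +
        k * (τ - B (∑ a, w a • e a) (∑ a, w a • e a)) := by
  set x := ∑ a, w a • e a with hx
  induction k generalizing y with
  | zero => exact ⟨Fin.elim0, by simp⟩
  | succ k ih =>
    set z := y + (k : ℝ) • x with hz
    have havg : ∑ a, w a * B (z + e a) (z + e a) =
        B z z + B z x + B x z + ∑ a, w a * B (e a) (e a) := by
      have h1 : B z x = ∑ a, w a * B z (e a) := by simp [hx]
      have h2 : B x z = ∑ a, w a * B (e a) z := by simp [hx]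
      have h3 : B z z = ∑ a, w a * B z z := by rw [← Finset.sum_mul, hw1, one_mul]
      rw [h1, h2, h3, ← Finset.sum_add_distrib, ← Finset.sum_add_distrib, ← Finset.sum_add_distrib]
      refine Finset.sum_congr rfl fun a _ => ?_
      simp only [map_add, LinearMap.add_apply]
      ring
    have hle : ∑ a, w a * B (e a) (e a) ≤ τ := by
      calc ∑ a, w a * B (e a) (e a) ≤ ∑ a, w a * τ :=
            Finset.sum_le_sum fun a _ => mul_le_mul_of_nonneg_left (hτ a) (hw a)
        _ = τ := by rw [← Finset.sum_mul, hw1, one_mul]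
    -- The `w`-average of the left-hand side is at most the right-hand side, so some atom does no
    -- worse than the average. It replaces one of the remaining copies of `x`. Positivity of `B`
    -- plays no role, which matters for `gapForm`.
    obtain ⟨a, ha⟩ : ∃ a, B (z + e a) (z + e a) ≤ B z z + B z x + B x z + τ := by
      by_contra! hcon
      have h1 : B z z + B z x + B x z + τ < ∑ a, w a * B (z + e a) (z + e a) := by
        obtain ⟨a₀, -, ha₀⟩ : ∃ a ∈ Finset.univ, 0 < w a := by
          by_contra! h
          have := Finset.sum_nonpos h
          rw [hw1] at this
          linarith
        calc B z z + B z x + B x z + τ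
            = ∑ a, w a * (B z z + B z x + B x z + τ) := by rw [← Finset.sum_mul, hw1, one_mul]
          _ < _ := Finset.sum_lt_sum
            (fun a _ => mul_le_mul_of_nonneg_left (hcon a).le (hw a))
            ⟨a₀, Finset.mem_univ _, mul_lt_mul_of_pos_left (hcon a₀) ha₀⟩
      rw [havg] at h1
      linarith
    obtain ⟨φ, hφ⟩ := ih (y + e a)
    refine ⟨Fin.cons a φ, ?_⟩
    have e1 : y + ∑ i, e ((Fin.cons a φ : Fin (k + 1) → α) i) = y + e a + ∑ i, e (φ i) := by
      rw [Fin.sum_univ_succ]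
      simp [add_assoc]
    have e2 : y + e a + (k : ℝ) • x = z + e a := by rw [hz]; abel
    have e3 : y + ((k + 1 : ℕ) : ℝ) • x = z + x := by
      rw [hz]; push_cast; rw [add_smul, one_smul, add_assoc]
    rw [e2] at hφ
    rw [e1, e3]
    have e4 : B (z + x) (z + x) = B z z + B z x + B x z + B x x := by
      simp only [map_add, LinearMap.add_apply]; ring
    rw [e4]
    push_cast
    linarith

end Maurey

/-- A sum of signed unit vectors. -/
def atomSum {k N : ℕ} (φ : Fin k → Fin N × Bool) : Fin N → ℝ :=
  ∑ i, Pi.single (φ i).1 (if (φ i).2 then 1 else -1)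

/-- The matrices with columns of norm at most `2` that do not shrink sums of `k` signed unit vectors
too much. -/
def GoodMatrix {m N : ℕ} (k : ℕ) (A : Matrix (Fin m) (Fin N) ℝ) : Prop :=
  (∀ φ : Fin k → Fin N × Bool,
    (∑ j, atomSum φ j ^ 2) / 2 ≤ ∑ i, (∑ j, A i j * atomSum φ j) ^ 2) ∧
  ∀ j, ∑ i, A i j ^ 2 ≤ 4

variable {m N : ℕ} {A : Matrix (Fin m) (Fin N) ℝ}

/-- The bilinear form `(x, y) ↦ ⟨A x, A y⟩ - ⟨x, y⟩ / 2`. -/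
noncomputable def gapForm (A : Matrix (Fin m) (Fin N) ℝ) :
    (Fin N → ℝ) →ₗ[ℝ] (Fin N → ℝ) →ₗ[ℝ] ℝ :=
  LinearMap.mk₂ ℝ (fun x y => ∑ i, (∑ j, A i j * x j) * (∑ j, A i j * y j) - (∑ j, x j * y j) / 2)
    (fun x x' y => by
      simp only [Pi.add_apply, mul_add, add_mul, Finset.sum_add_distrib]; ring)
    (fun a x y => by
      have h : ∀ i, ∑ j, A i j * (a • x) j = a * ∑ j, A i j * x j := fun i => by
        rw [Finset.mul_sum]
        exact Finset.sum_congr rfl fun j _ => by simp only [Pi.smul_apply, smul_eq_mul]; ring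
      have h' : ∑ j, (a • x) j * y j = a * ∑ j, x j * y j := by
        rw [Finset.mul_sum]
        exact Finset.sum_congr rfl fun j _ => by simp only [Pi.smul_apply, smul_eq_mul]; ring
      simp only [h, h', mul_assoc, ← Finset.mul_sum, smul_eq_mul]
      ring)
    (fun x y y' => by
      simp only [Pi.add_apply, mul_add, Finset.sum_add_distrib]; ring)
    (fun a x y => by
      have h : ∀ i, ∑ j, A i j * (a • y) j = a * ∑ j, A i j * y j := fun i => by
        rw [Finset.mul_sum]
        exact Finset.sum_congr rfl fun j _ => by simp only [Pi.smul_apply, smul_eq_mul]; ring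
      have h' : ∑ j, x j * (a • y) j = a * ∑ j, x j * y j := by
        rw [Finset.mul_sum]
        exact Finset.sum_congr rfl fun j _ => by simp only [Pi.smul_apply, smul_eq_mul]; ring
      simp only [h, h', mul_left_comm _ a, ← Finset.mul_sum, smul_eq_mul]
      ring)

lemma gapForm_self (A : Matrix (Fin m) (Fin N) ℝ) (x : Fin N → ℝ) :
    gapForm A x x = ∑ i, (∑ j, A i j * x j) ^ 2 - (∑ j, x j ^ 2) / 2 := by
  simp only [gapForm, LinearMap.mk₂_apply, sq]

/-- The vector `x / ‖x‖₁` is a convex combination of signed unit vectors. Maurey's method for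
`gapForm` gives a sum of `k` of them, on which the form is nonnegative; each single atom has value
at most `4` by the column bound. With `q` the value at `x` and `L = ‖x‖₁` this reads `0 ≤ k² q / L²
+ k (4 - q / L²)`. -/
lemma GoodMatrix.sub_le {k : ℕ} (hA : GoodMatrix k A) (x : Fin N → ℝ) :
    ((k : ℝ) - 1) * ((∑ j, x j ^ 2) / 2 - ∑ i, (∑ j, A i j * x j) ^ 2) ≤ 4 * (∑ j, |x j|) ^ 2 := by
  -- For `k = 0` the factor `k - 1` is negative, and the claim follows from an upper bound of `‖A
  -- x‖` by the triangle inequality over the columns.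
  rcases Nat.eq_zero_or_pos k with rfl | hk
  · have h0 := hA.2
    have h1 : ∑ i, (∑ j, A i j * x j) ^ 2 ≤ 4 * (∑ j, |x j|) ^ 2 := by
      have h2 := norm_sum_le (Finset.univ : Finset (Fin N)) fun j =>
        WithLp.toLp 2 (fun i => A i j * x j)
      have h3 : ∀ j, ‖(WithLp.toLp 2 (fun i => A i j * x j) : EuclideanSpace ℝ (Fin m))‖
          ≤ 2 * |x j| := by
        intro j
        refine (sq_le_sq₀ (norm_nonneg _) (by positivity)).1 ?_
        rw [EuclideanSpace.norm_sq_eq]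
        simp only [Real.norm_eq_abs, sq_abs, mul_pow, ← Finset.sum_mul]
        nlinarith [h0 j, sq_nonneg (x j)]
      have h4 := h2.trans (Finset.sum_le_sum fun j _ => h3 j)
      rw [← Finset.mul_sum] at h4
      have h5 := pow_le_pow_left₀ (norm_nonneg _) h4 2
      rw [EuclideanSpace.norm_sq_eq] at h5
      simp only [WithLp.ofLp_sum, Finset.sum_apply, Real.norm_eq_abs, sq_abs] at h5
      nlinarith
    have h2 : 0 ≤ ∑ j, x j ^ 2 := Finset.sum_nonneg fun _ _ => sq_nonneg _
    push_cast
    linarith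
  set L := ∑ j, |x j| with hL
  have hL0 : 0 ≤ L := Finset.sum_nonneg fun _ _ => abs_nonneg _
  rcases hL0.eq_or_lt with h0 | hLpos
  · have hx : x = 0 := by
      funext j
      have := (Finset.sum_eq_zero_iff_of_nonneg fun j _ => abs_nonneg (x j)).1 h0.symm j
        (Finset.mem_univ j)
      simpa using this
    rw [hx, ← h0]
    simp
  set e : Fin N → Fin N → ℝ := fun j => Pi.single j (if 0 ≤ x j then 1 else -1) with he
  have hmain := exists_sum_le_of_convex_combination (gapForm A) e (w := fun j => |x j| / L)
    (fun j => by positivity) (by rw [← Finset.sum_div, ← hL, div_self hLpos.ne']) (τ := 4)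
    (fun j => by
      rw [gapForm_self]
      have h1 : ∑ i, (∑ l, A i l * e j l) ^ 2 = ∑ i, A i j ^ 2 := by
        refine Finset.sum_congr rfl fun i _ => ?_
        rw [Finset.sum_eq_single j]
        · simp only [he, Pi.single_eq_same]; split_ifs <;> ring
        · intro l _ hl; simp [he, hl]
        · simp
      have h2 : 0 ≤ ∑ l, e j l ^ 2 := Finset.sum_nonneg fun _ _ => sq_nonneg _
      have := hA.2 j
      linarith) k 0
  obtain ⟨φ, hφ⟩ := hmain
  have hatom : (0 : Fin N → ℝ) + ∑ i, e (φ i) =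
      atomSum fun i => (φ i, decide (0 ≤ x (φ i))) := by
    rw [zero_add, atomSum]
    simp [he]
  have hcomb : ∑ a, (|x a| / L) • e a = L⁻¹ • x := by
    funext j
    rw [Finset.sum_apply, Finset.sum_eq_single j]
    · simp only [he, Pi.smul_apply, Pi.single_eq_same, smul_eq_mul]
      split_ifs with h
      · rw [abs_of_nonneg h]; ring
      · rw [abs_of_neg (not_le.1 h)]; ring
    · intro l _ hl; simp [he, Ne.symm hl]
    · simp
  rw [hatom, hcomb, zero_add] at hφ
  have hpos : 0 ≤ gapForm A (atomSum fun i => (φ i, decide (0 ≤ x (φ i))))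
      (atomSum fun i => (φ i, decide (0 ≤ x (φ i)))) := by
    rw [gapForm_self]
    linarith [hA.1 fun i => (φ i, decide (0 ≤ x (φ i)))]
  have h1 := hpos.trans hφ
  simp only [map_smul, LinearMap.smul_apply, smul_eq_mul] at h1
  rw [← neg_sub (∑ i, (∑ j, A i j * x j) ^ 2) ((∑ j, x j ^ 2) / 2), ← gapForm_self]
  set q := gapForm A x x
  have hk' : (0 : ℝ) < k := by exact_mod_cast hk
  have h2 : (0 : ℝ) ≤ k * ((k - 1) * q + 4 * L ^ 2) := by
    have h3 := mul_nonneg h1 (sq_nonneg L)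
    have h4 : ((k : ℝ) * (L⁻¹ * (k * (L⁻¹ * q))) + k * (4 - L⁻¹ * (L⁻¹ * q))) * L ^ 2 =
        k * ((k - 1) * q + 4 * L ^ 2) := by field_simp; ring
    rwa [h4] at h3
  have h5 := nonneg_of_mul_nonneg_right h2 hk'
  linarith

section VectorValued

open scoped MatrixOrder Matrix.Norms.L2Operator in
lemma exists_eq_conjTranspose_mul_self {G : Matrix (Fin N) (Fin N) ℝ} (hG : G.PosSemidef) :
    ∃ B : Matrix (Fin N) (Fin N) ℝ, G = B.conjTranspose * B :=
  CStarAlgebra.nonneg_iff_eq_star_mul_self.mp hG.nonneg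

lemma norm_sum_real_smul_sq (𝕜 : Type*) {V ι : Type*} [RCLike 𝕜] [NormedAddCommGroup V]
    [InnerProductSpace 𝕜 V] [NormedSpace ℝ V] [IsScalarTower ℝ 𝕜 V] [Fintype ι] (x : ι → ℝ)
    (h : ι → V) :
    ‖∑ j, x j • h j‖ ^ 2 = ∑ j, ∑ l, x j * x l * RCLike.re (inner 𝕜 (h j) (h l)) := by
  rw [← inner_self_eq_norm_sq (𝕜 := 𝕜), sum_inner, map_sum]
  refine Finset.sum_congr rfl fun j _ => ?_
  rw [inner_sum, map_sum]
  refine Finset.sum_congr rfl fun l _ => ?_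
  rw [real_smul_eq_rclike_smul (𝕜 := 𝕜) _ (h j), real_smul_eq_rclike_smul (𝕜 := 𝕜) _ (h l),
    inner_smul_left, inner_smul_right, RCLike.conj_ofReal, ← mul_assoc, ← RCLike.ofReal_mul,
    RCLike.re_ofReal_mul]

/-- The kernel of a good matrix, acting on vectors with entries in a Hilbert space, contains only
vectors whose `ℓ²`-norm is much smaller than the `ℓ¹`-norm. -/
lemma GoodMatrix.sum_norm_sq_le (𝕜 : Type*) {V : Type*} [RCLike 𝕜] [NormedAddCommGroup V]
    [InnerProductSpace 𝕜 V] [NormedSpace ℝ V] [IsScalarTower ℝ 𝕜 V] {k : ℕ} (hA : GoodMatrix k A)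
    {h : Fin N → V} (hh : matrixAct A h = 0) :
    ((k : ℝ) - 1) * ∑ j, ‖h j‖ ^ 2 ≤ 8 * (∑ j, ‖h j‖) ^ 2 := by
  set G : Matrix (Fin N) (Fin N) ℝ := fun j l => RCLike.re (inner 𝕜 (h j) (h l)) with hG
  have hquad : ∀ x : Fin N → ℝ, ‖∑ j, x j • h j‖ ^ 2 = ∑ j, ∑ l, x j * x l * G j l :=
    fun x => norm_sum_real_smul_sq 𝕜 x h
  have hpsd : G.PosSemidef := by
    refine Matrix.PosSemidef.of_dotProduct_mulVec_nonneg ?_ fun x => ?_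
    · ext j l
      rw [Matrix.conjTranspose_apply, star_trivial]
      simp only [hG]
      rw [← inner_conj_symm, RCLike.conj_re]
    · have h1 : star x ⬝ᵥ (G.mulVec x) = ∑ j, ∑ l, x j * x l * G j l := by
        simp only [dotProduct, Matrix.mulVec, star_trivial, Finset.mul_sum]
        exact Finset.sum_congr rfl fun j _ => Finset.sum_congr rfl fun l _ => by ring
      rw [h1, ← hquad]
      positivity
  -- The columns of `B` are real vectors with the same real Gram matrix as the `h j`. The real
  -- inequality is applied to each row of `B` and summed: by `himg` every row lies in the kernel of
  -- `A`, by `hdiag` the `ℓ²`-norms add up correctly, and by Cauchy–Schwarz (`habs`) the `ℓ¹`-norms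
  -- do not grow.
  obtain ⟨B, hB⟩ := exists_eq_conjTranspose_mul_self hpsd
  have hGB : ∀ j l, G j l = ∑ a, B a j * B a l := by
    intro j l
    rw [hB, Matrix.mul_apply]
    simp
  have hdiag : ∀ j, ∑ a, B a j ^ 2 = ‖h j‖ ^ 2 := by
    intro j
    have h1 : G j j = ‖h j‖ ^ 2 := inner_self_eq_norm_sq (𝕜 := 𝕜) (h j)
    rw [← h1, hGB]
    exact Finset.sum_congr rfl fun a _ => by ring
  have himg : ∀ i, ∑ a, (∑ j, A i j * B a j) ^ 2 = 0 := by
    intro i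
    have h1 : ∑ j, A i j • h j = 0 := congrFun hh i
    have h2 := hquad (fun j => A i j)
    rw [h1, norm_zero, zero_pow two_ne_zero] at h2
    rw [h2]
    simp_rw [hGB, Finset.mul_sum, sq, Finset.sum_mul_sum]
    rw [Finset.sum_comm]
    refine Finset.sum_congr rfl fun j _ => ?_
    rw [Finset.sum_comm]
    exact Finset.sum_congr rfl fun l _ => Finset.sum_congr rfl fun a _ => by ring
  have habs : ∑ a, (∑ j, |B a j|) ^ 2 ≤ (∑ j, ‖h j‖) ^ 2 := by
    simp_rw [sq, Finset.sum_mul_sum]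
    rw [Finset.sum_comm]
    refine Finset.sum_le_sum fun j _ => ?_
    rw [Finset.sum_comm]
    refine Finset.sum_le_sum fun l _ => ?_
    have h1 := Finset.sum_mul_sq_le_sq_mul_sq Finset.univ (fun a => |B a j|) fun a => |B a l|
    simp only [sq_abs] at h1
    rw [hdiag, hdiag, ← mul_pow] at h1
    exact abs_le_of_sq_le_sq' h1 (by positivity) |>.2
  have hsum := Finset.sum_le_sum fun a (_ : a ∈ Finset.univ) => hA.sub_le fun j => B a j
  rw [← Finset.mul_sum, ← Finset.mul_sum, Finset.sum_sub_distrib, ← Finset.sum_div,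
    Finset.sum_comm (f := fun a j => B a j ^ 2),
    Finset.sum_comm (f := fun a i => (∑ j, A i j * B a j) ^ 2)] at hsum
  simp_rw [hdiag, himg] at hsum
  simp only [Finset.sum_const_zero, sub_zero] at hsum
  linarith

/-! ## Errors of `ℓ¹`-minimization -/

variable {V : Type*} [NormedAddCommGroup V]

/-- What `z` gains off `S` must be compensated on `S`, so the error is controlled by its part on `S`
and the tail of `c`. -/
lemma sum_norm_sub_le_of_sum_norm_le {c z : Fin N → V} (hz : ∑ j, ‖z j‖ ≤ ∑ j, ‖c j‖)
    (S : Finset (Fin N)) :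
    ∑ j, ‖z j - c j‖ ≤ 2 * ∑ j ∈ S, ‖z j - c j‖ + 2 * ∑ j ∈ Sᶜ, ‖c j‖ := by
  rw [← Finset.sum_add_sum_compl S] at hz ⊢
  rw [← Finset.sum_add_sum_compl S (fun j => ‖c j‖)] at hz
  have h1 : ∑ j ∈ S, ‖c j‖ ≤ ∑ j ∈ S, ‖z j‖ + ∑ j ∈ S, ‖z j - c j‖ := by
    rw [← Finset.sum_add_distrib]
    exact Finset.sum_le_sum fun j _ => by
      exact norm_le_insert (z j) (c j)
  have h2 : ∑ j ∈ Sᶜ, ‖z j - c j‖ ≤ ∑ j ∈ Sᶜ, ‖z j‖ + ∑ j ∈ Sᶜ, ‖c j‖ := by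
    rw [← Finset.sum_add_distrib]
    exact Finset.sum_le_sum fun j _ => norm_sub_le _ _
  linarith

/-- Cauchy–Schwarz on `S` and `hnull` show that `S` carries at most a quarter of the `ℓ¹`-error.
Hence that error is at most `4σ`, and `8 · 4² = 128`. -/
lemma mul_sum_norm_sub_sq_le {c z : Fin N → V} (hz : ∑ j, ‖z j‖ ≤ ∑ j, ‖c j‖) {K : ℝ}
    (hnull : K * ∑ j, ‖z j - c j‖ ^ 2 ≤ 8 * (∑ j, ‖z j - c j‖) ^ 2)
    {S : Finset (Fin N)} (hS : 128 * (S.card : ℝ) ≤ K) :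
    K * ∑ j, ‖z j - c j‖ ^ 2 ≤ 128 * (∑ j ∈ Sᶜ, ‖c j‖) ^ 2 := by
  have h1 := sum_norm_sub_le_of_sum_norm_le hz S
  set σ := ∑ j ∈ Sᶜ, ‖c j‖
  set a := ∑ j, ‖z j - c j‖
  set d := ∑ j ∈ S, ‖z j - c j‖ with hd
  have ha : 0 ≤ a := Finset.sum_nonneg fun _ _ => norm_nonneg _
  have hσ : 0 ≤ σ := Finset.sum_nonneg fun _ _ => norm_nonneg _
  have hd0 : 0 ≤ d := Finset.sum_nonneg fun _ _ => norm_nonneg _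
  have h2 : d ^ 2 ≤ S.card * ∑ j, ‖z j - c j‖ ^ 2 := by
    refine sq_sum_le_card_mul_sum_sq.trans ?_
    refine mul_le_mul_of_nonneg_left ?_ (Nat.cast_nonneg _)
    exact Finset.sum_le_sum_of_subset_of_nonneg (Finset.subset_univ _) fun _ _ _ => sq_nonneg _
  set e := ∑ j, ‖z j - c j‖ ^ 2
  have he : 0 ≤ e := Finset.sum_nonneg fun _ _ => sq_nonneg _
  have h3 : d ≤ a / 4 := by
    refine abs_le_of_sq_le_sq' ?_ (by positivity) |>.2
    have : 128 * d ^ 2 ≤ 8 * a ^ 2 := by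
      calc 128 * d ^ 2 ≤ 128 * (S.card * e) := by linarith
        _ = 128 * (S.card : ℝ) * e := by ring
        _ ≤ K * e := mul_le_mul_of_nonneg_right hS he
        _ ≤ _ := hnull
    nlinarith
  have h4 : a ≤ 4 * σ := by linarith
  nlinarith

/-- The error of `ℓ¹`-minimization for vectors with a bound on the `ℓ^p`-quasinorm. -/
lemma sum_norm_sub_sq_le_rpow {c z : Fin N → V} (hz : ∑ j, ‖z j‖ ≤ ∑ j, ‖c j‖) {K : ℝ}
    (hK : 0 < K) (hnull : K * ∑ j, ‖z j - c j‖ ^ 2 ≤ 8 * (∑ j, ‖z j - c j‖) ^ 2)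
    {p M : ℝ} (hp : 0 < p) (hp1 : p < 1) (hM : 0 < M) (hc : ∑ j, ‖c j‖ ^ p ≤ M) :
    ∑ j, ‖z j - c j‖ ^ 2 ≤ (128 * M) ^ (2 / p) * K ^ (1 - 2 / p) := by
  -- At this threshold the bound on `∑ ‖c j‖ ^ p` allows at most `K / 128` entries above `t`; the
  -- entries below satisfy `‖c j‖ ≤ t^(1-p) ‖c j‖^p`.
  set t : ℝ := (128 * M / K) ^ (1 / p) with ht
  have ht0 : 0 < t := by positivity
  have htp : t ^ p = 128 * M / K := by
    rw [ht, ← Real.rpow_mul (by positivity), one_div_mul_cancel hp.ne', Real.rpow_one]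
  set S := Finset.univ.filter fun j => t < ‖c j‖ with hSdef
  have hS : 128 * (S.card : ℝ) ≤ K := by
    have h1 : (S.card : ℝ) * t ^ p ≤ M := by
      calc (S.card : ℝ) * t ^ p = ∑ j ∈ S, t ^ p := by rw [Finset.sum_const, nsmul_eq_mul]
        _ ≤ ∑ j ∈ S, ‖c j‖ ^ p := Finset.sum_le_sum fun j hj =>
          Real.rpow_le_rpow ht0.le (Finset.mem_filter.1 hj).2.le hp.le
        _ ≤ ∑ j, ‖c j‖ ^ p := Finset.sum_le_sum_of_subset_of_nonneg (Finset.subset_univ _)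
          fun _ _ _ => by positivity
        _ ≤ M := hc
    rw [htp] at h1
    have h2 : (S.card : ℝ) * (128 * M / K) * K ≤ M * K := mul_le_mul_of_nonneg_right h1 hK.le
    have h3 : (S.card : ℝ) * (128 * M / K) * K = M * (128 * S.card) := by field_simp
    rw [h3] at h2
    exact le_of_mul_le_mul_left h2 hM
  have h1 := mul_sum_norm_sub_sq_le hz hnull hS
  have hσ : ∑ j ∈ Sᶜ, ‖c j‖ ≤ t ^ (1 - p) * M := by
    calc ∑ j ∈ Sᶜ, ‖c j‖ ≤ ∑ j ∈ Sᶜ, t ^ (1 - p) * ‖c j‖ ^ p := by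
          refine Finset.sum_le_sum fun j hj => ?_
          have hj' : ‖c j‖ ≤ t := by simpa [hSdef] using hj
          rcases (norm_nonneg (c j)).eq_or_lt with h0 | h0
          · rw [← h0, Real.zero_rpow hp.ne', mul_zero]
          · calc ‖c j‖ = ‖c j‖ ^ (1 - p) * ‖c j‖ ^ p := by
                  rw [← Real.rpow_add h0, sub_add_cancel, Real.rpow_one]
              _ ≤ _ := mul_le_mul_of_nonneg_right
                (Real.rpow_le_rpow h0.le hj' (by linarith)) (by positivity)
      _ = t ^ (1 - p) * ∑ j ∈ Sᶜ, ‖c j‖ ^ p := by rw [Finset.mul_sum]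
      _ ≤ t ^ (1 - p) * ∑ j, ‖c j‖ ^ p := mul_le_mul_of_nonneg_left
          (Finset.sum_le_sum_of_subset_of_nonneg (Finset.subset_univ _)
            fun _ _ _ => by positivity) (by positivity)
      _ ≤ _ := mul_le_mul_of_nonneg_left hc (by positivity)
  have hσ0 : 0 ≤ ∑ j ∈ Sᶜ, ‖c j‖ := Finset.sum_nonneg fun _ _ => norm_nonneg _
  have h2 : K * ∑ j, ‖z j - c j‖ ^ 2 ≤ 128 * (t ^ (1 - p) * M) ^ 2 :=
    h1.trans (mul_le_mul_of_nonneg_left (pow_le_pow_left₀ hσ0 hσ 2) (by norm_num))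
  have h3 : t ^ (1 - p) = (128 * M / K) ^ (1 / p - 1) := by
    rw [ht, ← Real.rpow_mul (by positivity)]
    congr 1
    field_simp
  have h4 : 128 * (t ^ (1 - p) * M) ^ 2 ≤ K * ((128 * M) ^ (2 / p) * K ^ (1 - 2 / p)) := by
    have e1 : (t ^ (1 - p)) ^ 2 = (128 * M) ^ (2 / p) / (128 * M) ^ 2 * K ^ (1 - 2 / p) * K := by
      rw [h3, ← Real.rpow_natCast, ← Real.rpow_mul (by positivity),
        Real.div_rpow (by positivity) hK.le]
      have e2 : (1 / p - 1) * ((2 : ℕ) : ℝ) = 2 / p - 2 := by push_cast; ring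
      have e3 : (1 : ℝ) - 2 / p = -(2 / p - 2) - 1 := by ring
      rw [e2, e3, Real.rpow_sub hK (-(2 / p - 2)) 1, Real.rpow_neg hK.le, Real.rpow_one,
        Real.rpow_sub (x := 128 * M) (by positivity), Real.rpow_two]
      field_simp
    rw [mul_pow, e1]
    have e4 : 128 * ((128 * M) ^ (2 / p) / (128 * M) ^ 2 * K ^ (1 - 2 / p) * K * M ^ 2) =
        (K * ((128 * M) ^ (2 / p) * K ^ (1 - 2 / p))) / 128 := by
      field_simp
    rw [e4]
    have : 0 ≤ K * ((128 * M) ^ (2 / p) * K ^ (1 - 2 / p)) := by positivity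
    linarith
  exact le_of_mul_le_mul_left (h2.trans h4) hK

/-- The trivial error bound. -/
lemma sum_norm_sub_sq_le_of_sum_norm_le {c z : Fin N → V} (hz : ∑ j, ‖z j‖ ≤ ∑ j, ‖c j‖) :
    ∑ j, ‖z j - c j‖ ^ 2 ≤ (2 * ∑ j, ‖c j‖) ^ 2 := by
  have h1 : ∑ j, ‖z j - c j‖ ≤ 2 * ∑ j, ‖c j‖ := by
    calc ∑ j, ‖z j - c j‖ ≤ ∑ j, (‖z j‖ + ‖c j‖) := Finset.sum_le_sum fun j _ => norm_sub_le _ _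
      _ ≤ _ := by rw [Finset.sum_add_distrib]; linarith
  calc ∑ j, ‖z j - c j‖ ^ 2 ≤ (∑ j, ‖z j - c j‖) ^ 2 :=
        Finset.sum_sq_le_sq_sum_of_nonneg fun _ _ => norm_nonneg _
    _ ≤ _ := pow_le_pow_left₀ (Finset.sum_nonneg fun _ _ => norm_nonneg _) h1 2

end VectorValued

/-! ## Gaussian matrices are good with high probability -/

-- The product of `exp (t x²)` and the standard Gaussian density is a multiple of the density with
-- variance `1 / (1 - 2t)`.
open scoped NNReal in
lemma lintegral_exp_mul_sq_gaussianReal {t : ℝ} (ht : t < 1 / 2) :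
    ∫⁻ x, ENNReal.ofReal (Real.exp (t * x ^ 2)) ∂gaussianReal 0 1 =
      ENNReal.ofReal (√(1 - 2 * t))⁻¹ := by
  have h0 : 0 < 1 - 2 * t := by linarith
  set v : ℝ≥0 := ⟨(1 - 2 * t)⁻¹, by positivity⟩ with hv
  have hvc : (v : ℝ) = (1 - 2 * t)⁻¹ := rfl
  have hv0 : v ≠ 0 := by
    intro h
    have : (v : ℝ) = 0 := by rw [h]; rfl
    rw [hvc] at this
    exact (inv_pos.2 h0).ne' this
  rw [gaussianReal_of_var_ne_zero 0 one_ne_zero,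
    lintegral_withDensity_eq_lintegral_mul _ (measurable_gaussianPDF 0 1) (by fun_prop)]
  have h1 : ∀ x, (gaussianPDF 0 1 * fun x => ENNReal.ofReal (Real.exp (t * x ^ 2))) x =
      ENNReal.ofReal (√(1 - 2 * t))⁻¹ * gaussianPDF 0 v x := by
    intro x
    rw [Pi.mul_apply, gaussianPDF, gaussianPDF, ← ENNReal.ofReal_mul (gaussianPDFReal_nonneg _ _ _),
      ← ENNReal.ofReal_mul (by positivity)]
    congr 1
    rw [gaussianPDFReal_def, gaussianPDFReal_def, hvc]
    simp only [NNReal.coe_one, mul_one, sub_zero]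
    rw [Real.sqrt_mul (by positivity) (1 - 2 * t)⁻¹, Real.sqrt_inv, mul_inv, inv_inv, mul_assoc,
      ← Real.exp_add]
    have h2 : √(1 - 2 * t) ≠ 0 := (Real.sqrt_pos.2 h0).ne'
    have h3 : -x ^ 2 / 2 + t * x ^ 2 = -x ^ 2 / (2 * (1 - 2 * t)⁻¹) := by
      field_simp
      ring
    rw [h3]
    field_simp
  simp_rw [h1]
  rw [lintegral_const_mul _ (measurable_gaussianPDF 0 v), lintegral_gaussianPDF_eq_one 0 hv0, mul_one]

instance (d : ℕ) : IsProbabilityMeasure (stdNormal d) := by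
  unfold stdNormal
  infer_instance

lemma map_sum_mul_stdNormal {N : ℕ} (u : Fin N → ℝ) :
    (stdNormal N).map (fun x => ∑ j, u j * x j) =
      gaussianReal 0 (∑ j, u j ^ 2).toNNReal := by
  have hmem : ∀ j, MemLp (fun x : ℝ => u j * x) 2 (gaussianReal 0 1) := fun j =>
    (memLp_id_gaussianReal' 2 (by norm_num)).const_mul (u j)
  have hind : iIndepFun (fun (j : Fin N) (x : Fin N → ℝ) => u j * x j) (stdNormal N) :=
    iIndepFun_pi (μ := fun _ : Fin N => gaussianReal 0 1) (X := fun j x => u j * x)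
      fun j => (by fun_prop)
  have hlaw : ∀ j, HasGaussianLaw (fun x : Fin N → ℝ => u j * x j) (stdNormal N) := by
    intro j
    have h1 : HasGaussianLaw (fun x : Fin N → ℝ => x j) (stdNormal N) := by
      refine ⟨?_⟩
      have := (measurePreserving_eval (fun _ : Fin N => gaussianReal 0 1) j).map_eq
      have h2 : (stdNormal N).map (fun x : Fin N → ℝ => x j) = gaussianReal 0 1 := this
      rw [h2]
      infer_instance
    exact h1.fun_smul (u j)
  have hsum := (hind.hasGaussianLaw_fun_sum hlaw).map_eq_gaussianReal
  rw [hsum]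
  congr 1
  · rw [integral_finsetSum _ fun j _ => (hlaw j).integrable]
    refine Finset.sum_eq_zero fun j _ => ?_
    rw [integral_const_mul]
    have h1 : ∫ x : Fin N → ℝ, x j ∂stdNormal N = ∫ x, x ∂gaussianReal 0 1 :=
      integral_comp_eval (μ := fun _ : Fin N => gaussianReal 0 1) (i := j) (f := fun x => x)
        (by fun_prop)
    rw [h1, integral_id_gaussianReal, mul_zero]
  · congr 1
    have h1 := variance_sum_pi (μ := fun _ : Fin N => gaussianReal 0 1) hmem
    have h2 : (∑ j, fun x : Fin N → ℝ => u j * x j) = fun x => ∑ j, u j * x j := by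
      funext x; simp
    rw [h2] at h1
    refine h1.trans (Finset.sum_congr rfl fun j _ => ?_)
    rw [variance_const_mul, variance_fun_id_gaussianReal]
    simp

lemma lintegral_exp_mul_sq_sum {N : ℕ} (u : Fin N → ℝ) (hu : 0 < ∑ j, u j ^ 2) {t : ℝ}
    (ht : t < 1 / 2) :
    ∫⁻ x, ENNReal.ofReal (Real.exp (t * (∑ j, u j * x j) ^ 2 / ∑ j, u j ^ 2)) ∂stdNormal N =
      ENNReal.ofReal (√(1 - 2 * t))⁻¹ := by
  set v := ∑ j, u j ^ 2 with hv
  have h1 : (gaussianReal 0 1).map (√v * ·) = gaussianReal 0 v.toNNReal := by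
    rw [gaussianReal_map_const_mul]
    congr 1
    · simp
    · ext
      simp [Real.sq_sqrt hu.le, hu.le]
  have h2 : ∫⁻ x, ENNReal.ofReal (Real.exp (t * (∑ j, u j * x j) ^ 2 / v)) ∂stdNormal N =
      ∫⁻ y, ENNReal.ofReal (Real.exp (t * y ^ 2 / v)) ∂gaussianReal 0 v.toNNReal := by
    rw [hv, ← map_sum_mul_stdNormal, ← hv, lintegral_map (by fun_prop) (by fun_prop)]
  rw [h2, ← h1, lintegral_map (by fun_prop) (by fun_prop), ← lintegral_exp_mul_sq_gaussianReal ht]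
  refine lintegral_congr fun x => ?_
  rw [mul_pow, Real.sq_sqrt hu.le]
  congr 3
  field_simp

/-- A Gaussian vector of dimension `m * N` is a family of `m` independent Gaussian vectors. -/
lemma map_uncurry_stdNormal (m N : ℕ) :
    (Measure.pi fun _ : Fin m => stdNormal N).map
      (fun x k => x (finProdFinEquiv.symm k).1 (finProdFinEquiv.symm k).2) = stdNormal (m * N) := by
  refine (Measure.pi_eq fun s hs => ?_).symm
  rw [Measure.map_apply (by fun_prop) (MeasurableSet.univ_pi hs)]
  have h1 : (fun (x : Fin m → Fin N → ℝ) (k : Fin (m * N)) =>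
      x (finProdFinEquiv.symm k).1 (finProdFinEquiv.symm k).2) ⁻¹' Set.univ.pi s =
      Set.univ.pi fun i => Set.univ.pi fun j => s (finProdFinEquiv (i, j)) := by
    ext x
    simp only [Set.mem_preimage, Set.mem_univ_pi]
    constructor
    · intro h i j
      have := h (finProdFinEquiv (i, j))
      rwa [Equiv.symm_apply_apply] at this
    · intro h k
      have := h (finProdFinEquiv.symm k).1 (finProdFinEquiv.symm k).2
      rwa [Prod.mk.eta, Equiv.apply_symm_apply] at this
  rw [h1, Measure.pi_pi]
  simp only [stdNormal, Measure.pi_pi]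
  rw [← Finset.prod_product', Finset.univ_product_univ]
  exact Equiv.prod_comp finProdFinEquiv fun k => gaussianReal 0 1 (s k)

/-- An exponential moment bound for the squared norm of the image of a vector. -/
lemma stdNormal_tail_le {m N : ℕ} (u : Fin N → ℝ) (hu : 0 < ∑ j, u j ^ 2) {t : ℝ}
    (ht : t < 1 / 2) (a : ℝ) :
    stdNormal (m * N) {r | a ≤ t * (∑ i, (∑ j, u j * r (finProdFinEquiv (i, j))) ^ 2) /
      ∑ j, u j ^ 2} ≤ ENNReal.ofReal (Real.exp (-a) * (√(1 - 2 * t))⁻¹ ^ m) := by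
  set v := ∑ j, u j ^ 2
  set Z : (Fin (m * N) → ℝ) → ℝ :=
    fun r => t * (∑ i, (∑ j, u j * r (finProdFinEquiv (i, j))) ^ 2) / v with hZ
  have hZm : Measurable Z := by
    rw [hZ]
    fun_prop
  have hint : ∫⁻ r, ENNReal.ofReal (Real.exp (Z r)) ∂stdNormal (m * N) =
      ENNReal.ofReal ((√(1 - 2 * t))⁻¹ ^ m) := by
    rw [← map_uncurry_stdNormal, lintegral_map (by fun_prop) (by fun_prop)]
    have h1 : ∀ x : Fin m → Fin N → ℝ, ENNReal.ofReal (Real.exp (Z fun k =>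
        x (finProdFinEquiv.symm k).1 (finProdFinEquiv.symm k).2)) =
        ∏ i, ENNReal.ofReal (Real.exp (t * (∑ j, u j * x i j) ^ 2 / v)) := by
      intro x
      rw [← ENNReal.ofReal_prod_of_nonneg fun i _ => (Real.exp_pos _).le, ← Real.exp_sum]
      simp only [hZ, Equiv.symm_apply_apply, Finset.mul_sum, Finset.sum_div]
    simp_rw [h1]
    -- The rows are independent, so the exponential moment is the `m`-th power of that of one row;
    -- Markov's inequality then gives the tail.
    rw [lintegral_prod_eq_prod_lintegral_of_indepFun Finset.univ
      (fun i (x : Fin m → Fin N → ℝ) => ENNReal.ofReal (Real.exp (t * (∑ j, u j * x i j) ^ 2 / v)))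
      (iIndepFun_pi (μ := fun _ : Fin m => stdNormal N)
        (X := fun _ y => ENNReal.ofReal (Real.exp (t * (∑ j, u j * y j) ^ 2 / v)))
        fun _ => Measurable.aemeasurable (by fun_prop)) fun i => by fun_prop]
    have h2 : ∀ i : Fin m, ∫⁻ x : Fin m → Fin N → ℝ,
        ENNReal.ofReal (Real.exp (t * (∑ j, u j * x i j) ^ 2 / v))
          ∂(Measure.pi fun _ : Fin m => stdNormal N) = ENNReal.ofReal (√(1 - 2 * t))⁻¹ := by
      intro i
      rw [← lintegral_exp_mul_sq_sum u hu ht,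
        ← (measurePreserving_eval (fun _ : Fin m => stdNormal N) i).lintegral_comp (by fun_prop)]
    rw [Finset.prod_congr rfl fun i _ => h2 i, Finset.prod_const, Finset.card_univ,
      Fintype.card_fin, ENNReal.ofReal_pow (by positivity)]
  have hmarkov := mul_meas_ge_le_lintegral₀ (μ := stdNormal (m * N))
    (f := fun r => ENNReal.ofReal (Real.exp (Z r))) (by fun_prop) (ENNReal.ofReal (Real.exp a))
  have hset : {r | ENNReal.ofReal (Real.exp a) ≤ ENNReal.ofReal (Real.exp (Z r))} =
      {r | a ≤ Z r} := by
    ext r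
    simp only [Set.mem_ofPred_eq]
    rw [ENNReal.ofReal_le_ofReal_iff (Real.exp_pos _).le, Real.exp_le_exp]
  rw [hset, hint] at hmarkov
  have h3 : stdNormal (m * N) {r | a ≤ Z r} = ENNReal.ofReal (Real.exp (-a)) *
      (ENNReal.ofReal (Real.exp a) * stdNormal (m * N) {r | a ≤ Z r}) := by
    rw [← mul_assoc, ← ENNReal.ofReal_mul (Real.exp_pos _).le, ← Real.exp_add, neg_add_cancel,
      Real.exp_zero, ENNReal.ofReal_one, one_mul]
  rw [h3, ENNReal.ofReal_mul (Real.exp_pos _).le]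
  gcongr

/-- This is the cost per row in the lower tail bound: `1/4 - (log 2)/2 < -9/100`. -/
lemma exp_quarter_mul_inv_sqrt_two_le : Real.exp (1 / 4) * (√2)⁻¹ ≤ Real.exp (-(9 / 100)) := by
  have h1 : (√2)⁻¹ = Real.exp (-(Real.log 2 / 2)) := by
    rw [Real.exp_neg, ← Real.log_sqrt (by norm_num), Real.exp_log (by positivity)]
  rw [h1, ← Real.exp_add, Real.exp_le_exp]
  linarith [Real.log_two_gt_d9]

lemma exp_neg_one_mul_sqrt_two_le : Real.exp (-1) * √2 ≤ Real.exp (-(9 / 100)) := by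
  have h1 : √2 = Real.exp (Real.log 2 / 2) := by
    rw [← Real.log_sqrt (by norm_num), Real.exp_log (by positivity)]
  rw [h1, ← Real.exp_add, Real.exp_le_exp]
  linarith [Real.log_two_lt_d9]

/-- The Gaussian matrix with entries of variance `1 / m`. -/
noncomputable def gaussianMatrix (m N : ℕ) (r : Fin (m * N) → ℝ) : Matrix (Fin m) (Fin N) ℝ :=
  fun i j => (√m)⁻¹ * r (finProdFinEquiv (i, j))

lemma sum_gaussianMatrix_sq (m N : ℕ) (r : Fin (m * N) → ℝ) (u : Fin N → ℝ) :
    ∑ i, (∑ j, gaussianMatrix m N r i j * u j) ^ 2 =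
      (∑ i, (∑ j, u j * r (finProdFinEquiv (i, j))) ^ 2) / m := by
  rw [Finset.sum_div]
  refine Finset.sum_congr rfl fun i _ => ?_
  have h1 : ∑ j, gaussianMatrix m N r i j * u j =
      (√m)⁻¹ * ∑ j, u j * r (finProdFinEquiv (i, j)) := by
    rw [Finset.mul_sum]
    exact Finset.sum_congr rfl fun j _ => by rw [gaussianMatrix]; ring
  rw [h1, mul_pow, inv_pow, Real.sq_sqrt (Nat.cast_nonneg _)]
  ring

lemma stdNormal_shrink_le {m N : ℕ} (hm : 0 < m) (u : Fin N → ℝ) :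
    stdNormal (m * N) {r | ¬ (∑ j, u j ^ 2) / 2 ≤ ∑ i, (∑ j, gaussianMatrix m N r i j * u j) ^ 2}
      ≤ ENNReal.ofReal (Real.exp (-(9 / 100) * m)) := by
  have hm' : (0 : ℝ) < m := Nat.cast_pos.2 hm
  have hv0 : 0 ≤ ∑ j, u j ^ 2 := Finset.sum_nonneg fun _ _ => sq_nonneg _
  rcases hv0.eq_or_lt with h0 | hv
  · have : {r : Fin (m * N) → ℝ | ¬ (∑ j, u j ^ 2) / 2 ≤
        ∑ i, (∑ j, gaussianMatrix m N r i j * u j) ^ 2} = ∅ := by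
      ext r
      simp only [Set.mem_ofPred_eq, Set.mem_empty_iff_false, iff_false, not_not, ← h0, zero_div]
      exact Finset.sum_nonneg fun _ _ => sq_nonneg _
    rw [this, measure_empty]
    exact zero_le
  -- A negative `t` gives a lower tail: after multiplication by `-1/2`, shrinking by more than one
  -- half means exceeding `-m/4`.
  have h1 := stdNormal_tail_le (m := m) u hv (t := -(1 / 2)) (by norm_num) (-(m / 4))
  refine (measure_mono fun r hr => ?_).trans (h1.trans (ENNReal.ofReal_le_ofReal ?_))
  · simp only [Set.mem_ofPred_eq, not_le, sum_gaussianMatrix_sq] at hr ⊢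
    rw [div_lt_iff₀ hm'] at hr
    rw [le_div_iff₀ hv]
    linarith
  · have e1 : (1 - 2 * -(1 / 2 : ℝ)) = 2 := by norm_num
    have e2 : Real.exp (-(-((m : ℝ) / 4))) = Real.exp (1 / 4) ^ m := by
      rw [← Real.exp_nat_mul]; congr 1; ring
    have e3 : Real.exp (-(9 / 100) * m) = Real.exp (-(9 / 100)) ^ m := by
      rw [← Real.exp_nat_mul]; congr 1; ring
    rw [e1, e2, e3, ← mul_pow]
    exact pow_le_pow_left₀ (by positivity) exp_quarter_mul_inv_sqrt_two_le m

lemma stdNormal_column_le {m N : ℕ} (hm : 0 < m) (l : Fin N) :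
    stdNormal (m * N) {r | ¬ ∑ i, gaussianMatrix m N r i l ^ 2 ≤ 4}
      ≤ ENNReal.ofReal (Real.exp (-(9 / 100) * m)) := by
  have hm' : (0 : ℝ) < m := Nat.cast_pos.2 hm
  have hu : ∑ j, (Pi.single l 1 : Fin N → ℝ) j ^ 2 = 1 := by
    rw [Finset.sum_eq_single l]
    · simp
    · intro j _ hj; simp [hj]
    · simp
  have h1 := stdNormal_tail_le (m := m) (Pi.single l 1 : Fin N → ℝ) (by rw [hu]; norm_num)
    (t := 1 / 4) (by norm_num) m
  refine (measure_mono fun r hr => ?_).trans (h1.trans (ENNReal.ofReal_le_ofReal ?_))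
  · have h2 := sum_gaussianMatrix_sq m N r (Pi.single l 1)
    simp only [Pi.single_apply, mul_ite, mul_one, mul_zero, Finset.sum_ite_eq', Finset.mem_univ,
      if_true] at h2
    simp only [Set.mem_ofPred_eq, not_le] at hr ⊢
    rw [h2] at hr
    rw [hu, div_one]
    rw [lt_div_iff₀ hm'] at hr
    simp only [Pi.single_apply]
    linarith
  · have e1 : (√(1 - 2 * (1 / 4 : ℝ)))⁻¹ = √2 := by
      rw [← Real.sqrt_inv]; norm_num
    have e2 : Real.exp (-(m : ℝ)) = Real.exp (-1) ^ m := by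
      rw [← Real.exp_nat_mul]; congr 1; ring
    have e3 : Real.exp (-(9 / 100) * m) = Real.exp (-(9 / 100)) ^ m := by
      rw [← Real.exp_nat_mul]; congr 1; ring
    rw [e1, e2, e3, ← mul_pow]
    exact pow_le_pow_left₀ (by positivity) exp_neg_one_mul_sqrt_two_le m

/-- Being good is a finite list of conditions on fixed vectors, `(2N)^k` sums and `N` columns, so a
union bound suffices and no net is needed. -/
lemma stdNormal_not_goodMatrix_le {m N : ℕ} (hm : 0 < m) (k : ℕ) :
    stdNormal (m * N) {r | ¬ GoodMatrix k (gaussianMatrix m N r)} ≤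
      ENNReal.ofReal (((N * 2 : ℕ) ^ k + N) * Real.exp (-(9 / 100) * m)) := by
  have hsub : {r | ¬ GoodMatrix k (gaussianMatrix m N r)} ⊆
      (⋃ φ : Fin k → Fin N × Bool, {r | ¬ (∑ j, atomSum φ j ^ 2) / 2 ≤
        ∑ i, (∑ j, gaussianMatrix m N r i j * atomSum φ j) ^ 2}) ∪
      ⋃ l : Fin N, {r | ¬ ∑ i, gaussianMatrix m N r i l ^ 2 ≤ 4} := by
    intro r hr
    simp only [Set.mem_ofPred_eq, GoodMatrix, not_and_or, not_forall] at hr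
    rcases hr with ⟨φ, h⟩ | ⟨l, h⟩
    · exact Or.inl (Set.mem_iUnion.2 ⟨φ, h⟩)
    · exact Or.inr (Set.mem_iUnion.2 ⟨l, h⟩)
  refine (measure_mono hsub).trans ((measure_union_le _ _).trans ?_)
  have h1 : stdNormal (m * N) (⋃ φ : Fin k → Fin N × Bool, {r | ¬ (∑ j, atomSum φ j ^ 2) / 2 ≤
        ∑ i, (∑ j, gaussianMatrix m N r i j * atomSum φ j) ^ 2}) ≤
      ((N * 2 : ℕ) ^ k : ℕ) * ENNReal.ofReal (Real.exp (-(9 / 100) * m)) := by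
    refine (measure_iUnion_fintype_le _ _).trans
      ((Finset.sum_le_sum fun φ _ => stdNormal_shrink_le hm _).trans ?_)
    rw [Finset.sum_const, nsmul_eq_mul, Finset.card_univ]
    simp
  have h2 : stdNormal (m * N) (⋃ l : Fin N, {r | ¬ ∑ i, gaussianMatrix m N r i l ^ 2 ≤ 4}) ≤
      N * ENNReal.ofReal (Real.exp (-(9 / 100) * m)) := by
    refine (measure_iUnion_fintype_le _ _).trans
      ((Finset.sum_le_sum fun l _ => stdNormal_column_le hm _).trans ?_)
    rw [Finset.sum_const, nsmul_eq_mul, Finset.card_univ, Fintype.card_fin]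
  refine (add_le_add h1 h2).trans (le_of_eq ?_)
  rw [← add_mul, ENNReal.ofReal_mul (by positivity), ENNReal.ofReal_add (by positivity)
    (Nat.cast_nonneg _), ENNReal.ofReal_pow (Nat.cast_nonneg _), ENNReal.ofReal_natCast,
    ENNReal.ofReal_natCast, Nat.cast_pow]

/-! ## The reconstruction map -/

section

variable {V : Type*} [NormedAddCommGroup V] [NormedSpace ℝ V] {m N : ℕ}

lemma matrixAct_sub (A : Matrix (Fin m) (Fin N) ℝ) (z z' : Fin N → V) :
    matrixAct A (fun j => z j - z' j) = matrixAct A z - matrixAct A z' := by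
  funext i
  simp only [matrixAct, Pi.sub_apply, smul_sub, Finset.sum_sub_distrib]

lemma matrixAct_map {W : Type*} [NormedAddCommGroup W] [NormedSpace ℝ W]
    (A : Matrix (Fin m) (Fin N) ℝ) (P : V →ₗ[ℝ] W) (z : Fin N → V) :
    matrixAct A (fun j => P (z j)) = fun i => P (matrixAct A z i) := by
  funext i
  simp [matrixAct]

lemma continuous_matrixAct (A : Matrix (Fin m) (Fin N) ℝ) :
    Continuous (matrixAct (V := V) A) := by
  unfold matrixAct
  fun_prop

/-- The image of `f` under the sampling operator is the image of its Legendre coefficients under the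
sensing matrix. -/
lemma gaussianSampling_eq_matrixAct (m : ℕ) (r : Fin (randomDim m) → ℝ) (f : L2 V) :
    gaussianSampling m r f =
      matrixAct (sensingMatrix m r) fun j => legendreCoeff (indexAt m j) f := by
  funext i
  simp only [gaussianSampling, matrixAct, legendreCoeff, Finset.sum_smul, mul_smul]
  rw [integral_finsetSum Finset.univ (f := fun j y =>
    sensingMatrix m r i j • tensorLegendre (indexAt m j) y • f y)
    fun j _ => (integrable_tensorLegendre_smul _ f).smul (sensingMatrix m r i j)]
  exact Finset.sum_congr rfl fun j _ => integral_smul _ _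

end

section

/-- A nonexpansive real-linear projection onto a finite-dimensional subspace that contains finitely
many given vectors. -/
lemma exists_projection (𝕜 : Type*) {V : Type*} [RCLike 𝕜] [NormedAddCommGroup V]
    [InnerProductSpace 𝕜 V] [NormedSpace ℝ V] [IsScalarTower ℝ 𝕜 V] {m : ℕ} (v : Fin m → V) :
    ∃ (S : Submodule 𝕜 V) (P : V →ₗ[ℝ] V), FiniteDimensional 𝕜 S ∧ (∀ x, P x ∈ S) ∧
      (∀ x, ‖P x‖ ≤ ‖x‖) ∧ (∀ x, ‖P x‖ = ‖x‖ → P x = x) ∧ ∀ i, P (v i) = v i := by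
  set S := Submodule.span 𝕜 (Set.range v) with hS
  have : FiniteDimensional 𝕜 S := FiniteDimensional.span_of_finite 𝕜 (Set.finite_range v)
  refine ⟨S, S.starProjection.toLinearMap.restrictScalars ℝ, inferInstance,
    fun x => S.starProjection_apply_mem x, fun x => ?_, fun x hx => ?_, fun i => ?_⟩
  · exact S.norm_starProjection_apply_le x
  · have h1 := S.norm_sq_eq_add_norm_sq_starProjection x
    have hx' : ‖S.starProjection x‖ = ‖x‖ := hx
    rw [hx'] at h1
    have h2 : ‖Sᗮ.starProjection x‖ = 0 := by
      have : ‖Sᗮ.starProjection x‖ ^ 2 = 0 := by linarith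
      exact pow_eq_zero_iff two_ne_zero |>.1 this
    have h3 := S.starProjection_add_starProjection_orthogonal x
    rw [norm_eq_zero.1 h2, add_zero] at h3
    exact h3
  · have h1 : v i ∈ S := Submodule.subset_span ⟨i, rfl⟩
    have h2 : S.starProjection (v i) = v i := Submodule.starProjection_eq_self_iff.2 h1
    exact h2

lemma norm_midpoint_sq (𝕜 : Type*) {V : Type*} [RCLike 𝕜] [NormedAddCommGroup V]
    [InnerProductSpace 𝕜 V] [NormedSpace ℝ V] [IsScalarTower ℝ 𝕜 V] (x y : V) :
    ‖(2 : ℝ)⁻¹ • (x + y)‖ ^ 2 = (‖x‖ ^ 2 + ‖y‖ ^ 2) / 2 - ‖x - y‖ ^ 2 / 4 := by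
  have h1 := parallelogram_law_with_norm 𝕜 x y
  rw [norm_smul, mul_pow]
  norm_num
  linarith

/-- Among the minimizers of the `ℓ¹`-problem there is exactly one of smallest `ℓ²`-norm. -/
lemma exists_l1Minimizer (𝕜 : Type*) {V : Type*} [RCLike 𝕜] [NormedAddCommGroup V]
    [InnerProductSpace 𝕜 V] [NormedSpace ℝ V] [IsScalarTower ℝ 𝕜 V] {m N : ℕ}
    (A : Matrix (Fin m) (Fin N) ℝ) {v : Fin m → V}
    (hv : v ∈ Set.range (matrixAct (V := V) A)) :
    ∃ c ∈ l1Minimizers A v, ∀ z ∈ l1Minimizers A v, z ≠ c → ∑ j, ‖c j‖ ^ 2 < ∑ j, ‖z j‖ ^ 2 := by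
  -- Bounded closed sets in `V^N` need not be compact. Projecting the entries onto the
  -- finite-dimensional span of the data preserves the constraint and increases no norm, so both
  -- minimizations may be carried out over compact sets with entries in `S`.
  obtain ⟨S, P, hfin, hPS, hPle, hPeq, hPv⟩ := exists_projection 𝕜 v
  have hPA : ∀ z, matrixAct A z = v → matrixAct A (fun j => P (z j)) = v := by
    intro z hz
    rw [matrixAct_map, hz]
    exact funext hPv
  have hproper : ProperSpace S := FiniteDimensional.proper_rclike 𝕜 S
  obtain ⟨z₀, hz₀⟩ := hv
  -- the competitors with entries in `S`
  set R := ∑ j, ‖z₀ j‖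
  set ι : (Fin N → S) → Fin N → V := fun z j => (z j : V) with hι
  have hιc : Continuous ι := by fun_prop
  set K : Set (Fin N → S) := {z | matrixAct A (ι z) = v ∧ ∑ j, ‖z j‖ ≤ R} with hK
  have hKc : IsCompact K := by
    refine Metric.isCompact_of_isClosed_isBounded ?_ ?_
    · refine IsClosed.inter ?_ ?_
      · exact isClosed_eq ((continuous_matrixAct A).comp hιc) continuous_const
      · exact isClosed_le (show Continuous fun z : Fin N → S => ∑ j, ‖z j‖ by fun_prop)
          continuous_const
    · refine (Metric.isBounded_closedBall (x := (0 : Fin N → S)) (r := R)).subset fun z hz => ?_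
      rw [mem_closedBall_zero_iff]
      refine (pi_norm_le_iff_of_nonneg (Finset.sum_nonneg fun _ _ => norm_nonneg _)).2 fun j => ?_
      exact (Finset.single_le_sum (f := fun j => ‖z j‖) (fun _ _ => norm_nonneg _)
        (Finset.mem_univ j)).trans hz.2
  have hsumP : ∀ z : Fin N → V, ∑ j, ‖P (z j)‖ ≤ ∑ j, ‖z j‖ :=
    fun z => Finset.sum_le_sum fun j _ => hPle _
  set proj : (Fin N → V) → Fin N → S := fun z j => ⟨P (z j), hPS _⟩ with hproj
  have hιproj : ∀ z, ι (proj z) = fun j => P (z j) := fun z => rfl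
  have hKne : K.Nonempty := ⟨proj z₀, by rw [hιproj]; exact hPA z₀ hz₀, hsumP z₀⟩
  obtain ⟨z₁, hz₁K, hz₁⟩ := hKc.exists_isMinOn hKne
    (show Continuous fun z : Fin N → S => ∑ j, ‖z j‖ by fun_prop).continuousOn
  set L := ∑ j, ‖z₁ j‖ with hL
  have hmin : ∀ z, matrixAct A z = v → L ≤ ∑ j, ‖z j‖ := by
    intro z hz
    by_cases h : ∑ j, ‖z j‖ ≤ R
    · have h1 : proj z ∈ K := ⟨by rw [hιproj]; exact hPA z hz, (hsumP z).trans h⟩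
      exact (hz₁ h1).trans (hsumP z)
    · exact hz₁K.2.trans (not_le.1 h).le
  have hmem : ∀ z, z ∈ l1Minimizers A v ↔ matrixAct A z = v ∧ ∑ j, ‖z j‖ ≤ L := by
    intro z
    refine ⟨fun h => ⟨h.1, h.2 (ι z₁) hz₁K.1⟩, fun h => ⟨h.1, fun z' hz' => h.2.trans (hmin z' hz')⟩⟩
  set K' : Set (Fin N → S) := {z | matrixAct A (ι z) = v ∧ ∑ j, ‖z j‖ ≤ L} with hK'
  have hK'c : IsCompact K' := by
    refine hKc.of_isClosed_subset ?_ fun z hz => ⟨hz.1, hz.2.trans hz₁K.2⟩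
    refine IsClosed.inter ?_ ?_
    · exact isClosed_eq ((continuous_matrixAct A).comp hιc) continuous_const
    · exact isClosed_le (show Continuous fun z : Fin N → S => ∑ j, ‖z j‖ by fun_prop)
          continuous_const
  obtain ⟨c, hcK, hc⟩ := hK'c.exists_isMinOn ⟨z₁, hz₁K.1, le_rfl⟩
    (show Continuous fun z : Fin N → S => ∑ j, ‖z j‖ ^ 2 by fun_prop).continuousOn
  have hle : ∀ z ∈ l1Minimizers A v, ∑ j, ‖ι c j‖ ^ 2 ≤ ∑ j, ‖z j‖ ^ 2 := by
    intro z hz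
    have hz' := (hmem z).1 hz
    have h1 : proj z ∈ K' := ⟨by rw [hιproj]; exact hPA z hz'.1, (hsumP z).trans hz'.2⟩
    exact (hc h1).trans (Finset.sum_le_sum fun j _ => pow_le_pow_left₀ (norm_nonneg _) (hPle _) 2)
  refine ⟨ι c, (hmem _).2 hcK, fun z hz hne => lt_of_le_of_ne (hle z hz) fun heq => hne ?_⟩
  have hz' := (hmem z).1 hz
  -- The midpoint of two minimizers is again a minimizer; by the parallelogram law its `ℓ²`-norm
  -- would be strictly smaller if they were different.
  set w : Fin N → V := fun j => (2 : ℝ)⁻¹ • (ι c j + z j) with hw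
  have hwmem : w ∈ l1Minimizers A v := by
    rw [hmem]
    constructor
    · have h1 : matrixAct A w = (2 : ℝ)⁻¹ • (matrixAct A (ι c) + matrixAct A z) := by
        funext i
        simp only [matrixAct, hw, Pi.smul_apply, Pi.add_apply, ← Finset.sum_add_distrib,
          Finset.smul_sum]
        refine Finset.sum_congr rfl fun j _ => ?_
        rw [smul_comm, smul_add]
      rw [h1, hcK.1, hz'.1, ← two_smul ℝ v, smul_smul]
      norm_num
    · calc ∑ j, ‖w j‖ ≤ ∑ j, (2 : ℝ)⁻¹ * (‖ι c j‖ + ‖z j‖) := by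
            refine Finset.sum_le_sum fun j _ => ?_
            rw [hw]
            simp only
            rw [norm_smul]
            norm_num
            exact norm_add_le _ _
        _ = (2 : ℝ)⁻¹ * (∑ j, ‖ι c j‖ + ∑ j, ‖z j‖) := by
            rw [← Finset.mul_sum, Finset.sum_add_distrib]
        _ ≤ L := by
            have h2 : ∑ j, ‖ι c j‖ ≤ L := hcK.2
            linarith [hz'.2]
  have h1 := hle w hwmem
  have h2 : ∑ j, ‖w j‖ ^ 2 = ((∑ j, ‖ι c j‖ ^ 2 + ∑ j, ‖z j‖ ^ 2) / 2) -
      (∑ j, ‖ι c j - z j‖ ^ 2) / 4 := by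
    rw [← Finset.sum_add_distrib, Finset.sum_div, Finset.sum_div, ← Finset.sum_sub_distrib]
    exact Finset.sum_congr rfl fun j _ => norm_midpoint_sq 𝕜 _ _
  have h3 : ∑ j, ‖ι c j - z j‖ ^ 2 ≤ 0 := by
    rw [h2, ← heq] at h1
    linarith
  have h4 := (Finset.sum_eq_zero_iff_of_nonneg fun j _ => sq_nonneg _).1
    (le_antisymm h3 (Finset.sum_nonneg fun _ _ => sq_nonneg _))
  funext j
  have h5 := pow_eq_zero_iff two_ne_zero |>.1 (h4 j (Finset.mem_univ j))
  exact (sub_eq_zero.1 (norm_eq_zero.1 h5)).symm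

lemma exists_isL1Reconstruction (𝕜 : Type*) {V : Type*} [RCLike 𝕜] [NormedAddCommGroup V]
    [InnerProductSpace 𝕜 V] [NormedSpace ℝ V] [IsScalarTower ℝ 𝕜 V]
    (m : ℕ) (r : Fin (randomDim m) → ℝ) :
    ∃ T : (Fin m → V) → L2 V, IsL1Reconstruction m r T := by
  have h : ∀ v : Fin m → V, ∃ u : L2 V,
      (v ∈ Set.range (matrixAct (V := V) (sensingMatrix m r)) →
        ∃ c ∈ l1Minimizers (sensingMatrix m r) v,
          (∀ z ∈ l1Minimizers (sensingMatrix m r) v, z ≠ c → ∑ j, ‖c j‖ ^ 2 < ∑ j, ‖z j‖ ^ 2) ∧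
          u =ᵐ[uniformCube] fun y => ∑ j, tensorLegendre (indexAt m j) y • c j) ∧
      (v ∉ Set.range (matrixAct (V := V) (sensingMatrix m r)) → u = 0) := by
    intro v
    by_cases hv : v ∈ Set.range (matrixAct (V := V) (sensingMatrix m r))
    · obtain ⟨c, hc, hcu⟩ := exists_l1Minimizer 𝕜 _ hv
      exact ⟨_, fun _ => ⟨c, hc, hcu, coeFn_sum_legendreLp _ c⟩, fun h => absurd hv h⟩
    · exact ⟨0, fun h => absurd h hv, fun _ => rfl⟩
  choose T hT using h
  exact ⟨T, hT⟩

/-- The reconstruction, expressed by the minimizer. -/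
lemma IsL1Reconstruction.exists_eq {V : Type*} [NormedAddCommGroup V] [NormedSpace ℝ V] {m : ℕ} {r : Fin (randomDim m) → ℝ} {T : (Fin m → V) → L2 V}
    (hT : IsL1Reconstruction m r T) (f : L2 V) :
    ∃ z : Fin (numIndices m) → V,
      matrixAct (sensingMatrix m r) (fun j => z j - legendreCoeff (indexAt m j) f) = 0 ∧
      ∑ j, ‖z j‖ ≤ ∑ j, ‖legendreCoeff (indexAt m j) f‖ ∧
      T (gaussianSampling m r f) = ∑ j, legendreLp (indexAt m j) (z j) := by
  have h0 := gaussianSampling_eq_matrixAct m r f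
  obtain ⟨z, hz, -, hz'⟩ := (hT (gaussianSampling m r f)).1 ⟨_, h0.symm⟩
  refine ⟨z, ?_, hz.2 _ h0.symm, ?_⟩
  · rw [matrixAct_sub, hz.1, ← h0, sub_self]
  · exact Lp.ext (hz'.trans (coeFn_sum_legendreLp _ z).symm)

end

/-! ## The sampling operator -/

lemma legendreCoeff_add {V : Type*} [NormedAddCommGroup V] [NormedSpace ℝ V]
    (ν : ℕ →₀ ℕ) (f g : L2 V) :
    legendreCoeff ν ⇑(f + g) = legendreCoeff ν f + legendreCoeff ν g := by
  rw [legendreCoeff_congr (Lp.coeFn_add f g), legendreCoeff, legendreCoeff, legendreCoeff,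
    ← integral_add (integrable_tensorLegendre_smul ν f) (integrable_tensorLegendre_smul ν g)]
  simp only [Pi.add_apply, smul_add]

lemma legendreCoeff_smul (𝕜 : Type*) {V : Type*} [RCLike 𝕜] [NormedAddCommGroup V]
    [InnerProductSpace 𝕜 V] [NormedSpace ℝ V] [IsScalarTower ℝ 𝕜 V]
    (ν : ℕ →₀ ℕ) (a : 𝕜) (f : L2 V) :
    legendreCoeff ν ⇑(a • f) = a • legendreCoeff ν f := by
  rw [legendreCoeff_congr (Lp.coeFn_smul a f), legendreCoeff, legendreCoeff, ← integral_smul]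
  refine integral_congr_ae (ae_of_all _ fun y => ?_)
  simp only [Pi.smul_apply]
  rw [real_smul_eq_rclike_smul (𝕜 := 𝕜), real_smul_eq_rclike_smul (𝕜 := 𝕜), smul_comm]

lemma norm_legendreCoeff_le_norm (𝕜 : Type*) {V : Type*} [RCLike 𝕜] [NormedAddCommGroup V]
    [InnerProductSpace 𝕜 V] [CompleteSpace V] [NormedSpace ℝ V] [IsScalarTower ℝ 𝕜 V]
    (ν : ℕ →₀ ℕ) (f : L2 V) : ‖legendreCoeff ν f‖ ≤ ‖f‖ := by
  have h := sum_norm_legendreCoeff_sq_le 𝕜 f {ν}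
  rw [Finset.sum_singleton] at h
  exact (pow_le_pow_iff_left₀ (norm_nonneg _) (norm_nonneg _) two_ne_zero).1 h

lemma isBoundedLinearMap_gaussianSampling (𝕜 : Type*) {V : Type*} [RCLike 𝕜] [NormedAddCommGroup V]
    [InnerProductSpace 𝕜 V] [CompleteSpace V] [NormedSpace ℝ V] [IsScalarTower ℝ 𝕜 V]
    (m : ℕ) (r : Fin (randomDim m) → ℝ) :
    IsBoundedLinearMap 𝕜 (gaussianSampling (V := V) m r) := by
  refine IsLinearMap.with_bound ⟨fun f g => ?_, fun a f => ?_⟩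
    (∑ i, ∑ j, |sensingMatrix m r i j|) fun f => ?_
  · simp only [gaussianSampling_eq_matrixAct, legendreCoeff_add]
    funext i
    simp only [matrixAct, Pi.add_apply, smul_add, Finset.sum_add_distrib]
  · simp only [gaussianSampling_eq_matrixAct, legendreCoeff_smul]
    funext i
    simp only [matrixAct, Pi.smul_apply, Finset.smul_sum]
    refine Finset.sum_congr rfl fun j _ => ?_
    rw [real_smul_eq_rclike_smul (𝕜 := 𝕜), real_smul_eq_rclike_smul (𝕜 := 𝕜), smul_comm]
  · rw [gaussianSampling_eq_matrixAct]
    refine (pi_norm_le_iff_of_nonneg (by positivity)).2 fun i => ?_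
    have h1 : ‖matrixAct (sensingMatrix m r) (fun j => legendreCoeff (indexAt m j) f) i‖ ≤
        ∑ j, |sensingMatrix m r i j| * ‖f‖ := by
      refine (norm_sum_le _ _).trans (Finset.sum_le_sum fun j _ => ?_)
      rw [norm_smul, Real.norm_eq_abs]
      exact mul_le_mul_of_nonneg_left (norm_legendreCoeff_le_norm 𝕜 _ f) (abs_nonneg _)
    refine h1.trans ?_
    rw [← Finset.sum_mul]
    refine mul_le_mul_of_nonneg_right ?_ (norm_nonneg _)
    exact Finset.single_le_sum (f := fun i => ∑ j, |sensingMatrix m r i j|)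
      (fun i _ => Finset.sum_nonneg fun _ _ => abs_nonneg _) (Finset.mem_univ i)

lemma isBoundedLinear_gaussianSampling (𝕜 : Type*) {V : Type*} [RCLike 𝕜] [NormedAddCommGroup V]
    [InnerProductSpace 𝕜 V] [CompleteSpace V] [NormedSpace ℝ V] [IsScalarTower ℝ 𝕜 V]
    {Y : NormedSubspace 𝕜 (L2 V)} (hY : Y.ContinuouslyEmbedded)
    (m : ℕ) (r : Fin (randomDim m) → ℝ) :
    IsBoundedLinear Y (fun f : Y.carrier => gaussianSampling m r (f : L2 V)) := by
  have h := isBoundedLinearMap_gaussianSampling 𝕜 (V := V) m r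
  obtain ⟨C, hC⟩ := hY
  obtain ⟨M, hM, hbound⟩ := h.bound
  refine ⟨⟨fun f g => h.map_add f g, fun a f => h.map_smul a f⟩, M * C, fun f => ?_⟩
  calc ‖gaussianSampling m r (f : L2 V)‖ ≤ M * ‖(f : L2 V)‖ := hbound _
    _ ≤ M * (C * Y.norm f) := mul_le_mul_of_nonneg_left (hC f) hM.le
    _ = M * C * Y.norm f := by ring

/-- A bounded linear operator with values in `Z^m` is adaptive. -/
lemma IsBoundedLinear.isAdaptive {𝕜 E Z : Type*} [RCLike 𝕜] [AddCommGroup E] [Module 𝕜 E]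
    [NormedAddCommGroup Z] [NormedSpace 𝕜 Z] {Y : NormedSubspace 𝕜 E} {m : ℕ}
    {L : Y.carrier → Fin m → Z} (hL : IsBoundedLinear Y L) : IsAdaptive Y L := by
  obtain ⟨h1, C, hC⟩ := hL
  refine ⟨fun i _ f => L f i, fun i _ => ⟨⟨fun f g => ?_, fun a f => ?_⟩, C, fun f => ?_⟩,
    fun f i => rfl⟩
  · simp only [h1.map_add, Pi.add_apply]
  · simp only [h1.map_smul, Pi.smul_apply]
  · exact (norm_le_pi_norm (L f) i).trans (hC f)

/-- A normed space as a normed subspace of itself. -/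
def NormedSubspace.whole (𝕜 E : Type*) [RCLike 𝕜] [NormedAddCommGroup E] [NormedSpace 𝕜 E] :
    NormedSubspace 𝕜 E where
  carrier := ⊤
  norm := (normSeminorm 𝕜 E).comp (Submodule.subtype ⊤)
  eq_zero_of_norm f hf := by
    have h : ‖(f : E)‖ = 0 := hf
    exact Subtype.ext (norm_eq_zero.1 h)

lemma NormedSubspace.continuouslyEmbedded_whole (𝕜 E : Type*) [RCLike 𝕜] [NormedAddCommGroup E]
    [NormedSpace 𝕜 E] : (NormedSubspace.whole 𝕜 E).ContinuouslyEmbedded :=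
  ⟨1, fun f => by rw [one_mul]; exact le_of_eq rfl⟩

/-- The coefficients of `v g` are those of `g` times `v`. Any nonzero vector therefore serves as
both `v` and `w`, with the same random functionals on all of `L²(U)` as the scalar operator. -/
lemma isSamplingOperator_gaussianSampling (𝕜 : Type*) {V : Type*} [RCLike 𝕜] [NormedAddCommGroup V]
    [InnerProductSpace 𝕜 V] [CompleteSpace V] [Nontrivial V] [NormedSpace ℝ V]
    [IsScalarTower ℝ 𝕜 V] {Y : NormedSubspace 𝕜 (L2 V)} (hY : Y.ContinuouslyEmbedded)
    (m : ℕ) (r : Fin (randomDim m) → ℝ) :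
    IsSamplingOperator Y (fun f : Y.carrier => gaussianSampling m r (f : L2 V)) := by
  obtain ⟨v, hv⟩ := exists_ne (0 : V)
  refine ⟨(isBoundedLinear_gaussianSampling 𝕜 hY m r).isAdaptive, v, v, hv, hv,
    NormedSubspace.whole ℝ (L2 ℝ), fun g => gaussianSampling m r (g : L2 ℝ),
    (isBoundedLinear_gaussianSampling ℝ
      (NormedSubspace.continuouslyEmbedded_whole ℝ (L2 ℝ)) m r).isAdaptive, fun g f hgf => ?_⟩
  refine ⟨Submodule.mem_top, fun i => ?_⟩
  have hcoeff : ∀ ν, legendreCoeff ν (f : L2 V) = legendreCoeff ν g • v := by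
    intro ν
    rw [legendreCoeff_congr hgf, legendreCoeff, legendreCoeff, ← integral_smul_const]
    simp only [smul_assoc]
  simp only [gaussianSampling_eq_matrixAct, matrixAct, hcoeff, Finset.sum_smul, smul_assoc]

lemma le_upperExpectation {Ω : Type*} [MeasurableSpace Ω] (μ : Measure Ω) [IsProbabilityMeasure μ]
    {g : Ω → ℝ≥0∞} {a : ℝ≥0∞} (h : ∀ ω, a ≤ g ω) : a ≤ upperExpectation μ g := by
  refine le_iInf fun h' => le_iInf fun _ => le_iInf fun hg => ?_
  calc a = ∫⁻ _, a ∂μ := by simp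
    _ ≤ ∫⁻ ω, h' ω ∂μ := lintegral_mono fun ω => (h ω).trans (hg ω)

/-- Each realization competes in the infimum, so the width is below the worst-case error for every
`r`. -/
lemma adaptiveWidth_le_upperExpectation (𝕜 : Type*) {V : Type*} [RCLike 𝕜] [NormedAddCommGroup V]
    [InnerProductSpace 𝕜 V] [CompleteSpace V] [Nontrivial V] [NormedSpace ℝ V]
    [IsScalarTower ℝ 𝕜 V] {Y : NormedSubspace 𝕜 (L2 V)} (hY : Y.ContinuouslyEmbedded)
    (K : Set (L2 V)) (m : ℕ) (T : (Fin (randomDim m) → ℝ) → (Fin m → V) → L2 V) :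
    adaptiveWidth Y K m ≤ upperExpectation (stdNormal (randomDim m))
      (fun r => worstError m r (T r) K) := by
  refine le_upperExpectation _ fun r => ?_
  refine iInf_le_of_le (fun f : Y.carrier => gaussianSampling m r (f : L2 V))
    (iInf_le_of_le (isSamplingOperator_gaussianSampling 𝕜 hY m r) (iInf_le_of_le (T r) ?_))
  exact iSup_le fun f => iSup_le fun hf =>
    le_iSup₂ (f := fun f (_ : f ∈ K) => ‖f - T r (gaussianSampling m r f)‖ₑ) (f : L2 V) hf

/-! ## The size of the hyperbolic cross -/

/-- A multi-index is encoded by `s` pairs of position and value; spare pairs are `(0, 0)` and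
contribute nothing. -/
lemma exists_sum_single_eq {n : ℕ} (hn : 0 < n) (s : ℕ) (ν : ℕ →₀ ℕ) (hs : ν.support.card ≤ s)
    (hν : ∀ k ∈ ν.support, k < n ∧ ν k < n) :
    ∃ φ : Fin s → Fin n × Fin n, ∑ i, Finsupp.single ((φ i).1 : ℕ) ((φ i).2 : ℕ) = ν := by
  induction s generalizing ν with
  | zero =>
    have h0 : ν = 0 := by
      rw [← Finsupp.support_eq_empty, ← Finset.card_eq_zero]
      omega
    exact ⟨Fin.elim0, by simp [h0]⟩
  | succ s ih =>
    by_cases h : ν.support = ∅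
    · have h0 : ν = 0 := Finsupp.support_eq_empty.1 h
      refine ⟨fun _ => (⟨0, hn⟩, ⟨0, hn⟩), ?_⟩
      simp [h0]
    · obtain ⟨k, hk⟩ := Finset.nonempty_iff_ne_empty.2 h
      have hcard : (ν.erase k).support.card ≤ s := by
        rw [Finsupp.support_erase, Finset.card_erase_of_mem hk]
        omega
      obtain ⟨φ, hφ⟩ := ih (ν.erase k) hcard fun l hl => by
        rw [Finsupp.support_erase, Finset.mem_erase] at hl
        rw [Finsupp.erase_ne hl.1]
        exact hν l hl.2
      refine ⟨Fin.cons (⟨k, (hν k hk).1⟩, ⟨ν k, (hν k hk).2⟩) φ, ?_⟩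
      rw [Fin.sum_univ_succ]
      simp only [Fin.cons_zero, Fin.cons_succ]
      rw [hφ, Finsupp.single_add_erase]

/-- Each nonzero entry contributes a factor of at least `2` to a product bounded by `n`, so there
are at most `log₂ n` of them, with positions and values below `n`. -/
lemma card_hyperbolicCross_le {n : ℕ} (hn : 0 < n) :
    (hyperbolicCross_finite n).toFinset.card ≤ (n * n) ^ Nat.log 2 n := by
  have hsub : (hyperbolicCross_finite n).toFinset ⊆
      Finset.univ.image fun φ : Fin (Nat.log 2 n) → Fin n × Fin n =>
        ∑ i, Finsupp.single ((φ i).1 : ℕ) ((φ i).2 : ℕ) := by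
    intro ν hν
    rw [Set.Finite.mem_toFinset] at hν
    obtain ⟨h1, h2⟩ := hν
    have hprod : ν.prod (fun _ a => a + 1) = ∏ k ∈ ν.support, (ν k + 1) := rfl
    have hcard : ν.support.card ≤ Nat.log 2 n := by
      refine Nat.le_log_of_pow_le one_lt_two ((Finset.pow_card_le_prod _ _ _ fun k hk => ?_).trans
        (hprod.symm.le.trans h1))
      have := Finsupp.mem_support_iff.1 hk
      omega
    obtain ⟨φ, hφ⟩ := exists_sum_single_eq hn _ ν hcard fun k hk => by
      have hk0 := Finsupp.mem_support_iff.1 hk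
      constructor
      · by_contra hkn
        exact hk0 (h2 k (by omega))
      · have h3 : ν k + 1 ≤ ∏ k ∈ ν.support, (ν k + 1) :=
          Finset.single_le_prod' (f := fun k => ν k + 1) (fun _ _ => by omega) hk
        rw [hprod] at h1
        omega
    exact Finset.mem_image.2 ⟨φ, Finset.mem_univ _, hφ⟩
  refine (Finset.card_le_card hsub).trans (Finset.card_image_le.trans ?_)
  simp

lemma one_le_log_of_three_le {m : ℕ} (hm : 3 ≤ m) : 1 ≤ Real.log m := by
  rw [Real.le_log_iff_exp_le (by positivity)]
  have h : (3 : ℝ) ≤ m := by exact_mod_cast hm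
  linarith [Real.exp_one_lt_d9]

lemma crossParam_pos {m : ℕ} (hm : 3 ≤ m) : 0 < crossParam m := by
  have := one_le_log_of_three_le hm
  have h : (0 : ℝ) < m := by positivity
  exact Nat.ceil_pos.2 (by positivity)

lemma crossParam_le {m : ℕ} (hm : 3 ≤ m) : crossParam m ≤ m := by
  have := one_le_log_of_three_le hm
  refine Nat.ceil_le.2 (div_le_self (Nat.cast_nonneg _) ?_)
  nlinarith

/-- The logarithm of the size of the index set is of the order `log² m`. -/
lemma numIndices_mul_two_le {m : ℕ} (hm : 3 ≤ m) :
    ((numIndices m * 2 : ℕ) : ℝ) ≤ Real.exp (4 * Real.log m ^ 2) := by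
  have hl := one_le_log_of_three_le hm
  have hm0 : (0 : ℝ) < m := by positivity
  set n := crossParam m with hn
  have hn0 : 0 < n := crossParam_pos hm
  have hnm : n ≤ m := crossParam_le hm
  have h1 : numIndices m ≤ (m * m) ^ Nat.log 2 m := by
    refine (card_hyperbolicCross_le hn0).trans ?_
    calc (n * n) ^ Nat.log 2 n ≤ (m * m) ^ Nat.log 2 n :=
          Nat.pow_le_pow_left (Nat.mul_le_mul hnm hnm) _
      _ ≤ (m * m) ^ Nat.log 2 m := Nat.pow_le_pow_right (by positivity)
          (Nat.log_mono_right hnm)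
  have h2 : ((numIndices m * 2 : ℕ) : ℝ) ≤ ((m : ℝ) * m) ^ Nat.log 2 m * 2 := by
    push_cast
    exact mul_le_mul_of_nonneg_right (by exact_mod_cast h1) zero_le_two
  refine h2.trans ?_
  rw [← Real.log_le_iff_le_exp (by positivity), Real.log_mul (by positivity) two_ne_zero,
    Real.log_pow, Real.log_mul hm0.ne' hm0.ne']
  have h3 : (Nat.log 2 m : ℝ) * Real.log 2 ≤ Real.log m := by
    rw [← Real.log_pow]
    refine Real.log_le_log (by positivity) ?_
    exact_mod_cast Nat.pow_log_le_self 2 (by omega)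
  have h4 := Real.log_two_gt_d9
  have h5 := Real.log_two_lt_d9
  -- Here `1 / log 2 < 1.5`. The exponent is then at most `3 log² m + log 2`, and `log m ≥ 1` bounds
  -- this by `4 log² m`.
  have h6 : (Nat.log 2 m : ℝ) ≤ 1.5 * Real.log m := by
    have : (0 : ℝ) ≤ Nat.log 2 m := Nat.cast_nonneg _
    nlinarith
  nlinarith

/-! ## The error of the random scheme for functions with `ℓ^p`-summable coefficients -/

/-- The Legendre coefficients of `f` have `ℓ^p`-quasinorm at most `M ^ (1/p)`, and those outside of
the hyperbolic cross of parameter `n` are at most `(D / n) ^ (1/p)`. -/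
def SummableCoeffs {V : Type*} [NormedAddCommGroup V] [NormedSpace ℝ V] (p M D : ℝ) (f : L2 V) :
    Prop :=
  (∀ F : Finset (ℕ →₀ ℕ), ∑ ν ∈ F, ‖legendreCoeff ν f‖ ^ p ≤ M) ∧
  ∀ n : ℕ, 1 ≤ n → ∀ ν ∉ hyperbolicCross n, ‖legendreCoeff ν f‖ ^ p ≤ D / n

lemma sum_le_rpow_of_sum_rpow_le {ι : Type*} (s : Finset ι) {a : ι → ℝ} (ha : ∀ i, 0 ≤ a i)
    {p M : ℝ} (hp : 0 < p) (hp1 : p < 1) (hM : 0 < M) (h : ∑ i ∈ s, a i ^ p ≤ M) :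
    ∑ i ∈ s, a i ≤ M ^ (1 / p) := by
  have h1 : ∀ i ∈ s, a i ≤ M ^ (1 / p - 1) * a i ^ p := by
    intro i hi
    have h2 : a i ^ p ≤ M :=
      (Finset.single_le_sum (f := fun i => a i ^ p) (fun _ _ => Real.rpow_nonneg (ha _) _) hi).trans h
    rcases (ha i).eq_or_lt with h0 | h0
    · rw [← h0, Real.zero_rpow hp.ne', mul_zero]
    · have h3 : a i ^ (1 - p) ≤ M ^ (1 / p - 1) := by
        have h4 : a i ^ (1 - p) = (a i ^ p) ^ (1 / p - 1) := by
          rw [← Real.rpow_mul h0.le]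
          congr 1
          field_simp
        rw [h4]
        refine Real.rpow_le_rpow (by positivity) h2 ?_
        rw [sub_nonneg, one_le_div hp]
        exact hp1.le
      calc a i = a i ^ (1 - p) * a i ^ p := by
            rw [← Real.rpow_add h0, sub_add_cancel, Real.rpow_one]
        _ ≤ _ := mul_le_mul_of_nonneg_right h3 (by positivity)
  calc ∑ i ∈ s, a i ≤ ∑ i ∈ s, M ^ (1 / p - 1) * a i ^ p := Finset.sum_le_sum h1
    _ = M ^ (1 / p - 1) * ∑ i ∈ s, a i ^ p := by rw [Finset.mul_sum]
    _ ≤ M ^ (1 / p - 1) * M := mul_le_mul_of_nonneg_left h (by positivity)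
    _ = M ^ (1 / p) := by rw [Real.rpow_sub hM, Real.rpow_one]; field_simp

/-- The ratio `m / log² m`. -/
noncomputable def ratio (m : ℕ) : ℝ := m / Real.log m ^ 2

lemma ratio_pos {m : ℕ} (hm : 3 ≤ m) : 0 < ratio m := by
  have := one_le_log_of_three_le hm
  have h : (0 : ℝ) < m := by positivity
  unfold ratio
  positivity

lemma ratio_le_crossParam (m : ℕ) : ratio m ≤ crossParam m := Nat.le_ceil _

lemma ratio_le {m : ℕ} (hm : 3 ≤ m) : ratio m ≤ m := by
  have := one_le_log_of_three_le hm
  exact div_le_self (Nat.cast_nonneg _) (by nlinarith)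

/-- The truncation error is of the right order. -/
lemma SummableCoeffs.norm_sub_truncation_le (𝕜 : Type*) {V : Type*} [RCLike 𝕜]
    [NormedAddCommGroup V] [InnerProductSpace 𝕜 V] [CompleteSpace V] [NormedSpace ℝ V]
    [IsScalarTower ℝ 𝕜 V] {p M D : ℝ} (hp : 0 < p) (hp1 : p < 1) (hM : 0 < M) (hD : 0 < D)
    {f : L2 V} (hf : SummableCoeffs p M D f) {m : ℕ} (hm : 3 ≤ m) :
    ‖f - ∑ ν ∈ indexSet m, legendreLp ν (legendreCoeff ν f)‖ ≤
      √(D ^ (2 / p - 1) * M) * ratio m ^ (1 / 2 - 1 / p) := by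
  set x := ratio m
  have hx : 0 < x := ratio_pos hm
  have hexp : 0 < 2 / p - 1 := by
    rw [sub_pos, lt_div_iff₀ hp]; linarith
  have h1 : ‖f - ∑ ν ∈ indexSet m, legendreLp ν (legendreCoeff ν f)‖ ^ 2 ≤
      (D / x) ^ (2 / p - 1) * M := by
    refine norm_sub_sum_legendreLp_sq_le 𝕜 f _ fun t ht => ?_
    -- The square is split as `(a^p)^(2/p - 1) · a^p`: the first factor is uniformly small outside
    -- the cross, and the second one is summable.
    have h2 : ∀ ν ∈ t, ‖legendreCoeff ν f‖ ^ 2 ≤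
        (D / x) ^ (2 / p - 1) * ‖legendreCoeff ν f‖ ^ p := by
      intro ν hν
      have hν' : ν ∉ hyperbolicCross (crossParam m) := fun h =>
        ht ν hν ((Set.Finite.mem_toFinset _).2 h)
      have h3 : ‖legendreCoeff ν f‖ ^ p ≤ D / x :=
        (hf.2 _ (crossParam_pos hm) ν hν').trans
          (div_le_div_of_nonneg_left hD.le hx (ratio_le_crossParam m))
      rcases (norm_nonneg (legendreCoeff ν f)).eq_or_lt with h0 | h0
      · rw [← h0, Real.zero_rpow hp.ne']; simp
      · calc ‖legendreCoeff ν f‖ ^ 2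
            = (‖legendreCoeff ν f‖ ^ p) ^ (2 / p - 1) * ‖legendreCoeff ν f‖ ^ p := by
              rw [← Real.rpow_mul h0.le, ← Real.rpow_add h0, ← Real.rpow_two]
              congr 1
              field_simp
              ring
          _ ≤ _ := mul_le_mul_of_nonneg_right
              (Real.rpow_le_rpow (by positivity) h3 hexp.le) (by positivity)
    calc ∑ ν ∈ t, ‖legendreCoeff ν f‖ ^ 2
        ≤ ∑ ν ∈ t, (D / x) ^ (2 / p - 1) * ‖legendreCoeff ν f‖ ^ p := Finset.sum_le_sum h2
      _ = (D / x) ^ (2 / p - 1) * ∑ ν ∈ t, ‖legendreCoeff ν f‖ ^ p := by rw [Finset.mul_sum]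
      _ ≤ _ := mul_le_mul_of_nonneg_left (hf.1 t) (by positivity)
  refine (Real.le_sqrt (norm_nonneg _) (by positivity)).2 h1 |>.trans (le_of_eq ?_)
  have h4 : (D / x) ^ (2 / p - 1) * M =
      D ^ (2 / p - 1) * M * (x ^ (1 / 2 - 1 / p)) ^ 2 := by
    rw [Real.div_rpow hD.le hx.le, ← Real.rpow_natCast, ← Real.rpow_mul hx.le]
    have h5 : (1 / 2 - 1 / p) * ((2 : ℕ) : ℝ) = -(2 / p - 1) := by push_cast; ring
    rw [h5, Real.rpow_neg hx.le]
    ring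
  rw [h4, Real.sqrt_mul (by positivity), Real.sqrt_sq (by positivity)]

lemma sum_indexAt {E : Type*} [AddCommMonoid E] (m : ℕ) (g : (ℕ →₀ ℕ) → E) :
    ∑ j, g (indexAt m j) = ∑ ν ∈ indexSet m, g ν := by
  rw [← Finset.sum_coe_sort (indexSet m)]
  exact Equiv.sum_comp (indexSet m).equivFin.symm fun ν => g ν

lemma indexAt_injective (m : ℕ) : Function.Injective (indexAt m) :=
  Subtype.val_injective.comp (indexSet m).equivFin.symm.injective

lemma norm_truncation_sub_le (𝕜 : Type*) {V : Type*} [RCLike 𝕜] [NormedAddCommGroup V]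
    [InnerProductSpace 𝕜 V] [CompleteSpace V] [NormedSpace ℝ V] [IsScalarTower ℝ 𝕜 V] (f : L2 V)
    (m : ℕ) (z : Fin (numIndices m) → V) {e : ℝ} (he : 0 ≤ e)
    (hz : ∑ j, ‖z j - legendreCoeff (indexAt m j) f‖ ^ 2 ≤ e ^ 2) :
    ‖∑ ν ∈ indexSet m, legendreLp ν (legendreCoeff ν f) - ∑ j, legendreLp (indexAt m j) (z j)‖
      ≤ e := by
  rw [← sum_indexAt m fun ν => legendreLp ν (legendreCoeff ν f), norm_sub_rev,
    ← Finset.sum_sub_distrib]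
  have h1 : ∑ j, (legendreLp (indexAt m j) (z j) -
      legendreLp (indexAt m j) (legendreCoeff (indexAt m j) f)) =
      ∑ j, legendreLp (indexAt m j) (z j - legendreCoeff (indexAt m j) f) :=
    Finset.sum_congr rfl fun j _ => ((legendreIsometry 𝕜 V (indexAt m j)).map_sub _ _).symm
  rw [h1]
  refine (pow_le_pow_iff_left₀ (norm_nonneg _) he two_ne_zero).1 ?_
  rw [norm_sum_fin_legendreLp_sq 𝕜 (indexAt_injective m)]
  exact hz

lemma sum_coeff_indexAt_le {V : Type*} [NormedAddCommGroup V] [NormedSpace ℝ V] {p M D : ℝ}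
    {f : L2 V} (hf : SummableCoeffs p M D f) (m : ℕ) :
    ∑ j, ‖legendreCoeff (indexAt m j) f‖ ^ p ≤ M := by
  rw [sum_indexAt m fun ν => ‖legendreCoeff ν f‖ ^ p]
  exact hf.1 _

/-- The error bound that holds for every matrix. -/
lemma norm_sub_reconstruction_le (𝕜 : Type*) {V : Type*} [RCLike 𝕜] [NormedAddCommGroup V]
    [InnerProductSpace 𝕜 V] [CompleteSpace V] [NormedSpace ℝ V] [IsScalarTower ℝ 𝕜 V]
    {p M D : ℝ} (hp : 0 < p) (hp1 : p < 1) (hM : 0 < M) (hD : 0 < D) {f : L2 V}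
    (hf : SummableCoeffs p M D f) {m : ℕ} (hm : 3 ≤ m) {r : Fin (randomDim m) → ℝ}
    {T : (Fin m → V) → L2 V} (hT : IsL1Reconstruction m r T) :
    ‖f - T (gaussianSampling m r f)‖ ≤
      √(D ^ (2 / p - 1) * M) * ratio m ^ (1 / 2 - 1 / p) + 2 * M ^ (1 / p) := by
  obtain ⟨z, -, hz1, hzT⟩ := hT.exists_eq f
  rw [hzT]
  refine (norm_sub_le_norm_sub_add_norm_sub _
    (∑ ν ∈ indexSet m, legendreLp ν (legendreCoeff ν f)) _).trans
    (add_le_add (hf.norm_sub_truncation_le 𝕜 hp hp1 hM hD hm)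
      (norm_truncation_sub_le 𝕜 f m z (by positivity) ?_))
  refine (sum_norm_sub_sq_le_of_sum_norm_le hz1).trans ?_
  refine pow_le_pow_left₀ (by positivity) (mul_le_mul_of_nonneg_left ?_ zero_le_two) 2
  exact sum_le_rpow_of_sum_rpow_le Finset.univ (fun j => norm_nonneg _) hp hp1 hM
    (sum_coeff_indexAt_le hf m)

/-- The error bound for good matrices. -/
lemma norm_sub_reconstruction_le_of_goodMatrix (𝕜 : Type*) {V : Type*} [RCLike 𝕜] [NormedAddCommGroup V]
    [InnerProductSpace 𝕜 V] [CompleteSpace V] [NormedSpace ℝ V] [IsScalarTower ℝ 𝕜 V]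
    {p M D : ℝ} (hp : 0 < p) (hp1 : p < 1) (hM : 0 < M) (hD : 0 < D) {f : L2 V}
    (hf : SummableCoeffs p M D f) {m : ℕ} (hm : 3 ≤ m) {r : Fin (randomDim m) → ℝ}
    {T : (Fin m → V) → L2 V} (hT : IsL1Reconstruction m r T)
    {k : ℕ} (hk : 1 < k)
    (hr : GoodMatrix k (sensingMatrix m r)) :
    ‖f - T (gaussianSampling m r f)‖ ≤
      √(D ^ (2 / p - 1) * M) * ratio m ^ (1 / 2 - 1 / p) +
        (128 * M) ^ (1 / p) * ((k : ℝ) - 1) ^ (1 / 2 - 1 / p) := by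
  obtain ⟨z, hz0, hz1, hzT⟩ := hT.exists_eq f
  rw [hzT]
  have hK : (0 : ℝ) < k - 1 := by
    rw [sub_pos]; exact_mod_cast hk
  refine (norm_sub_le_norm_sub_add_norm_sub _
    (∑ ν ∈ indexSet m, legendreLp ν (legendreCoeff ν f)) _).trans
    (add_le_add (hf.norm_sub_truncation_le 𝕜 hp hp1 hM hD hm)
      (norm_truncation_sub_le 𝕜 f m z (by positivity) ?_))
  refine (sum_norm_sub_sq_le_rpow hz1 hK (hr.sum_norm_sq_le 𝕜 hz0) hp hp1 hM
    (sum_coeff_indexAt_le hf m)).trans (le_of_eq ?_)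
  rw [mul_pow, ← Real.rpow_natCast, ← Real.rpow_natCast, ← Real.rpow_mul (by positivity),
    ← Real.rpow_mul hK.le]
  congr 2 <;> · push_cast; ring

/-- The constant in the error bound. -/
noncomputable def errorConst (p M D : ℝ) : ℝ :=
  √(D ^ (2 / p - 1) * M) + (128 * M) ^ (1 / p) * 300 ^ (1 / p - 1 / 2) +
    2 * M ^ (1 / p) * (2 * (20 * (1 / p - 1 / 2)) ^ (1 / p - 1 / 2) + 300 ^ (1 / p - 1 / 2))

lemma errorConst_pos {p M D : ℝ} (hp : 0 < p) (hp1 : p < 1) (hM : 0 < M) :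
    0 < errorConst p M D := by
  have hs : 0 < 1 / p - 1 / 2 := by
    rw [sub_pos]; exact one_div_lt_one_div_of_lt hp (by linarith)
  unfold errorConst
  positivity

/-- The measurable hull of `B` has the same measure and provides a measurable majorant; neither `g`
nor `B` has to be measurable. -/
lemma upperExpectation_le_of_le_off {Ω : Type*} [MeasurableSpace Ω] (μ : Measure Ω)
    [IsProbabilityMeasure μ] {g : Ω → ℝ≥0∞} {B : Set Ω} {a b : ℝ≥0∞} (h1 : ∀ ω ∉ B, g ω ≤ a)
    (h2 : ∀ ω, g ω ≤ a + b) : upperExpectation μ g ≤ a + b * μ B := by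
  have hB : MeasurableSet (toMeasurable μ B) := measurableSet_toMeasurable μ B
  refine (iInf₂_le_of_le (fun ω => a + (toMeasurable μ B).indicator (fun _ => b) ω)
    (measurable_const.add (measurable_const.indicator hB))
      (iInf_le_of_le (fun ω => ?_) le_rfl)).trans (le_of_eq ?_)
  · by_cases hω : ω ∈ toMeasurable μ B
    · simp only [Set.indicator_of_mem hω]
      exact h2 ω
    · simp only [Set.indicator_of_notMem hω, add_zero]
      exact h1 ω fun h => hω (subset_toMeasurable μ B h)
  · rw [lintegral_add_left measurable_const, lintegral_const, measure_univ, mul_one,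
      lintegral_indicator_const hB, measure_toMeasurable]

/-- This follows from `y ≤ e^y` at `y = x / (20 s)`, raised to the power `s`. It converts the
failure probability into the convergence rate. -/
lemma exp_neg_le_rpow {s x : ℝ} (hs : 0 < s) (hx : 0 < x) :
    Real.exp (-(x / 20)) ≤ (20 * s) ^ s * x ^ (-s) := by
  have h1 : x / (20 * s) ≤ Real.exp (x / (20 * s)) :=
    (le_add_of_nonneg_right zero_le_one).trans (Real.add_one_le_exp _)
  have h2 : (x / (20 * s)) ^ s ≤ Real.exp (x / 20) := by
    refine (Real.rpow_le_rpow (by positivity) h1 hs.le).trans (le_of_eq ?_)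
    rw [← Real.exp_mul]
    congr 1
    field_simp
  rw [Real.exp_neg, Real.rpow_neg hx.le]
  rw [Real.div_rpow hx.le (by positivity)] at h2
  have h3 : 0 < x ^ s := by positivity
  have h4 : 0 < (20 * s) ^ s := by positivity
  rw [inv_le_comm₀ (Real.exp_pos _) (by positivity), mul_inv, inv_inv]
  rwa [div_eq_inv_mul] at h2

/-- The probability of a bad matrix. -/
lemma stdNormal_not_goodMatrix_le_exp {m : ℕ} (hm : 3 ≤ m) {k : ℕ} (hk : 1 ≤ k)
    (hkm : (k : ℝ) ≤ ratio m / 100) :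
    stdNormal (randomDim m) {r | ¬ GoodMatrix k (sensingMatrix m r)} ≤
      ENNReal.ofReal (2 * Real.exp (-(ratio m / 20))) := by
  refine (stdNormal_not_goodMatrix_le (by omega) k).trans (ENNReal.ofReal_le_ofReal ?_)
  set N := numIndices m
  have hl := one_le_log_of_three_le hm
  have h1 : (N : ℝ) ≤ ((N * 2 : ℕ) : ℝ) ^ k := by
    have h2 : N ≤ (N * 2) ^ k :=
      (Nat.le_mul_of_pos_right N two_pos).trans (Nat.le_self_pow (by omega) _)
    exact_mod_cast h2
  -- With `log (2N) ≤ 4 log² m` and `k ≤ m / (100 log² m)` the union bound costs `m/25`, which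
  -- leaves `9/100 - 1/25 = 1/20` in the exponent.
  have h2 : ((N * 2 : ℕ) : ℝ) ^ k ≤ Real.exp (m / 25) := by
    refine (pow_le_pow_left₀ (Nat.cast_nonneg _) (numIndices_mul_two_le hm) k).trans ?_
    rw [← Real.exp_nat_mul, Real.exp_le_exp]
    have h3 : (k : ℝ) * Real.log m ^ 2 ≤ m / 100 := by
      have h4 := mul_le_mul_of_nonneg_right hkm (sq_nonneg (Real.log m))
      have h5 : ratio m / 100 * Real.log m ^ 2 = m / 100 := by
        unfold ratio
        field_simp
      rwa [h5] at h4
    linarith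
  calc (((N * 2 : ℕ) : ℝ) ^ k + N) * Real.exp (-(9 / 100) * m)
      ≤ (Real.exp (m / 25) + Real.exp (m / 25)) * Real.exp (-(9 / 100) * m) :=
        mul_le_mul_of_nonneg_right (add_le_add h2 (h1.trans h2)) (Real.exp_pos _).le
    _ = 2 * Real.exp (-(m / 20)) := by
        rw [← two_mul, mul_assoc, ← Real.exp_add]
        congr 2
        ring
    _ ≤ 2 * Real.exp (-(ratio m / 20)) := by
        have := ratio_le hm
        gcongr

/-- The error bound in expectation. -/
theorem upperExpectation_worstError_le (𝕜 : Type*) {V : Type*} [RCLike 𝕜] [NormedAddCommGroup V]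
    [InnerProductSpace 𝕜 V] [CompleteSpace V] [NormedSpace ℝ V] [IsScalarTower ℝ 𝕜 V]
    {p M D : ℝ} (hp : 0 < p) (hp1 : p < 1) (hM : 0 < M) (hD : 0 < D) {K : Set (L2 V)}
    (hK : ∀ f ∈ K, SummableCoeffs p M D f) {m : ℕ} (hm : 3 ≤ m)
    {T : (Fin (randomDim m) → ℝ) → (Fin m → V) → L2 V} (hT : ∀ r, IsL1Reconstruction m r (T r)) :
    upperExpectation (stdNormal (randomDim m)) (fun r => worstError m r (T r) K) ≤
      ENNReal.ofReal (errorConst p M D * ratio m ^ (1 / 2 - 1 / p)) := by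
  set x := ratio m with hxdef
  have hx : 0 < x := ratio_pos hm
  set s := 1 / p - 1 / 2 with hs
  have hs0 : 0 < s := by
    rw [hs, sub_pos]; exact one_div_lt_one_div_of_lt hp (by linarith)
  have ha : 1 / 2 - 1 / p = -s := by rw [hs]; ring
  set E₀ := √(D ^ (2 / p - 1) * M) with hE₀
  set E₁ := (128 * M) ^ (1 / p) * 300 ^ s with hE₁
  set E₂ := 2 * M ^ (1 / p) with hE₂
  have hE₀0 : 0 ≤ E₀ := Real.sqrt_nonneg _
  have hE₁0 : 0 ≤ E₁ := by positivity
  have hE₂0 : 0 ≤ E₂ := by positivity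
  have hxs : 0 < x ^ (-s) := by positivity
  have hconst : errorConst p M D = E₀ + E₁ + E₂ * (2 * (20 * s) ^ s + 300 ^ s) := rfl
  have hall : ∀ r, worstError m r (T r) K ≤ ENNReal.ofReal (E₀ * x ^ (-s) + E₂) := by
    intro r
    refine iSup₂_le fun f hf => ?_
    rw [← ofReal_norm]
    refine ENNReal.ofReal_le_ofReal ?_
    have := norm_sub_reconstruction_le 𝕜 hp hp1 hM hD (hK f hf) hm (hT r)
    rwa [ha] at this
  rw [hconst, ha]
  -- For `x < 300` the rate is bounded below and the trivial error bound suffices. For `x ≥ 300` the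
  -- choice `k = ⌊x / 100⌋` satisfies `k - 1 ≥ x / 300`.
  rcases lt_or_ge x 300 with hlt | hge
  · have h1 : upperExpectation (stdNormal (randomDim m)) (fun r => worstError m r (T r) K) ≤
        ENNReal.ofReal (E₀ * x ^ (-s) + E₂) := by
      have h2 := upperExpectation_le_of_le_off (stdNormal (randomDim m)) (B := ∅) (b := 0)
        (fun r _ => hall r) (fun r => (hall r).trans (by rw [add_zero]))
      simpa using h2
    refine h1.trans (ENNReal.ofReal_le_ofReal ?_)
    have h3 : 1 ≤ (300 : ℝ) ^ s * x ^ (-s) := by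
      rw [Real.rpow_neg hx.le, ← div_eq_mul_inv, one_le_div (by positivity)]
      exact Real.rpow_le_rpow hx.le hlt.le hs0.le
    have h4 : E₂ ≤ E₂ * (300 ^ s * x ^ (-s)) := le_mul_of_one_le_right hE₂0 h3
    have h5 : 0 ≤ E₁ * x ^ (-s) := by positivity
    have h6 : 0 ≤ E₂ * (2 * (20 * s) ^ s) * x ^ (-s) := by positivity
    nlinarith
  · set k := ⌊x / 100⌋₊ with hk
    have hkx : (k : ℝ) ≤ x / 100 := Nat.floor_le (by positivity)
    have hkx' : x / 100 < k + 1 := Nat.lt_floor_add_one _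
    have hk3 : 3 ≤ k := Nat.le_floor (by push_cast; linarith)
    have hK1 : x / 300 ≤ (k : ℝ) - 1 := by
      have : (3 : ℝ) ≤ x / 100 := by linarith
      linarith
    have hgood : ∀ r ∉ {r | ¬ GoodMatrix k (sensingMatrix m r)},
        worstError m r (T r) K ≤ ENNReal.ofReal ((E₀ + E₁) * x ^ (-s)) := by
      intro r hr
      have hr' : GoodMatrix k (sensingMatrix m r) := not_not.1 hr
      refine iSup₂_le fun f hf => ?_
      rw [← ofReal_norm]
      refine ENNReal.ofReal_le_ofReal ?_
      have h1 := norm_sub_reconstruction_le_of_goodMatrix 𝕜 hp hp1 hM hD (hK f hf) hm (hT r)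
        (by omega) hr'
      rw [ha] at h1
      have h2 : ((k : ℝ) - 1) ^ (-s) ≤ 300 ^ s * x ^ (-s) := by
        have h3 : ((k : ℝ) - 1) ^ (-s) ≤ (x / 300) ^ (-s) :=
          Real.rpow_le_rpow_of_nonpos (by positivity) hK1 (by linarith)
        refine h3.trans (le_of_eq ?_)
        rw [Real.div_rpow hx.le (by norm_num), Real.rpow_neg (by norm_num : (0 : ℝ) ≤ 300)]
        field_simp
      have h4 : (128 * M) ^ (1 / p) * ((k : ℝ) - 1) ^ (-s) ≤ E₁ * x ^ (-s) := by
        rw [hE₁, mul_assoc]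
        exact mul_le_mul_of_nonneg_left h2 (by positivity)
      rw [add_mul]
      linarith
    have hbound := upperExpectation_le_of_le_off (stdNormal (randomDim m))
      (b := ENNReal.ofReal E₂) hgood (fun r => (hall r).trans (by
        rw [← ENNReal.ofReal_add (by positivity) hE₂0]
        refine ENNReal.ofReal_le_ofReal ?_
        have : 0 ≤ E₁ * x ^ (-s) := by positivity
        linarith))
    refine hbound.trans ?_
    have hprob := stdNormal_not_goodMatrix_le_exp hm (by omega : 1 ≤ k) hkx
    have h2 : ENNReal.ofReal E₂ *
        stdNormal (randomDim m) {r | ¬ GoodMatrix k (sensingMatrix m r)} ≤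
        ENNReal.ofReal (E₂ * (2 * ((20 * s) ^ s * x ^ (-s)))) := by
      rw [ENNReal.ofReal_mul hE₂0]
      refine mul_le_mul_right (hprob.trans (ENNReal.ofReal_le_ofReal ?_)) _
      exact mul_le_mul_of_nonneg_left (exp_neg_le_rpow hs0 hx) zero_le_two
    refine (add_le_add le_rfl h2).trans ?_
    rw [← ENNReal.ofReal_add (by positivity) (by positivity)]
    refine ENNReal.ofReal_le_ofReal ?_
    have h5 : 0 ≤ E₂ * 300 ^ s * x ^ (-s) := by positivity
    nlinarith

/-! ## Positive majorants of monotone `ℓ^p`-sequences -/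

/-- A positive sequence with `β k ^ p` summable and of the order `1 / (k + 1)`. -/
structure IsMajorant (p S : ℝ) (β : ℕ → ℝ) : Prop where
  pos : ∀ k, 0 < β k
  summable : Summable β
  summable_rpow : Summable fun k => β k ^ p
  rpow_le : ∀ k : ℕ, β k ^ p ≤ S / (k + 1)

lemma antitone_monotoneMajorant (z : ℕ → ℝ) : Antitone (monotoneMajorant z) := by
  intro i j hij
  exact iSup₂_le fun l hl => le_iSup₂ (f := fun l (_ : l ≥ i) => ‖z l‖ₑ) l (hij.trans hl)

lemma enorm_le_monotoneMajorant (z : ℕ → ℝ) (i : ℕ) : ‖z i‖ₑ ≤ monotoneMajorant z i :=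
  le_iSup₂ (f := fun l (_ : l ≥ i) => ‖z l‖ₑ) i le_rfl

lemma Antitone.succ_mul_le_tsum {a : ℕ → ℝ} (ha : Antitone a) (h0 : ∀ k, 0 ≤ a k)
    (hs : Summable a) (k : ℕ) : a k ≤ (∑' j, a j) / (k + 1) := by
  rw [le_div_iff₀ (by positivity)]
  calc a k * (k + 1) = ∑ _j ∈ Finset.range (k + 1), a k := by
        rw [Finset.sum_const, Finset.card_range, nsmul_eq_mul]; push_cast; ring
    _ ≤ ∑ j ∈ Finset.range (k + 1), a j := Finset.sum_le_sum fun j hj =>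
        ha (Nat.lt_succ_iff.1 (Finset.mem_range.1 hj))
    _ ≤ ∑' j, a j := hs.sum_le_tsum _ fun j _ => h0 j

lemma exists_isMajorant {p : ℝ} (hp : 0 < p) (hp1 : p < 1) {b : ℕ → ℝ}
    (h : monotoneNorm p b < ∞) : ∃ β S, IsMajorant p S β ∧ ∀ k, b k ≤ β k := by
  have hsum : ∑' i, monotoneMajorant b i ^ p ≠ ∞ := by
    intro htop
    rw [monotoneNorm, htop, ENNReal.top_rpow_of_pos (by positivity)] at h
    exact lt_irrefl _ h
  have hfin : ∀ i, monotoneMajorant b i ≠ ∞ := by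
    intro i hi
    have h1 := ENNReal.ne_top_of_tsum_ne_top hsum i
    rw [hi, ENNReal.top_rpow_of_pos hp] at h1
    exact h1 rfl
  set a : ℕ → ℝ := fun i => (monotoneMajorant b i).toReal with ha
  have ha0 : ∀ i, 0 ≤ a i := fun i => ENNReal.toReal_nonneg
  have haanti : Antitone a := fun i j hij =>
    ENNReal.toReal_mono (hfin i) (antitone_monotoneMajorant b hij)
  have hasum : Summable fun i => a i ^ p := by
    have h1 := ENNReal.summable_toReal hsum
    simpa only [ha, ENNReal.toReal_rpow] using h1
  have hba : ∀ i, b i ≤ a i := by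
    intro i
    have h1 := ENNReal.toReal_mono (hfin i) (enorm_le_monotoneMajorant b i)
    rw [toReal_enorm, Real.norm_eq_abs] at h1
    exact (le_abs_self _).trans h1
  -- The geometric term makes the sequence positive, as required by the radii, which contain `1 / β
  -- k`; it preserves monotonicity and `p`-summability.
  set β : ℕ → ℝ := fun i => a i + (1 / 2 : ℝ) ^ i with hβ
  have hpos : ∀ i, 0 < β i := fun i => add_pos_of_nonneg_of_pos (ha0 i) (by positivity)
  have hanti : Antitone β := fun i j hij =>
    add_le_add (haanti hij) (pow_le_pow_of_le_one (by norm_num) (by norm_num) hij)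
  have hrpow : Summable fun i => β i ^ p := by
    have hgeo : Summable fun i : ℕ => ((1 / 2 : ℝ) ^ p) ^ i :=
      summable_geometric_of_lt_one (by positivity)
        (Real.rpow_lt_one (by norm_num) (by norm_num) hp)
    refine Summable.of_nonneg_of_le (fun i => by have := hpos i; positivity) (fun i => ?_)
      (hasum.add hgeo)
    have h1 := Real.rpow_add_le_add_rpow (ha0 i) (by positivity : (0 : ℝ) ≤ (1 / 2) ^ i) hp.le hp1.le
    have h2 : ((1 / 2 : ℝ) ^ i) ^ p = ((1 / 2 : ℝ) ^ p) ^ i := by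
      rw [← Real.rpow_natCast, ← Real.rpow_natCast, ← Real.rpow_mul (by norm_num),
        ← Real.rpow_mul (by norm_num), mul_comm]
    rwa [h2] at h1
  have hsβ : Summable β := by
    refine Summable.of_nonneg_of_le (fun i => (hpos i).le) (fun i => ?_)
      (hrpow.mul_left (β 0 ^ (1 - p)))
    calc β i = β i ^ (1 - p) * β i ^ p := by
          rw [← Real.rpow_add (hpos i), sub_add_cancel, Real.rpow_one]
      _ ≤ _ := mul_le_mul_of_nonneg_right
        (Real.rpow_le_rpow (hpos i).le (hanti (Nat.zero_le i)) (by linarith))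
        (by have := hpos i; positivity)
  refine ⟨β, ∑' i, β i ^ p, ⟨hpos, hsβ, hrpow, ?_⟩, fun k =>
    (hba k).trans (le_add_of_nonneg_right (by positivity))⟩
  exact Antitone.succ_mul_le_tsum
    (fun i j hij => Real.rpow_le_rpow (hpos j).le (hanti hij) hp.le)
    (fun i => by have := hpos i; positivity) hrpow

/-- The first `k + 1` terms of the monotone norm are each at least `|b k|^p`. Thus one explicit
sequence dominates the whole unit ball. -/
lemma le_rpow_of_monotoneNorm_le_one {p : ℝ} (hp : 0 < p) {b : ℕ → ℝ}
    (h : monotoneNorm p b ≤ 1) (k : ℕ) : b k ≤ ((k : ℝ) + 1) ^ (-(1 / p)) := by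
  have hsum : ∑' i, monotoneMajorant b i ^ p ≤ 1 := by
    refine le_of_not_gt fun hlt => ?_
    exact (ENNReal.one_lt_rpow hlt (by positivity : 0 < 1 / p)).not_ge h
  have h1 : ((k : ℝ≥0∞) + 1) * ‖b k‖ₑ ^ p ≤ 1 := by
    calc ((k : ℝ≥0∞) + 1) * ‖b k‖ₑ ^ p = ∑ _j ∈ Finset.range (k + 1), ‖b k‖ₑ ^ p := by
          rw [Finset.sum_const, Finset.card_range, nsmul_eq_mul]; push_cast; ring
      _ ≤ ∑ j ∈ Finset.range (k + 1), monotoneMajorant b j ^ p := Finset.sum_le_sum fun j hj =>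
          ENNReal.rpow_le_rpow ((enorm_le_monotoneMajorant b k).trans
            (antitone_monotoneMajorant b (Nat.lt_succ_iff.1 (Finset.mem_range.1 hj)))) hp.le
      _ ≤ ∑' j, monotoneMajorant b j ^ p := ENNReal.sum_le_tsum _
      _ ≤ 1 := hsum
  have h2 : ((k : ℝ) + 1) * |b k| ^ p ≤ 1 := by
    have h3 := ENNReal.toReal_mono ENNReal.one_ne_top h1
    rw [ENNReal.toReal_mul, ← ENNReal.toReal_rpow, toReal_enorm, Real.norm_eq_abs,
      ENNReal.toReal_one] at h3
    have h4 : ((k : ℝ≥0∞) + 1).toReal = (k : ℝ) + 1 := by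
      rw [ENNReal.toReal_add (ENNReal.natCast_ne_top k) ENNReal.one_ne_top]
      simp
    rwa [h4] at h3
  have hk : (0 : ℝ) < (k : ℝ) + 1 := by positivity
  have h3 : |b k| ^ p ≤ ((k : ℝ) + 1)⁻¹ := by
    rwa [← one_div, le_div_iff₀ hk, mul_comm]
  calc b k ≤ |b k| := le_abs_self _
    _ = (|b k| ^ p) ^ (1 / p) := by
        rw [← Real.rpow_mul (abs_nonneg _), mul_one_div_cancel hp.ne', Real.rpow_one]
    _ ≤ (((k : ℝ) + 1)⁻¹) ^ (1 / p) := Real.rpow_le_rpow (by positivity) h3 (by positivity)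
    _ = ((k : ℝ) + 1) ^ (-(1 / p)) := by rw [Real.inv_rpow hk.le, Real.rpow_neg hk.le]

lemma isMajorant_rpow {p p' : ℝ} (hp : 0 < p) (hpp' : p < p') (hp' : p' < 1) :
    IsMajorant p' 1 fun k : ℕ => ((k : ℝ) + 1) ^ (-(1 / p)) := by
  have hs : ∀ e : ℝ, e < -1 → Summable fun k : ℕ => ((k : ℝ) + 1) ^ e := by
    intro e he
    have h1 := (summable_nat_add_iff 1).2 (Real.summable_nat_rpow.2 he)
    simpa only [Nat.cast_add, Nat.cast_one] using h1
  have hr : ∀ k : ℕ, (((k : ℝ) + 1) ^ (-(1 / p))) ^ p' = ((k : ℝ) + 1) ^ (-(p' / p)) := by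
    intro k
    rw [← Real.rpow_mul (by positivity)]
    congr 1
    ring
  have h1 : 1 < p' / p := by rwa [one_lt_div hp]
  refine ⟨fun k => by positivity, hs _ ?_, ?_, fun k => ?_⟩
  · rw [neg_lt_neg_iff, one_lt_div hp]
    linarith
  · simp_rw [hr]
    exact hs _ (by linarith)
  · rw [hr, one_div, ← Real.rpow_neg_one]
    exact Real.rpow_le_rpow_of_exponent_le (by linarith [(Nat.cast_nonneg k : (0 : ℝ) ≤ k)])
      (by linarith)

/-- The constants are fixed before the spaces, the embedding and `b`; this makes the final constants
uniform over all Hilbert spaces and over all `b ≤ β`. -/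
lemma IsMajorant.exists_summableCoeffs {p S : ℝ} {β : ℕ → ℝ} (h : IsMajorant p S β) (hp : 0 < p)
    (hp1 : p < 1) :
    ∃ M D : ℝ, 0 < M ∧ 0 < D ∧ ∀ (V W : Type*) [NormedAddCommGroup V] [NormedSpace ℝ V]
      [CompleteSpace V] [NormedAddCommGroup W] [NormedSpace ℂ W] [CompleteSpace W]
      (emb : V →ₗᵢ[ℝ] W) (b : ℕ → ℝ), (∀ k, b k ≤ β k) → ∀ f ∈ holClass emb b,
      SummableCoeffs p M D f := by
  set κ := minRadius β with hκdef
  have hκ : 1 < κ := one_lt_minRadius fun k => (h.pos k).le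
  set A := 8 / (1 - κ⁻¹) ^ 2
  have hA : 0 ≤ A := by positivity
  have hβ0 : ∀ k, 0 ≤ β k := fun k => (h.pos k).le
  have hmul : ∀ k, (A * β k) ^ p = A ^ p * β k ^ p := fun k => Real.mul_rpow hA (hβ0 k)
  have hs : Summable fun k => (A * β k) ^ p := by
    simp_rw [hmul]
    exact h.summable_rpow.mul_left _
  have hM : ∀ k : ℕ, (A * β k) ^ p ≤ A ^ p * S / (k + 1) := by
    intro k
    rw [hmul, mul_div_assoc]
    exact mul_le_mul_of_nonneg_left (h.rpow_le k) (by positivity)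
  set D₀ := (1 + A ^ p * S * ∑' j : ℕ, ((j : ℝ) + 1) * (κ⁻¹ ^ p) ^ (j - 1)) *
    majorantConst A κ p β with hD₀
  refine ⟨majorantConst A κ p β + 1, max D₀ 1, ?_, lt_max_of_lt_right one_pos, ?_⟩
  · have : 0 ≤ majorantConst A κ p β := majorantConst_nonneg
    linarith
  intro V W _ _ _ _ _ _ emb b hb f hf
  obtain ⟨g, hg, hfg⟩ := hf
  have hc : ∀ ν, ‖legendreCoeff ν f‖ ^ p ≤ coeffMajorant A κ β ν ^ p := by
    intro ν
    rw [legendreCoeff_congr hfg]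
    exact Real.rpow_le_rpow (norm_nonneg _) (norm_legendreCoeff_le h.pos h.summable hb hg ν) hp.le
  refine ⟨fun F => ?_, fun n hn ν hν => ?_⟩
  · have h1 := sum_coeffMajorant_rpow_le hA hκ hp hp1 hβ0 hs F
    have h2 := Finset.sum_le_sum fun ν (_ : ν ∈ F) => hc ν
    linarith
  · refine (hc ν).trans ((coeffMajorant_rpow_le_of_notMem hA hκ hp hp1 hβ0 hs hM hn hν).trans ?_)
    exact div_le_div_of_nonneg_right (le_max_left _ _) (Nat.cast_nonneg n)

/-! ## The two error bounds -/

/-- The bound for a fixed sequence `b`. -/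
theorem exists_const_holClass {p : ℝ} (hp : 0 < p) (hp1 : p < 1) {b : ℕ → ℝ}
    (hb : monotoneNorm p b < ∞) :
    ∃ c : ℝ, 0 < c ∧ ∀ (𝕜 V W : Type*) [RCLike 𝕜] [NormedAddCommGroup V] [InnerProductSpace 𝕜 V]
      [CompleteSpace V] [NormedSpace ℝ V] [IsScalarTower ℝ 𝕜 V]
      [NormedAddCommGroup W] [NormedSpace ℂ W] [CompleteSpace W] (emb : V →ₗᵢ[ℝ] W) (m : ℕ),
      3 ≤ m → ∀ T : (Fin (randomDim m) → ℝ) → (Fin m → V) → L2 V,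
      (∀ r, IsL1Reconstruction m r (T r)) →
      upperExpectation (stdNormal (randomDim m)) (fun r => worstError m r (T r) (holClass emb b)) ≤
        ENNReal.ofReal (c * ((m : ℝ) / Real.log m ^ 2) ^ (1 / 2 - 1 / p)) := by
  obtain ⟨β, S, hβ, hbβ⟩ := exists_isMajorant hp hp1 hb
  obtain ⟨M, D, hM, hD, hcoeff⟩ := hβ.exists_summableCoeffs hp hp1
  refine ⟨errorConst p M D, errorConst_pos hp hp1 hM, ?_⟩
  intro 𝕜 V W _ _ _ _ _ _ _ _ _ emb m hm T hT
  exact upperExpectation_worstError_le 𝕜 hp hp1 hM hD (hcoeff V W emb b hbβ) hm hT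

/-- The factor `log^{2s} m` is absorbed by a power of `m`: with `log m ≤ m^ε / ε` and `2 s ε = s -
t` the exponents match exactly. -/
lemma exists_ratio_rpow_le {s t : ℝ} (ht : 0 < t) (hts : t < s) :
    ∃ C : ℝ, 0 < C ∧ ∀ m : ℕ, 3 ≤ m → ratio m ^ (-s) ≤ C * (m : ℝ) ^ (-t) := by
  have hs : 0 < s := ht.trans hts
  set ε := (s - t) / (2 * s) with hε
  have hε0 : 0 < ε := div_pos (by linarith) (by linarith)
  refine ⟨(1 / ε) ^ (2 * s), by positivity, fun m hm => ?_⟩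
  have hl := one_le_log_of_three_le hm
  have hm0 : (0 : ℝ) < m := by positivity
  have h1 : Real.log m ≤ (1 / ε) * (m : ℝ) ^ ε := by
    have := Real.log_le_rpow_div hm0.le hε0
    rwa [div_eq_inv_mul, ← one_div] at this
  have h2 : ratio m ^ (-s) = (m : ℝ) ^ (-s) * Real.log m ^ (2 * s) := by
    rw [ratio, Real.div_rpow hm0.le (by positivity), ← Real.rpow_natCast,
      ← Real.rpow_mul (by linarith), Real.rpow_neg hm0.le, mul_neg, Real.rpow_neg (by linarith)]
    push_cast
    rw [div_inv_eq_mul]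
  rw [h2]
  calc (m : ℝ) ^ (-s) * Real.log m ^ (2 * s)
      ≤ (m : ℝ) ^ (-s) * ((1 / ε) * (m : ℝ) ^ ε) ^ (2 * s) := by gcongr
    _ = (1 / ε) ^ (2 * s) * (m : ℝ) ^ (-t) := by
        rw [Real.mul_rpow (by positivity) (by positivity), ← Real.rpow_mul hm0.le,
          mul_left_comm, ← Real.rpow_add hm0]
        congr 2
        rw [hε]
        field_simp
        ring

/-- The bound for the union of the classes over the unit ball of the monotone `ℓ^p`-space. -/
theorem exists_const_holClassMonotone {p q : ℝ} (hp : 0 < p) (hpq : p < q) (hq : q < 1) :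
    ∃ c : ℝ, 0 < c ∧ ∀ (𝕜 V W : Type*) [RCLike 𝕜] [NormedAddCommGroup V] [InnerProductSpace 𝕜 V]
      [CompleteSpace V] [NormedSpace ℝ V] [IsScalarTower ℝ 𝕜 V]
      [NormedAddCommGroup W] [NormedSpace ℂ W] [CompleteSpace W] (emb : V →ₗᵢ[ℝ] W) (m : ℕ),
      3 ≤ m → ∀ T : (Fin (randomDim m) → ℝ) → (Fin m → V) → L2 V,
      (∀ r, IsL1Reconstruction m r (T r)) →
      upperExpectation (stdNormal (randomDim m))
          (fun r => worstError m r (T r) (holClassMonotone emb p)) ≤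
        ENNReal.ofReal (c * (m : ℝ) ^ (1 / 2 - 1 / q)) := by
  -- Above `p`, the dominating sequence is `p'`-summable; below `q`, the rate for `p'` leaves room
  -- for the logarithm.
  set p' := (p + q) / 2 with hp'
  have h1 : p < p' := by rw [hp']; linarith
  have h2 : p' < q := by rw [hp']; linarith
  have h0 : 0 < p' := hp.trans h1
  obtain ⟨M, D, hM, hD, hcoeff⟩ :=
    (isMajorant_rpow hp h1 (h2.trans hq)).exists_summableCoeffs h0 (h2.trans hq)
  have hqt : 0 < 1 / q - 1 / 2 := by
    rw [sub_pos]; exact one_div_lt_one_div_of_lt (hp.trans hpq) (by linarith)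
  obtain ⟨C, hC, hratio⟩ := exists_ratio_rpow_le (s := 1 / p' - 1 / 2) hqt
    (sub_lt_sub_right (one_div_lt_one_div_of_lt h0 h2) _)
  have hE := errorConst_pos (D := D) h0 (h2.trans hq) hM
  refine ⟨errorConst p' M D * C, mul_pos hE hC, ?_⟩
  intro 𝕜 V W _ _ _ _ _ _ _ _ _ emb m hm T hT
  refine (upperExpectation_worstError_le 𝕜 h0 (h2.trans hq) hM hD (K := holClassMonotone emb p)
    (fun f hf => ?_) hm hT).trans (ENNReal.ofReal_le_ofReal ?_)
  · obtain ⟨b, -, hb1, hf⟩ := hf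
    exact hcoeff V W emb b (le_rpow_of_monotoneNorm_le_one hp hb1) f hf
  · have h3 := hratio m hm
    rw [neg_sub, neg_sub] at h3
    rw [mul_assoc]
    exact mul_le_mul_of_nonneg_left h3 hE.le

end HolApprox

/-! ### The main theorem -/

open HolApprox in
theorem theorem4p4 :
    -- the constants come first: they depend on `b` and `p`, respectively on `p` and `q`, only
    ∃ (ca : (ℕ → ℝ) → ℝ → ℝ) (cb : ℝ → ℝ → ℝ), (∀ b p, 0 < ca b p) ∧ (∀ p q, 0 < cb p q) ∧
    -- a nontrivial real or complex Hilbert space `V`, embedded in a complex Banach space `W`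
    ∀ (𝕜 V W : Type*) [RCLike 𝕜] [NormedAddCommGroup V] [InnerProductSpace 𝕜 V] [CompleteSpace V]
      [Nontrivial V] [NormedSpace ℝ V] [IsScalarTower ℝ 𝕜 V]
      [NormedAddCommGroup W] [NormedSpace ℂ W] [CompleteSpace W] (emb : V →ₗᵢ[ℝ] W)
      (m : ℕ), 3 ≤ m →
    -- the sampling operator is bounded, linear and independent of `b`, `p`, `q`
    (∀ r, IsBoundedLinearMap 𝕜 (gaussianSampling (V := V) m r)) ∧
    (∀ (Y : NormedSubspace 𝕜 (L2 V)), Y.ContinuouslyEmbedded → ∀ r,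
      IsBoundedLinear Y (fun f : Y.carrier => gaussianSampling m r (f : L2 V)) ∧
      IsSamplingOperator Y (fun f : Y.carrier => gaussianSampling m r (f : L2 V))) ∧
    -- the reconstruction map is independent of `b`, `p`, `q`
    ∃ T : (Fin (randomDim m) → ℝ) → (Fin m → V) → L2 V, (∀ r, IsL1Reconstruction m r (T r)) ∧
    -- (a)
    (∀ (p : ℝ) (b : ℕ → ℝ), 0 < p → p < 1 → (∀ k, 0 ≤ b k) → monotoneNorm p b < ∞ →
      upperExpectation (stdNormal (randomDim m)) (fun r => worstError m r (T r) (holClass emb b)) ≤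
        ENNReal.ofReal (ca b p * ((m : ℝ) / Real.log m ^ 2) ^ (1 / 2 - 1 / p))) ∧
    -- (b)
    (∀ (p q : ℝ), 0 < p → p < q → q < 1 →
      (∀ (Y : NormedSubspace 𝕜 (L2 V)), Y.ContinuouslyEmbedded →
        holClassMonotone emb p ⊆ (Y.carrier : Set (L2 V)) →
        adaptiveWidth Y (holClassMonotone emb p) m ≤
          upperExpectation (stdNormal (randomDim m))
            (fun r => worstError m r (T r) (holClassMonotone emb p))) ∧
      upperExpectation (stdNormal (randomDim m))
          (fun r => worstError m r (T r) (holClassMonotone emb p)) ≤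
        ENNReal.ofReal (cb p q * (m : ℝ) ^ (1 / 2 - 1 / q))) := by
  classical
  -- The constants are chosen for each pair of parameters before any space is introduced; the value
  -- `1` outside the admissible range only keeps them positive.
  refine ⟨fun b p => if h : 0 < p ∧ p < 1 ∧ monotoneNorm p b < ∞ then
      (exists_const_holClass h.1 h.2.1 h.2.2).choose else 1,
    fun p q => if h : 0 < p ∧ p < q ∧ q < 1 then
      (exists_const_holClassMonotone h.1 h.2.1 h.2.2).choose else 1, fun b p => ?_, fun p q => ?_, ?_⟩
  · beta_reduce
    split_ifs with h
    · exact (exists_const_holClass h.1 h.2.1 h.2.2).choose_spec.1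
    · exact one_pos
  · beta_reduce
    split_ifs with h
    · exact (exists_const_holClassMonotone h.1 h.2.1 h.2.2).choose_spec.1
    · exact one_pos
  intro 𝕜 V W _ _ _ _ _ _ _ _ _ _ emb m hm
  refine ⟨isBoundedLinearMap_gaussianSampling 𝕜 m, fun Y hY r =>
    ⟨isBoundedLinear_gaussianSampling 𝕜 hY m r, isSamplingOperator_gaussianSampling 𝕜 hY m r⟩, ?_⟩
  choose T hT using exists_isL1Reconstruction 𝕜 (V := V) m
  refine ⟨T, hT, fun p b hp hp1 _ hb => ?_, fun p q hp hpq hq => ⟨fun Y hY _ =>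
    adaptiveWidth_le_upperExpectation 𝕜 hY _ m T, ?_⟩⟩
  · beta_reduce
    rw [dif_pos ⟨hp, hp1, hb⟩]
    exact (exists_const_holClass hp hp1 hb).choose_spec.2 𝕜 V W emb m hm T hT
  · beta_reduce
    rw [dif_pos ⟨hp, hpq, hq⟩]
    exact (exists_const_holClassMonotone hp hpq hq).choose_spec.2 𝕜 V W emb m hm T hT
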